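/- **Notation.** For a finite directed graph $G=(V,E)$ with arc weights $w:E\to\mathbb R$ let $$P(G,w)=\Big\{y\in\mathbb R^E:\ \sum_{(u,v)\in E}y_{uv}-\sum_{(v,u)\in E}y_{vu}=0\ \ (u\in V),\quad \sum_{e\in E}w_ey_e=-1,\quad y\ge 0\Big\}.$$ Let $\mathcal V(P)$ be the set of extreme points of $P$, and $\mathcal D(P)$ the set of its extreme directions. Here a direction is a vector $d$ with $x+\mu d\in P$ for all $x\in P$, $\mu\ge 0$; it is extreme if $d\neq 0$ and $d=\mu_1d_1+\mu_2d_2$ with $\mu_1,\mu_2>0$ and directions $d_1,d_2$ is possible only if $d_1,d_2$ span the same ray as $d$. Extreme directions are normalized by $\sum_{e}d_e=1$. **The graph of a CNF formula.** Let $\phi=C_1\wedge\dots\wedge C_m$ be a CNF formula in the variables $x_1,\dots,x_n$, each clause being a set of literals. The weighted directed graph $(G,w)$ of $\phi$ has distinct vertices $v_0,\dots,v_n=v'_0,v'_1,\dots,v'_m$ and, for every occurrence $o$ of a literal $\ell$ in a clause $C_j$, two vertices $a(o),b(o)$ and two paths $p(o)\to a(o)\to b(o)\to q(o)$ with arc weights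 $\frac12,-\frac12,0$ and $r(o)\to b(o)\to a(o)\to s(o)$ with arc weights $0,-\frac12,\frac12$, where $r(o)=v'_{j-1}$ and $s(o)=v'_j$. For each literal $\ell\in\{x_i,\overline x_i\}$ the paths $p(o)\to a(o)\to b(o)\to q(o)$ of all its occurrences $o$ are concatenated, in the order of the clauses, to a chain from $v_{i-1}$ to $v_i$ whose intermediate end points are new vertices (if $\ell$ does not occur, there is no such chain). Finally there is the arc $(v'_m,v_0)$ of weight $-1$. **Proposition 1.** For the weighted directed graphs $(G,w)$ of CNF formulas, both the set $\mathcal D(P(G,w))$ and the set $\mathcal V(P(G,w))\cup\mathcal D(P(G,w))$ can be generated in incremental polynomial time. That is, for each of the two sets there are an algorithm and a polynomial $q$ such that, given as input such a graph $(G,w)$ (with any numbering of its vertices and arcs), the algorithm outputs every element of the set exactly once and then halts, and for every $k$, whenever exactly $k$ elements have been output so far (also between the last output and halting), at most $q(|V|+|E|+k)$ steps have been made. -/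

import Mathlib

/-! ### Polyhedra: extreme directions -/

namespace NegFlow

/-- `d` is a direction of `P`: `x + μ d ∈ P` whenever `x ∈ P` and `μ ≥ 0`. -/
def IsDirection {ι : Type} (P : Set (ι → ℝ)) (d : ι → ℝ) : Prop :=
  ∀ x ∈ P, ∀ μ : ℝ, 0 ≤ μ → x + μ • d ∈ P

/-- `d` is an extreme direction of `P`: a nonzero direction that is a conic combination of two
directions only if both of them span the same ray as `d`. -/
def IsExtremeDirection {ι : Type} (P : Set (ι → ℝ)) (d : ι → ℝ) : Prop :=
  d ≠ 0 ∧ IsDirection P d ∧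
    ∀ d₁ d₂ : ι → ℝ, IsDirection P d₁ → IsDirection P d₂ →
      ∀ μ₁ μ₂ : ℝ, 0 < μ₁ → 0 < μ₂ → d = μ₁ • d₁ + μ₂ • d₂ →
        SameRay ℝ d₁ d ∧ SameRay ℝ d₂ d

/-- The set `𝒟(P)` for a polyhedron `P` in the nonnegative orthant. An extreme direction is only
determined up to a positive factor; the representative with coordinate sum `1` is chosen. -/
def extremeDirections {ι : Type} [Fintype ι] (P : Set (ι → ℝ)) : Set (ι → ℝ) :=
  {d | IsExtremeDirection P d ∧ ∑ e, d e = 1}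

/-! ### Weighted directed graphs and the polyhedron of negative-weight flows -/

/-- A finite directed graph with rational arc weights, its vertices and arcs being numbered. -/
structure WDigraph where
  /-- number of vertices -/
  nV : ℕ
  /-- number of arcs -/
  nE : ℕ
  /-- tail of an arc -/
  src : Fin nE → Fin nV
  /-- head of an arc -/
  tgt : Fin nE → Fin nV
  /-- weight of an arc -/
  wt : Fin nE → ℚ

/-- The polyhedron `P(G, w)`: nonnegative circulations of total weight `-1`. -/
def WDigraph.polyhedron (G : WDigraph) : Set (Fin G.nE → ℝ) :=
  {y | (∀ u : Fin G.nV,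
          (∑ e with G.src e = u, y e) - (∑ e with G.tgt e = u, y e) = 0) ∧
       (∑ e, (G.wt e : ℝ) * y e = -1) ∧
       ∀ e, 0 ≤ y e}

/-- The vertices (extreme points) `𝒱(P(G, w))`. -/
def WDigraph.verts (G : WDigraph) : Set (Fin G.nE → ℝ) :=
  Set.extremePoints ℝ G.polyhedron

/-- The extreme directions `𝒟(P(G, w))`. -/
def WDigraph.dirs (G : WDigraph) : Set (Fin G.nE → ℝ) :=
  extremeDirections G.polyhedron

/-! ### The weighted graph of a CNF formula -/

/-- A literal over `x_0, …, x_{n-1}`: a variable and its sign (`true` for positive). -/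
abbrev Literal (n : ℕ) : Type := Fin n × Bool

/-- A CNF formula with `n` variables and `m` clauses, each clause being a set of literals. -/
abbrev CNF (n m : ℕ) : Type := Fin m → Finset (Literal n)

namespace CNF

variable {n m : ℕ}

/-- The literal occurrences: pairs of a clause and a literal of that clause. -/
def Occ (φ : CNF n m) : Type := {o : Fin m × Literal n // o.2 ∈ φ o.1}

/-- The number of clauses in which a literal occurs. -/
def occCount (φ : CNF n m) (l : Literal n) : ℕ :=
  (Finset.univ.filter fun j => l ∈ φ j).card

/-- The number of occurrences of the same literal in earlier clauses. -/
def occRank (φ : CNF n m) (o : Occ φ) : ℕ :=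
  (Finset.univ.filter fun j => j < o.1.1 ∧ o.1.2 ∈ φ j).card

/-- The vertices of the graph. `varV i` for `0 ≤ i ≤ n` are the vertices at the ends of the
variable gadgets; `clauseV j` is the vertex at the end of the gadget of clause `j`;
`nodeA o`, `nodeB o` are the two inner vertices of an occurrence `o`, already identified for its
two paths; `link l k` is the vertex between the `k`-th and the `(k+1)`-st path in the chain of
the literal `l`. -/
inductive Vertex (φ : CNF n m) : Type
  | varV (i : Fin (n + 1))
  | clauseV (j : Fin m)
  | nodeA (o : Occ φ)
  | nodeB (o : Occ φ)
  | link (l : Literal n) (k : ℕ) (hk : 0 < k ∧ k < occCount φ l)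

/-- The arcs of the graph. An occurrence `o` has a path `p → a → b → q` in the chain of its
literal and a path `r → b → a → s` in the gadget of its clause; `back` is the closing arc. -/
inductive Arc (φ : CNF n m) : Type
  | arcPA (o : Occ φ)
  | arcAB (o : Occ φ)
  | arcBQ (o : Occ φ)
  | arcRB (o : Occ φ)
  | arcBA (o : Occ φ)
  | arcAS (o : Occ φ)
  | back

/-- The vertex of the chain of `l` after its first `k` paths. For `l = x_i` or its negation the
chain runs from `varV i` to `varV (i + 1)`. -/
def chainNode (φ : CNF n m) (l : Literal n) (k : ℕ) : Vertex φ :=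
  if h0 : k = 0 then .varV l.1.castSucc
  else if h : k < occCount φ l then .link l k ⟨Nat.pos_of_ne_zero h0, h⟩
  else .varV l.1.succ

/-- The vertex reached after the gadgets of the first `j` clauses; before the first clause this
is the last vertex of the variable part. -/
def clauseNode (φ : CNF n m) (j : Fin (m + 1)) : Vertex φ :=
  Fin.cases (.varV (Fin.last n)) (fun i => .clauseV i) j

/-- Tail of an arc. -/
def arcSrc (φ : CNF n m) : Arc φ → Vertex φ
  | .arcPA o => chainNode φ o.1.2 (occRank φ o)
  | .arcAB o => .nodeA o
  | .arcBQ o => .nodeB o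
  | .arcRB o => clauseNode φ o.1.1.castSucc
  | .arcBA o => .nodeB o
  | .arcAS o => .nodeA o
  | .back => clauseNode φ (Fin.last m)

/-- Head of an arc. -/
def arcTgt (φ : CNF n m) : Arc φ → Vertex φ
  | .arcPA o => .nodeA o
  | .arcAB o => .nodeB o
  | .arcBQ o => chainNode φ o.1.2 (occRank φ o + 1)
  | .arcRB o => .nodeB o
  | .arcBA o => .nodeA o
  | .arcAS o => clauseNode φ o.1.1.succ
  | .back => .varV 0

/-- Weight of an arc. -/
def arcWt (φ : CNF n m) : Arc φ → ℚ
  | .arcPA _ => 1 / 2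
  | .arcAB _ => -1 / 2
  | .arcBQ _ => 0
  | .arcRB _ => 0
  | .arcBA _ => -1 / 2
  | .arcAS _ => 1 / 2
  | .back => -1

end CNF

/-- `G` is the weighted graph of the formula `φ`, with some numbering of vertices and arcs. -/
def WDigraph.IsGraphOf (G : WDigraph) {n m : ℕ} (φ : CNF n m) : Prop :=
  ∃ (fV : Fin G.nV ≃ CNF.Vertex φ) (fE : Fin G.nE ≃ CNF.Arc φ),
    ∀ e, fV (G.src e) = CNF.arcSrc φ (fE e) ∧ fV (G.tgt e) = CNF.arcTgt φ (fE e) ∧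
      G.wt e = CNF.arcWt φ (fE e)

/-- The weighted graphs that arise from CNF formulas. -/
def cnfGraphs : Set WDigraph :=
  {G | ∃ (n m : ℕ) (φ : CNF n m), G.IsGraphOf φ}

/-! ### Machine model: first-order call-by-value programs on binary trees, with a step count -/

/-- The data: binary trees. -/
inductive Data : Type
  | nil
  | cons (hd tl : Data)

/-- Number of nodes of a tree. -/
def Data.size : Data → ℕ
  | .nil => 1
  | .cons a b => a.size + b.size + 1

/-- Program terms. Variables are counted from the innermost binder outwards. -/
inductive Term : Type
  /-- value of a variable -/
  | var (i : ℕ)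
  /-- the tree `nil` -/
  | nil
  /-- build a tree -/
  | cons (a b : Term)
  /-- case distinction; in `c` variable `0` is the left and variable `1` the right subtree -/
  | cases (s a c : Term)
  /-- local definition; in `body` variable `0` is the value of `e` -/
  | letIn (e body : Term)
  /-- call of the function with number `f` -/
  | call (f : ℕ) (arg : Term)
  /-- write the value of `e` to the output -/
  | emit (e : Term)

/-- A program is a finite list of (mutually recursive) function bodies, each with one argument;
the function with number `0` is the main function. -/
abbrev Program : Type := List Term

/-- What a run does, step by step: `none` is a silent step, `some d` a step that completes the
output of `d`. The number of steps is the length of the list. -/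
abbrev Trace : Type := List (Option Data)

/-- The outputs of a (part of a) run, in their order. -/
def Trace.outputs (t : Trace) : List Data := t.filterMap id

/-- `Eval p env e t v`: with the values `env` of the variables, the term `e` evaluates to `v`, and
the steps of this evaluation are `t`. Every node of a term that is evaluated takes one step, and
writing a tree takes as many additional steps as the tree has nodes. -/
inductive Eval (p : Program) : List Data → Term → Trace → Data → Prop
  | var {env : List Data} {i : ℕ} {v : Data} :
      env[i]? = some v → Eval p env (.var i) [none] v
  | nil {env : List Data} : Eval p env .nil [none] .nil
  | cons {env : List Data} {a b : Term} {t₁ t₂ : Trace} {u v : Data} :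
      Eval p env a t₁ u → Eval p env b t₂ v →
      Eval p env (.cons a b) (t₁ ++ t₂ ++ [none]) (.cons u v)
  | casesNil {env : List Data} {s a c : Term} {t₁ t₂ : Trace} {v : Data} :
      Eval p env s t₁ .nil → Eval p env a t₂ v →
      Eval p env (.cases s a c) (t₁ ++ [none] ++ t₂) v
  | casesCons {env : List Data} {s a c : Term} {t₁ t₂ : Trace} {x y v : Data} :
      Eval p env s t₁ (.cons x y) → Eval p (x :: y :: env) c t₂ v →
      Eval p env (.cases s a c) (t₁ ++ [none] ++ t₂) v
  | letIn {env : List Data} {e body : Term} {t₁ t₂ : Trace} {u v : Data} :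
      Eval p env e t₁ u → Eval p (u :: env) body t₂ v →
      Eval p env (.letIn e body) (t₁ ++ [none] ++ t₂) v
  | call {env : List Data} {f : ℕ} {arg body : Term} {t₁ t₂ : Trace} {u v : Data} :
      Eval p env arg t₁ u → p[f]? = some body → Eval p [u] body t₂ v →
      Eval p env (.call f arg) (t₁ ++ [none] ++ t₂) v
  | emit {env : List Data} {e : Term} {t : Trace} {v : Data} :
      Eval p env e t v →
      Eval p env (.emit e) (t ++ List.replicate v.size none ++ [some v]) v

/-- The program `p`, started on the input `x`, halts after the steps `t`. -/
def Program.RunsOn (p : Program) (x : Data) (t : Trace) : Prop :=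
  ∃ v, Eval p [x] (.call 0 (.var 0)) t v

/-! ### Input and output format -/

/-- A list of trees as a tree. -/
def Data.ofList : List Data → Data
  | [] => .nil
  | a :: l => .cons a (Data.ofList l)

/-- A natural number, in unary. -/
def Data.ofNat (k : ℕ) : Data := Data.ofList (List.replicate k .nil)

/-- The fraction `± a / b` (`neg` tells the sign). -/
def Data.frac (neg : Bool) (a b : ℕ) : Data :=
  .cons (if neg then .cons .nil .nil else .nil) (.cons (.ofNat a) (.ofNat b))

/-- The input: the number of vertices and the list of arcs `((tail, head), weight)`. -/
def WDigraph.encode (G : WDigraph) : Data :=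
  .cons (.ofNat G.nV)
    (.ofList (List.ofFn fun e : Fin G.nE =>
      .cons (.cons (.ofNat (G.src e)) (.ofNat (G.tgt e)))
        (.frac (decide (G.wt e < 0)) (G.wt e).num.natAbs (G.wt e).den)))

/-- The tree `d` is a fraction whose value is `r`. -/
def Data.IsNumber (d : Data) (r : ℝ) : Prop :=
  ∃ (neg : Bool) (a b : ℕ), b ≠ 0 ∧ d = .frac neg a b ∧
    r = (if neg then -1 else 1) * ((a : ℝ) / (b : ℝ))

/-- The tree `d` is the list of the coordinates of the vector `x`. -/
def Data.IsVector {k : ℕ} (d : Data) (x : Fin k → ℝ) : Prop :=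
  ∃ f : Fin k → Data, d = .ofList (List.ofFn f) ∧ ∀ i, (f i).IsNumber (x i)

/-! ### Generation in incremental polynomial time -/

/-- For the graphs `G` in the class `𝒢`, the finite sets `S G` of vectors can be generated in
incremental polynomial time: one program writes, for every `G` in `𝒢`, each element of `S G`
exactly once and then halts, and there is one polynomial `q` such that whenever only `k` elements
have been written so far, at most `q (|V| + |E| + k)` steps have been made. -/
def GeneratedInIncrementalPolyTime (𝒢 : Set WDigraph)
    (S : (G : WDigraph) → Set (Fin G.nE → ℝ)) : Prop :=
  ∃ (p : Program) (q : Polynomial ℕ), ∀ G ∈ 𝒢, ∃ t : Trace,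
    p.RunsOn G.encode t ∧
    (∃ L : List (Fin G.nE → ℝ), L.Nodup ∧ (∀ x, x ∈ L ↔ x ∈ S G) ∧
      List.Forall₂ Data.IsVector t.outputs L) ∧
    ∀ t' : Trace, t' <+: t → t'.length ≤ q.eval (G.nV + G.nE + t'.outputs.length)

end NegFlow

/-!
Every circulation is a nonnegative combination of simple cycles. Hence the extreme points of the
polyhedron are the normalized simple cycles of negative weight (`WDigraph.mem_verts_iff`), and, if
the polyhedron is not empty, its extreme directions are the normalized simple cycles of weight zero
and the weightless combinations of a negative and a positive cycle whose union contains no third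
cycle (`WDigraph.mem_dirs_iff`).

All simple cycles of a graph can be listed with polynomial delay by backtracking, where a path is
kept only if it extends to a cycle: each step finds a cycle or lengthens the path on top of the stack
(`Gen.Inv.next_length`). Whenever a cycle has been found, all vectors that come from the cycles known
so far are written, unless they have been written before. Here the known cycles are the cycles found,
all cycles of length two, and all cycles that consist of a segment of a cycle found and one more arc
(`Gen.closure`). The time up to any moment is polynomial in the size of the graph and the number of
cycles found (`Gen.exists_program`).

It remains to see that, for the graph of a formula, the number of cycles found is polynomially
bounded in the size of the graph and the number of extreme directions written
(`WDigraph.Numbering.length_le`). The weights are such that a negative cycle which is neither the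
closing arc alone nor the pair `a → b`, `b → a` of an occurrence goes once through the variable part
and once through the gadgets of all clauses. At an arc `a → b` that it uses in the variable part and
at the path through the gadget of the same clause it can be cut into two segments, which become
cycles of weight `≥ 0` when an arc is added to each (`CNF.Cyc.exists_split`). So the negative cycles
are polynomially few compared to the known cycles of weight `≥ 0`. The latter yield different extreme
directions: a cycle of weight zero is one by itself, and a positive cycle forms one together with the
pair of any occurrence whose outer arcs it does not all use (`CNF.Cyc.eq_or_eq_of_subset`). At most
two cycles use the outer arcs of all occurrences (`CNF.Cyc.mem_iff_of_outer`), so that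
`WDigraph.Numbering.card_nonnegSets_le` holds.

In the machine model, the enumeration is not written as a program but assembled: `PolyTime` functions
on encoded types are closed under composition, case distinction and bounded iteration, and
`exists_generator` turns a state machine with `PolyTime` parts into a program.
-/

namespace NegFlow

/-! ### Linking programs -/

/-- Renumber the functions called by a term, adding `k` to each number. -/
def Term.shift (k : ℕ) : Term → Term
  | .var i => .var i
  | .nil => .nil
  | .cons a b => .cons (a.shift k) (b.shift k)
  | .cases s a c => .cases (s.shift k) (a.shift k) (c.shift k)
  | .letIn e b => .letIn (e.shift k) (b.shift k)
  | .call f a => .call (f + k) (a.shift k)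
  | .emit e => .emit (e.shift k)

theorem Eval.link {p : Program} {env : List Data} {e : Term} {t : Trace} {v : Data}
    (h : Eval p env e t v) (pre post : Program) :
    Eval (pre ++ (p.map (Term.shift pre.length) ++ post)) env (e.shift pre.length) t v := by
  induction h with
  | var h => exact .var h
  | nil => exact .nil
  | cons _ _ iha ihb => exact .cons iha ihb
  | casesNil _ _ iha ihb => exact .casesNil iha ihb
  | casesCons _ _ iha ihb => exact .casesCons iha ihb
  | letIn _ _ iha ihb => exact .letIn iha ihb
  | @call env f arg body t₁ t₂ u v _ hf _ iha ihb =>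
    refine .call iha (body := body.shift pre.length) ?_ ihb
    have hlt : f < p.length := (List.getElem?_eq_some_iff.1 hf).1
    rw [List.getElem?_append_right (by omega), Nat.add_sub_cancel,
      List.getElem?_append_left (by simpa using hlt), List.getElem?_map, hf]
    rfl
  | emit _ ih => exact .emit ih

/-- The term `e` evaluates to `v` without output in at most `N` steps. -/
def Quiet (p : Program) (env : List Data) (e : Term) (N : ℕ) (v : Data) : Prop :=
  ∃ n ≤ N, Eval p env e (List.replicate n none) v

namespace Quiet

variable {p : Program} {env : List Data} {N N₁ N₂ : ℕ} {u v x y : Data} {e a b c s : Term}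

theorem mono (h : Quiet p env e N₁ v) (hN : N₁ ≤ N₂) : Quiet p env e N₂ v :=
  let ⟨n, hn, h⟩ := h
  ⟨n, hn.trans hN, h⟩

theorem var {i : ℕ} (h : env[i]? = some v) : Quiet p env (.var i) 1 v := ⟨1, le_rfl, .var h⟩

theorem nil : Quiet p env .nil 1 .nil := ⟨1, le_rfl, .nil⟩

theorem cons (ha : Quiet p env a N₁ u) (hb : Quiet p env b N₂ v) :
    Quiet p env (.cons a b) (N₁ + N₂ + 1) (.cons u v) := by
  obtain ⟨n, hn, ha⟩ := ha
  obtain ⟨m, hm, hb⟩ := hb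
  refine ⟨n + m + 1, by omega, ?_⟩
  have := Eval.cons ha hb
  rwa [← List.replicate_add, show [none] = List.replicate 1 (none : Option Data) from rfl,
    ← List.replicate_add] at this

theorem replicate_join (n m : ℕ) :
    List.replicate n (none : Option Data) ++ [none] ++ List.replicate m none =
      List.replicate (n + 1 + m) none := by
  rw [show [none] = List.replicate 1 (none : Option Data) from rfl, ← List.replicate_add,
    ← List.replicate_add]

theorem casesNil (hs : Quiet p env s N₁ .nil) (ha : Quiet p env a N₂ v) :
    Quiet p env (.cases s a c) (N₁ + 1 + N₂) v := by
  obtain ⟨n, hn, hs⟩ := hs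
  obtain ⟨m, hm, ha⟩ := ha
  exact ⟨n + 1 + m, by omega, replicate_join n m ▸ .casesNil hs ha⟩

theorem casesCons (hs : Quiet p env s N₁ (.cons x y)) (hc : Quiet p (x :: y :: env) c N₂ v) :
    Quiet p env (.cases s a c) (N₁ + 1 + N₂) v := by
  obtain ⟨n, hn, hs⟩ := hs
  obtain ⟨m, hm, hc⟩ := hc
  exact ⟨n + 1 + m, by omega, replicate_join n m ▸ .casesCons hs hc⟩

theorem call {f : ℕ} {body : Term} (ha : Quiet p env a N₁ u) (hf : p[f]? = some body)
    (hb : Quiet p [u] body N₂ v) : Quiet p env (.call f a) (N₁ + 1 + N₂) v := by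
  obtain ⟨n, hn, ha⟩ := ha
  obtain ⟨m, hm, hb⟩ := hb
  exact ⟨n + 1 + m, by omega, replicate_join n m ▸ .call ha hf hb⟩

end Quiet

/-! ### Polynomial-time functions on encoded types -/

/-- A type whose elements are represented by trees, without ambiguity. -/
class TreeCode (α : Type) where
  /-- the tree that represents an element -/
  code : α → Data
  inj : Function.Injective code

open TreeCode (code)

instance : TreeCode Unit := ⟨fun _ => .nil, fun _ _ _ => rfl⟩

instance : TreeCode Bool :=
  ⟨fun b => if b then .cons .nil .nil else .nil, fun a b => by cases a <;> cases b <;> simp⟩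

instance {α β : Type} [TreeCode α] [TreeCode β] : TreeCode (α × β) :=
  ⟨fun x => .cons (code x.1) (code x.2), fun x y h => by
    simp only [Data.cons.injEq] at h
    exact Prod.ext (TreeCode.inj h.1) (TreeCode.inj h.2)⟩

theorem Data.ofList_injective : Function.Injective Data.ofList := by
  intro l
  induction l with
  | nil => intro m h; cases m <;> simp_all [Data.ofList]
  | cons a l ih =>
    intro m h
    cases m with
    | nil => simp [Data.ofList] at h
    | cons b m =>
      simp only [Data.ofList, Data.cons.injEq] at h
      rw [h.1, ih h.2]

instance {α : Type} [TreeCode α] : TreeCode (List α) :=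
  ⟨fun l => .ofList (l.map code), fun _ _ h =>
    List.map_injective_iff.2 TreeCode.inj (Data.ofList_injective h)⟩

instance : TreeCode ℕ :=
  ⟨Data.ofNat, fun a b h => by simpa using congrArg List.length (Data.ofList_injective h)⟩

section Codes

variable {α β : Type} [TreeCode α] [TreeCode β]

@[simp] theorem code_pair (x : α × β) : code x = .cons (code x.1) (code x.2) := rfl
@[simp] theorem code_nil : code ([] : List α) = .nil := rfl
@[simp] theorem code_cons (a : α) (l : List α) : code (a :: l) = .cons (code a) (code l) := rfl
@[simp] theorem code_true : code true = .cons .nil .nil := rfl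
@[simp] theorem code_false : code false = .nil := rfl

/-- The number of nodes of the tree that represents an element. -/
def codeSize (a : α) : ℕ := (code a).size

theorem Data.one_le_size (d : Data) : 1 ≤ d.size := by cases d <;> simp [Data.size]

theorem one_le_codeSize (a : α) : 1 ≤ codeSize a := Data.one_le_size _

@[simp] theorem codeSize_pair (x : α × β) :
    codeSize x = codeSize x.1 + codeSize x.2 + 1 := rfl

@[simp] theorem codeSize_nil : codeSize ([] : List α) = 1 := rfl

@[simp] theorem codeSize_cons (a : α) (l : List α) :
    codeSize (a :: l) = codeSize a + codeSize l + 1 := rfl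

theorem codeSize_append (l m : List α) :
    codeSize (l ++ m) + 1 = codeSize l + codeSize m := by
  induction l with
  | nil => simp [add_comm]
  | cons a l ih => simp only [List.cons_append, codeSize_cons]; omega

theorem codeSize_mem {a : α} {l : List α} (h : a ∈ l) : codeSize a < codeSize l := by
  induction l with
  | nil => simp at h
  | cons b l ih =>
    rcases List.mem_cons.1 h with rfl | h
    · simp only [codeSize_cons]; omega
    · have := ih h; simp only [codeSize_cons]; omega

theorem length_lt_codeSize (l : List α) : l.length < codeSize l := by
  induction l with
  | nil => simp
  | cons a l ih => simp only [List.length_cons, codeSize_cons]; omega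

theorem codeSize_list_le {l : List α} {B : ℕ} (h : ∀ a ∈ l, codeSize a ≤ B) :
    codeSize l ≤ l.length * (B + 1) + 1 := by
  induction l with
  | nil => simp
  | cons a l ih =>
    have h1 := h a (by simp)
    have h2 := ih fun b hb => h b (by simp [hb])
    simp only [List.length_cons, codeSize_cons, add_mul, one_mul]; omega

theorem codeSize_bool (b : Bool) : codeSize b ≤ 3 := by cases b <;> simp [codeSize, Data.size]

end Codes

theorem polynomial_eval_mono (q : Polynomial ℕ) : Monotone fun n => q.eval n := by
  intro m n h
  induction q using Polynomial.induction_on' with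
  | add p q hp hq => simpa using add_le_add hp hq
  | monomial k a =>
    simp only [Polynomial.eval_monomial]
    exact Nat.mul_le_mul_left _ (Nat.pow_le_pow_left h k)

variable {α β γ δ σ : Type} [TreeCode α] [TreeCode β] [TreeCode γ] [TreeCode δ] [TreeCode σ]

/-- The function number `k` of the program `p` computes `f` without output; the size of the value
and the number of steps are at most `q` of the size of the argument. -/
def Computes (p : Program) (k : ℕ) (f : α → β) (q : Polynomial ℕ) : Prop :=
  ∃ body, p[k]? = some body ∧ ∀ a, codeSize (f a) ≤ q.eval (codeSize a) ∧
    Quiet p [code a] body (q.eval (codeSize a)) (code (f a))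

/-- `f` is computed by a program in polynomial time, with values of polynomial size. The bound on
the size is not implied by the one on the time, as values may share subtrees. -/
@[fun_prop]
def PolyTime (f : α → β) : Prop := ∃ (p : Program) (q : Polynomial ℕ), Computes p 0 f q

theorem Computes.call {p : Program} {k : ℕ} {f : α → β} {q : Polynomial ℕ} (h : Computes p k f q)
    {env : List Data} {e : Term} {N : ℕ} {a : α} (he : Quiet p env e N (code a)) :
    Quiet p env (.call k e) (N + 1 + q.eval (codeSize a)) (code (f a)) := by
  obtain ⟨body, hb, h⟩ := h
  exact he.call hb (h a).2

theorem Computes.size_le {p : Program} {k : ℕ} {f : α → β} {q : Polynomial ℕ}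
    (h : Computes p k f q) (a : α) : codeSize (f a) ≤ q.eval (codeSize a) := by
  obtain ⟨body, hb, h⟩ := h
  exact (h a).1

theorem Computes.link {p : Program} {k : ℕ} {f : α → β} {q : Polynomial ℕ}
    (h : Computes p k f q) (pre post : Program) :
    Computes (pre ++ (p.map (Term.shift pre.length) ++ post)) (pre.length + k) f q := by
  obtain ⟨body, hb, h⟩ := h
  have hlt : k < p.length := (List.getElem?_eq_some_iff.1 hb).1
  refine ⟨body.shift pre.length, ?_, fun a => ⟨(h a).1, ?_⟩⟩
  · rw [List.getElem?_append_right (by omega), Nat.add_sub_cancel_left,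
      List.getElem?_append_left (by simpa using hlt), List.getElem?_map, hb]
    rfl
  · obtain ⟨n, hn, h⟩ := (h a).2
    exact ⟨n, hn, h.link pre post⟩

/-- Three polynomial-time functions are computed by one program, in front of which there is room
for `c` functions that may call them. -/
theorem PolyTime.common {α' β' α'' β'' : Type} [TreeCode α'] [TreeCode β'] [TreeCode α'']
    [TreeCode β''] {f : α → β} {g : α' → β'} {h : α'' → β''} (hf : PolyTime f) (hg : PolyTime g)
    (hh : PolyTime h) (c : ℕ) :
    ∃ (p : Program) (i j k : ℕ) (q : Polynomial ℕ), ∀ pre : Program, pre.length = c →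
      Computes (pre ++ p) i f q ∧ Computes (pre ++ p) j g q ∧ Computes (pre ++ p) k h q := by
  obtain ⟨p₁, q₁, h₁⟩ := hf
  obtain ⟨p₂, q₂, h₂⟩ := hg
  obtain ⟨p₃, q₃, h₃⟩ := hh
  have weaken : ∀ {α β : Type} [TreeCode α] [TreeCode β] {f : α → β} {p k} {q q' : Polynomial ℕ},
      Computes p k f q → (∀ n, q.eval n ≤ q'.eval n) → Computes p k f q' := by
    rintro α β _ _ f p k q q' ⟨b, hb, h⟩ hq
    exact ⟨b, hb, fun a => ⟨(h a).1.trans (hq _), (h a).2.mono (hq _)⟩⟩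
  refine ⟨p₁.map (Term.shift c) ++ (p₂.map (Term.shift (c + p₁.length)) ++
    (p₃.map (Term.shift (c + p₁.length + p₂.length)) ++ [])), c, c + p₁.length,
    c + p₁.length + p₂.length, q₁ + q₂ + q₃, fun pre hpre => ⟨?_, ?_, ?_⟩⟩
  · have := h₁.link pre (p₂.map (Term.shift (c + p₁.length)) ++
      (p₃.map (Term.shift (c + p₁.length + p₂.length)) ++ []))
    rw [hpre] at this
    exact weaken this fun n => by simp only [Polynomial.eval_add]; omega
  · have := h₂.link (pre ++ p₁.map (Term.shift c))
      (p₃.map (Term.shift (c + p₁.length + p₂.length)) ++ [])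
    simp only [List.length_append, hpre, List.length_map, List.append_assoc] at this
    exact weaken this fun n => by simp only [Polynomial.eval_add]; omega
  · have := h₃.link (pre ++ p₁.map (Term.shift c) ++ p₂.map (Term.shift (c + p₁.length))) []
    simp only [List.length_append, hpre, List.length_map, List.append_assoc, ← add_assoc,
      add_zero] at this
    exact weaken this fun n => by simp only [Polynomial.eval_add]; omega

/-- Basic functions: a single function body without calls. -/
theorem PolyTime.of_body {f : α → β} (body : Term) (q : Polynomial ℕ)
    (hs : ∀ a, codeSize (f a) ≤ q.eval (codeSize a))
    (h : ∀ a, Quiet [body] [code a] body (q.eval (codeSize a)) (code (f a))) : PolyTime f :=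
  ⟨[body], q, body, rfl, fun a => ⟨hs a, h a⟩⟩

namespace PolyTime

open Polynomial in
/-- A function that only changes the type, but not the tree. -/
theorem of_code_eq {f : α → β} (h : ∀ a, code (f a) = code a) : PolyTime f := by
  refine of_body (.var 0) (X + 1) (fun a => ?_) fun a => ?_
  · simp [codeSize, h]
  · rw [h]; exact (Quiet.var rfl).mono (by simp)

@[fun_prop]
protected theorem id : PolyTime (fun a : α => a) := of_code_eq fun _ => rfl

open Polynomial in
theorem fst : PolyTime (fun x : α × β => x.1) := by
  refine of_body (.cases (.var 0) .nil (.var 0)) (X + 3) (fun a => ?_) fun a => ?_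
  · simp; omega
  · exact (Quiet.casesCons (Quiet.var rfl) (Quiet.var rfl)).mono (by simp)

open Polynomial in
theorem snd : PolyTime (fun x : α × β => x.2) := by
  refine of_body (.cases (.var 0) .nil (.var 1)) (X + 3) (fun a => ?_) fun a => ?_
  · simp; omega
  · exact (Quiet.casesCons (Quiet.var rfl) (Quiet.var rfl)).mono (by simp)

@[fun_prop]
theorem const (b : β) : PolyTime (fun _ : α => b) := by
  have : ∀ d : Data, ∃ e N, ∀ p env, Quiet p env e N d := by
    intro d
    induction d with
    | nil => exact ⟨.nil, 1, fun _ _ => .nil⟩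
    | cons a b iha ihb =>
      obtain ⟨e, N, he⟩ := iha
      obtain ⟨e', N', he'⟩ := ihb
      exact ⟨.cons e e', N + N' + 1, fun p env => (he p env).cons (he' p env)⟩
  obtain ⟨e, N, h⟩ := this (code b)
  exact of_body e (Polynomial.C (N + codeSize b)) (fun a => by simp)
    fun a => (h _ _).mono (by simp)

open Polynomial in
@[fun_prop]
theorem comp {g : β → γ} {f : α → β} (hg : PolyTime g) (hf : PolyTime f) :
    PolyTime (fun a => g (f a)) := by
  obtain ⟨p, i, j, _, q, h⟩ := common hg hf hf 1
  obtain ⟨h₁, h₂, -⟩ := h [.call i (.call j (.var 0))] rfl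
  refine ⟨.call i (.call j (.var 0)) :: p, q.comp q + q + 3, _, rfl, fun a => ?_⟩
  have hq := polynomial_eval_mono q (h₂.size_le a)
  refine ⟨((h₁.size_le _).trans hq).trans (by simp; omega),
    (h₁.call (h₂.call (.var rfl))).mono ?_⟩
  simp only [eval_add, eval_comp] at *
  simp only [eval_ofNat]; omega

open Polynomial in
@[fun_prop]
theorem pair {f : α → β} {g : α → γ} (hf : PolyTime f) (hg : PolyTime g) :
    PolyTime (fun a => (f a, g a)) := by
  obtain ⟨p, i, j, _, q, h⟩ := common hf hg hg 1
  obtain ⟨h₁, h₂, -⟩ := h [.cons (.call i (.var 0)) (.call j (.var 0))] rfl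
  refine ⟨.cons (.call i (.var 0)) (.call j (.var 0)) :: p, q + q + 5, _, rfl, fun a => ?_⟩
  have hs := h₁.size_le a
  have hs' := h₂.size_le a
  refine ⟨?_, ((h₁.call (.var rfl)).cons (h₂.call (.var rfl))).mono ?_⟩
  · simp only [codeSize_pair, eval_add, eval_ofNat]; omega
  · simp only [eval_add, eval_ofNat]; omega

open Polynomial in
/-- Case distinction on a list. -/
theorem listCases {l : α → List γ} {f : α → β} {g : γ × List γ × α → β} {r : α → β}
    (hl : PolyTime l) (hf : PolyTime f) (hg : PolyTime g)
    (hn : ∀ a, l a = [] → r a = f a) (hc : ∀ a x t, l a = x :: t → r a = g (x, t, a)) :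
    PolyTime r := by
  obtain ⟨p, i, j, k, q, h⟩ := common hl hf hg 1
  set body : Term := .cases (.call i (.var 0)) (.call j (.var 0))
    (.call k (.cons (.var 0) (.cons (.var 1) (.var 2))))
  obtain ⟨h₁, h₂, h₃⟩ := h [body] rfl
  refine ⟨body :: p, q + q + q.comp (q + X + 1) + 20, _, rfl, fun a => ?_⟩
  simp only [eval_add, eval_comp, eval_ofNat, eval_X, eval_one]
  have hl := h₁.call (.var (env := [code a]) (i := 0) rfl)
  cases hla : l a with
  | nil =>
    rw [hla, code_nil] at hl
    rw [hn a hla]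
    refine ⟨(h₂.size_le a).trans (by omega), (hl.casesNil (h₂.call (.var rfl))).mono (by omega)⟩
  | cons x t =>
    rw [hla, code_cons] at hl
    rw [hc a x t hla]
    have hs : codeSize (x, t, a) ≤ q.eval (codeSize a) + codeSize a + 1 := by
      have := h₁.size_le a
      rw [hla, codeSize_cons] at this
      simp only [codeSize_pair]
      omega
    have hq : q.eval _ ≤ q.eval _ := polynomial_eval_mono q hs
    refine ⟨(h₃.size_le _).trans (by omega), (hl.casesCons (h₃.call (a := (x, t, a))
      ((Quiet.var rfl).cons ((Quiet.var rfl).cons (Quiet.var rfl))))).mono ?_⟩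
    omega

open Polynomial in
/-- A loop over a list runs in polynomial time if its states stay of polynomial size. -/
theorem foldl {l : α → List γ} {i : α → σ} {S : α → σ → γ → σ} (hl : PolyTime l)
    (hi : PolyTime i) (hS : PolyTime fun z : α × σ × γ => S z.1 z.2.1 z.2.2) (r : Polynomial ℕ)
    (hr : ∀ a l', l' <+: l a → codeSize (l'.foldl (S a) (i a)) ≤ r.eval (codeSize a)) :
    PolyTime fun a => (l a).foldl (S a) (i a) := by
  obtain ⟨p, kl, ki, ks, q, h⟩ := common hl hi hS 2
  set loop : Term := .cases (.var 0) .nil (.cases (.var 1) .nil (.cases (.var 1) (.var 0)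
    (.call 1 (.cons (.var 4) (.cons (.call ks (.cons (.var 4) (.cons (.var 2) (.var 0))))
      (.var 1)))))) with hloop
  set main : Term := .call 1 (.cons (.var 0) (.cons (.call ki (.var 0)) (.call kl (.var 0))))
  obtain ⟨h₁, h₂, h₃⟩ := h [main, loop] rfl
  have key : ∀ (a : α) (B : ℕ) (t : List γ) (s : σ),
      (∀ t' x, t' ++ [x] <+: t → q.eval (codeSize (a, t'.foldl (S a) s, x)) ≤ B) →
      Quiet ([main, loop] ++ p) [code (a, s, t)] loop ((t.length + 1) * (B + 30))
        (code (t.foldl (S a) s)) := by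
    intro a B t
    induction t with
    | nil =>
      intro s _
      refine (Quiet.casesCons (Quiet.var rfl) (Quiet.casesCons (Quiet.var rfl)
        (Quiet.casesNil (Quiet.var rfl) (Quiet.var rfl)))).mono ?_
      simp
    | cons x t ih =>
      intro s hB
      have hx := hB [] x (by simp)
      have ht := ih (S a s x) fun t' y hy => hB (x :: t') y (by simpa using hy)
      refine (Quiet.casesCons (Quiet.var rfl) (Quiet.casesCons (Quiet.var rfl)
        (Quiet.casesCons (Quiet.var rfl) (Quiet.call (u := code (a, S a s x, t))
        ((Quiet.var rfl).cons ((h₃.call (a := (a, s, x)) ((Quiet.var rfl).cons ((Quiet.var rfl).cons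
          (Quiet.var rfl)))).cons (Quiet.var rfl))) rfl ht)))).mono ?_
      simp only [List.foldl_nil] at hx
      simp only [List.length_cons, add_mul, one_mul] at *
      omega
  refine ⟨main :: loop :: p, r + q + q + 20 + (q + 1) * (q.comp (X + r + q + 3) + 30), main, rfl,
    fun a => ?_⟩
  refine ⟨(hr a _ (List.prefix_refl _)).trans (by simp only [eval_add]; omega), ?_⟩
  have hsl := h₁.size_le a
  have hB : ∀ t' x, t' ++ [x] <+: l a → q.eval (codeSize (a, t'.foldl (S a) (i a), x)) ≤
      q.eval (codeSize a + r.eval (codeSize a) + q.eval (codeSize a) + 3) := by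
    intro t' x hx
    refine polynomial_eval_mono q ?_
    have h1 := hr a t' ((List.prefix_append _ _).trans hx)
    have h2 := codeSize_mem (hx.subset (show x ∈ t' ++ [x] by simp))
    simp only [codeSize_pair]
    omega
  have hk := key a _ (l a) (i a) hB
  refine (Quiet.call (u := code (a, i a, l a)) ((Quiet.var rfl).cons
    ((h₂.call (Quiet.var rfl)).cons (h₁.call (Quiet.var rfl)))) rfl hk).mono ?_
  have hlen := length_lt_codeSize (l a)
  have : ((l a).length + 1) * (q.eval (codeSize a + r.eval (codeSize a) + q.eval (codeSize a) + 3)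
      + 30) ≤ (q.eval (codeSize a) + 1) * (q.eval (codeSize a + r.eval (codeSize a) +
        q.eval (codeSize a) + 3) + 30) := Nat.mul_le_mul_right _ (by omega)
  simp only [eval_add, eval_comp, eval_ofNat, eval_X, eval_one, eval_mul]
  omega

end PolyTime
end NegFlow

namespace NegFlow

open TreeCode (code)

namespace PolyTime

variable {α β γ δ σ : Type} [TreeCode α] [TreeCode β] [TreeCode γ] [TreeCode δ] [TreeCode σ]

/-! ### Polynomial-time list operations -/

@[fun_prop]
theorem fst' {f : α → β × γ} (hf : PolyTime f) : PolyTime fun a => (f a).1 := fst.comp hf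

@[fun_prop]
theorem snd' {f : α → β × γ} (hf : PolyTime f) : PolyTime fun a => (f a).2 := snd.comp hf

@[fun_prop]
theorem cons {f : α → β} {l : α → List β} (hf : PolyTime f) (hl : PolyTime l) :
    PolyTime fun a => f a :: l a :=
  (of_code_eq (f := fun x : β × List β => x.1 :: x.2) fun _ => rfl).comp (hf.pair hl)

theorem singleton {f : α → β} (hf : PolyTime f) : PolyTime fun a => [f a] :=
  hf.cons (.const [])

@[fun_prop]
theorem headD {l : α → List β} {d : α → β} (hl : PolyTime l) (hd : PolyTime d) :
    PolyTime fun a => (l a).headD (d a) :=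
  listCases hl hd (g := fun z => z.1) fst (fun a h => by simp [h]) fun a x t h => by simp [h]

@[fun_prop]
theorem tail {l : α → List β} (hl : PolyTime l) : PolyTime fun a => (l a).tail :=
  listCases hl (.const []) (g := fun z => z.2.1) (by fun_prop) (fun a h => by simp [h])
    fun a x t h => by simp [h]

@[fun_prop]
theorem ite {c : α → Prop} [DecidablePred c] {f g : α → β} (hc : PolyTime fun a => decide (c a))
    (hf : PolyTime f) (hg : PolyTime g) : PolyTime fun a => if c a then f a else g a := by
  have h : PolyTime fun b : Bool => if b then [()] else [] :=
    of_code_eq fun b => by cases b <;> rfl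
  refine listCases (h.comp hc) hg (g := fun z => f z.2.2) (by fun_prop) (fun a ha => ?_)
    fun a x t ha => ?_
  · rw [if_neg]; intro hc; simp [hc] at ha
  · rw [if_pos]; by_contra hc; simp [hc] at ha

@[fun_prop]
theorem not {f : α → Bool} (hf : PolyTime f) : PolyTime fun a => !f a := by
  have := ite (c := fun a => f a = true) (by simpa using hf) (.const false) (.const true)
  refine cast (congrArg _ (funext fun a => ?_)) this
  cases f a <;> rfl

@[fun_prop]
theorem and {f g : α → Bool} (hf : PolyTime f) (hg : PolyTime g) :
    PolyTime fun a => f a && g a := by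
  have := ite (c := fun a => f a = true) (by simpa using hf) hg (.const false)
  refine cast (congrArg _ (funext fun a => ?_)) this
  cases f a <;> rfl

@[fun_prop]
theorem or {f g : α → Bool} (hf : PolyTime f) (hg : PolyTime g) :
    PolyTime fun a => f a || g a := by
  have := ite (c := fun a => f a = true) (by simpa using hf) (.const true) hg
  refine cast (congrArg _ (funext fun a => ?_)) this
  cases f a <;> rfl

open Polynomial in
/-- A loop over a list runs in polynomial time if each pass enlarges the state by an amount that is
polynomial in the sizes of the fixed argument and of the list element only. -/
theorem foldl_additive {l : α → List γ} {i : α → σ} {S : α → σ → γ → σ} (hl : PolyTime l)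
    (hi : PolyTime i) (hS : PolyTime fun z : α × σ × γ => S z.1 z.2.1 z.2.2) (r : Polynomial ℕ)
    (hr : ∀ a s x, codeSize (S a s x) ≤ codeSize s + r.eval (codeSize a + codeSize x)) :
    PolyTime fun a => (l a).foldl (S a) (i a) := by
  obtain ⟨p₁, q₁, h₁⟩ := id hl
  obtain ⟨p₂, q₂, h₂⟩ := id hi
  refine foldl hl hi hS (q₂ + q₁ * r.comp (X + q₁)) fun a l' hl' => ?_
  have key : ∀ t : List γ, (∀ x ∈ t, codeSize x ≤ q₁.eval (codeSize a)) → ∀ s,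
      codeSize (t.foldl (S a) s) ≤
        codeSize s + t.length * r.eval (codeSize a + q₁.eval (codeSize a)) := by
    intro t
    induction t with
    | nil => simp
    | cons x t ih =>
      intro ht s
      have h1 := ih (fun y hy => ht y (by simp [hy])) (S a s x)
      have h2 := hr a s x
      have h3 : r.eval _ ≤ r.eval _ :=
        polynomial_eval_mono r (Nat.add_le_add_left (ht x (by simp)) (codeSize a))
      simp only [List.foldl_cons, List.length_cons, add_mul, one_mul]
      omega
  have hsz := h₁.size_le a
  have h1 := key l' (fun x hx => ((codeSize_mem (hl'.subset hx)).le.trans hsz)) (i a)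
  have h2 := h₂.size_le a
  have h3 : l'.length ≤ q₁.eval (codeSize a) :=
    hl'.length_le.trans ((length_lt_codeSize _).le.trans hsz)
  have h4 := Nat.mul_le_mul_right (r.eval (codeSize a + q₁.eval (codeSize a))) h3
  simp only [eval_add, eval_mul, eval_comp, eval_X]
  omega

@[fun_prop]
theorem reverse {l : α → List β} (hl : PolyTime l) : PolyTime fun a => (l a).reverse := by
  have := foldl_additive (S := fun _ acc x => x :: acc) (i := fun _ : α => ([] : List β)) hl
    (.const []) (by fun_prop) (Polynomial.X + 1) (fun a s x => by simp; omega)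
  simpa using this

@[fun_prop]
theorem append {l m : α → List β} (hl : PolyTime l) (hm : PolyTime m) :
    PolyTime fun a => l a ++ m a := by
  have := foldl_additive (S := fun _ acc x => x :: acc) hl.reverse
    hm (by fun_prop) (Polynomial.X + 1) (fun a s x => by simp; omega)
  simpa using this

open Polynomial in
@[fun_prop]
theorem flatMap {l : α → List β} {g : α → β → List γ} (hl : PolyTime l)
    (hg : PolyTime fun z : α × β => g z.1 z.2) : PolyTime fun a => (l a).flatMap (g a) := by
  obtain ⟨p, q, h⟩ := id hg
  have := foldl_additive (S := fun a acc x => g a x ++ acc) (i := fun _ => []) hl.reverse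
    (.const []) (append (hg.comp (f := fun z : α × List γ × β => (z.1, z.2.2)) (by fun_prop))
      (by fun_prop)) (q.comp (X + 1)) (fun a s x => by
      have h1 := codeSize_append (g a x) s
      have h2 := h.size_le (a, x)
      simp only [codeSize_pair] at h2
      simp only [eval_comp, eval_add, eval_X, eval_one]; omega)
  refine cast (congrArg _ (funext fun a => ?_)) this
  rw [List.foldl_reverse]
  induction l a with
  | nil => rfl
  | cons x t ih => simp [ih]

@[fun_prop]
theorem map {l : α → List β} {g : α → β → γ} (hl : PolyTime l)
    (hg : PolyTime fun z : α × β => g z.1 z.2) : PolyTime fun a => (l a).map (g a) := by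
  have := flatMap (g := fun a x => [g a x]) hl hg.singleton
  simpa only [← List.map_eq_flatMap] using this

@[fun_prop]
theorem filter {l : α → List β} {g : α → β → Bool} (hl : PolyTime l)
    (hg : PolyTime fun z : α × β => g z.1 z.2) : PolyTime fun a => (l a).filter (g a) := by
  have := flatMap (g := fun a x => if g a x then [x] else []) hl (by
    refine ite (c := fun z : α × β => g z.1 z.2 = true) ?_ ?_ ?_
    · simpa using hg
    · exact singleton (by fun_prop)
    · fun_prop)
  refine cast (congrArg _ (funext fun a => ?_)) this
  induction l a with
  | nil => rfl
  | cons x t ih => by_cases h : g a x <;> simp [ih, h]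

@[fun_prop]
theorem isEmpty {l : α → List β} (hl : PolyTime l) : PolyTime fun a => (l a).isEmpty :=
  listCases hl (.const true) (g := fun _ => false) (.const _) (fun a h => by simp [h])
    fun a x t h => by simp [h]

@[fun_prop]
theorem any {l : α → List β} {g : α → β → Bool} (hl : PolyTime l)
    (hg : PolyTime fun z : α × β => g z.1 z.2) : PolyTime fun a => (l a).any (g a) := by
  have := (isEmpty (filter hl hg)).not
  refine cast (congrArg _ (funext fun a => ?_)) this
  rw [Bool.eq_iff_iff]; simp

@[fun_prop]
theorem all {l : α → List β} {g : α → β → Bool} (hl : PolyTime l)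
    (hg : PolyTime fun z : α × β => g z.1 z.2) : PolyTime fun a => (l a).all (g a) := by
  have := (any (g := fun a x => !g a x) hl hg.not).not
  refine cast (congrArg _ (funext fun a => ?_)) this
  rw [Bool.eq_iff_iff]; simp

/-! ### Equality and arithmetic -/

/-- The body of a recursive function that compares two trees. -/
def eqBody : Term :=
  .cases (.var 0) .nil (.cases (.var 0) (.cases (.var 1) (.cons .nil .nil) .nil)
    (.cases (.var 3) .nil (.cases (.call 0 (.cons (.var 2) (.var 0))) .nil
      (.call 0 (.cons (.var 5) (.var 3))))))

theorem eqBody_correct (x : Data) : ∀ y : Data,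
    Quiet [eqBody] [.cons x y] eqBody (30 * x.size) (code (@decide (x = y) (Classical.dec _))) := by
  induction x with
  | nil =>
    rintro (_ | ⟨y₁, y₂⟩)
    · simp only [decide_true, code_true]
      exact (Quiet.casesCons (.var rfl) (.casesNil (.var rfl)
        (.casesNil (.var rfl) (Quiet.nil.cons .nil)))).mono (by simp [Data.size])
    · simp only [reduceCtorEq, decide_false, code_false]
      exact (Quiet.casesCons (.var rfl) (.casesNil (.var rfl)
        (.casesCons (.var rfl) .nil))).mono (by simp [Data.size])
  | cons x₁ x₂ ih₁ ih₂ =>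
    rintro (_ | ⟨y₁, y₂⟩)
    · simp only [reduceCtorEq, decide_false, code_false]
      exact (Quiet.casesCons (.var rfl) (.casesCons (.var rfl)
        (.casesNil (.var rfl) .nil))).mono (by simp [Data.size]; omega)
    · have h1 := ih₁ y₁
      by_cases h : x₁ = y₁
      · have h2 := ih₂ y₂
        subst h
        simp only [decide_true, code_true] at h1
        rw [show code (@decide (Data.cons x₁ x₂ = .cons x₁ y₂) (Classical.dec _)) =
          code (@decide (x₂ = y₂) (Classical.dec _)) by by_cases hy : x₂ = y₂ <;> simp [hy]]
        exact (Quiet.casesCons (.var rfl) (.casesCons (.var rfl)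
          (.casesCons (.var rfl) (.casesCons (.call ((Quiet.var rfl).cons (.var rfl)) rfl
            h1) (.call ((Quiet.var rfl).cons (.var rfl)) rfl h2))))).mono
              (by simp only [Data.size]; omega)
      · simp only [h, decide_false, code_false] at h1
        simp only [Data.cons.injEq, h, false_and, decide_false, code_false]
        exact (Quiet.casesCons (.var rfl) (.casesCons (.var rfl)
          (.casesCons (.var rfl) (.casesNil (.call ((Quiet.var rfl).cons (.var rfl)) rfl
            h1) .nil)))).mono (by simp only [Data.size]; omega)

open Polynomial in
@[fun_prop]
theorem decide_eq [DecidableEq β] {f g : α → β} (hf : PolyTime f) (hg : PolyTime g) :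
    PolyTime fun a => decide (f a = g a) := by
  have h : PolyTime fun x : β × β => decide (x.1 = x.2) := by
    refine of_body eqBody (30 * X + 3) (fun a => ?_) fun a => ?_
    · have := codeSize_bool (decide (a.1 = a.2)); simp; omega
    · have := (eqBody_correct (code a.1) (code a.2)).mono (N₂ := 30 * codeSize a)
        (by rw [codeSize_pair]; simp only [codeSize]; omega)
      simp only [TreeCode.inj.eq_iff] at this
      convert this.mono _ using 1
      all_goals simp
  exact h.comp (hf.pair hg)

@[fun_prop]
theorem decide_mem {f : α → β} {l : α → List β} [DecidablePred fun a => f a ∈ l a]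
    (hf : PolyTime f) (hl : PolyTime l) : PolyTime fun a => decide (f a ∈ l a) := by
  classical
  have := any hl (g := fun a y => decide (f a = y)) (by fun_prop)
  refine cast (congrArg _ (funext fun a => ?_)) this
  rw [Bool.eq_iff_iff]; simp

theorem units {f : α → ℕ} (hf : PolyTime f) : PolyTime fun a => List.replicate (f a) () :=
  (of_code_eq (f := fun n => List.replicate n ()) fun n => by
    change Data.ofList _ = Data.ofList _; simp [code]).comp hf

@[fun_prop]
theorem length {l : α → List β} (hl : PolyTime l) : PolyTime fun a => (l a).length := by
  have h : PolyTime fun l : List Unit => l.length := of_code_eq fun l => by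
    change Data.ofList _ = Data.ofList _
    congr 1
    induction l with
    | nil => rfl
    | cons a l ih => rw [List.length_cons, List.replicate_succ, ih]; rfl
  simpa using h.comp (map (g := fun _ _ => ()) hl (.const ()))

@[fun_prop]
theorem add {f g : α → ℕ} (hf : PolyTime f) (hg : PolyTime g) : PolyTime fun a => f a + g a := by
  simpa using (hf.units.append hg.units).length

@[fun_prop]
theorem mul {f g : α → ℕ} (hf : PolyTime f) (hg : PolyTime g) : PolyTime fun a => f a * g a := by
  simpa using (flatMap (g := fun a _ => List.replicate (g a) ()) hf.units
    (hg.comp fst).units).length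

@[fun_prop]
theorem sub {f g : α → ℕ} (hf : PolyTime f) (hg : PolyTime g) : PolyTime fun a => f a - g a := by
  have := (foldl_additive (S := fun _ s _ => s.tail) hg.units hf.units (by fun_prop) 0
    (fun a s x => by cases s <;> simp; omega)).length
  refine cast (congrArg _ (funext fun a => ?_)) this
  induction g a with
  | zero => simp
  | succ n ih =>
    rw [List.replicate_succ', List.foldl_append, List.foldl_cons, List.foldl_nil,
      List.length_tail, ih]
    omega

@[fun_prop]
theorem decide_lt {f g : α → ℕ} (hf : PolyTime f) (hg : PolyTime g) :
    PolyTime fun a => decide (f a < g a) := by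
  have := (decide_eq (hg.sub hf) (.const 0)).not
  refine cast (congrArg _ (funext fun a => ?_)) this
  rw [Bool.eq_iff_iff]; simp; omega

@[fun_prop]
theorem sum {l : α → List β} {g : α → β → ℕ} (hl : PolyTime l)
    (hg : PolyTime fun z : α × β => g z.1 z.2) : PolyTime fun a => ((l a).map (g a)).sum := by
  have := (flatMap (g := fun a x => List.replicate (g a x) ()) hl hg.units).length
  simpa [List.length_flatMap] using this

end PolyTime
end NegFlow

namespace NegFlow

open TreeCode (code)

/-! ### Generators: a loop that writes outputs -/

theorem Trace.outputs_append (t u : Trace) : (t ++ u).outputs = t.outputs ++ u.outputs :=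
  List.filterMap_append

theorem Trace.outputs_replicate_none (n : ℕ) : Trace.outputs (List.replicate n none) = [] := by
  simp [Trace.outputs]

/-- The body of a recursive function, number `2`, that writes all elements of a list. -/
def emitBody : Term :=
  .cases (.var 0) .nil (.letIn (.emit (.var 0)) (.call 2 (.var 2)))

theorem emitBody_correct {β : Type} [TreeCode β] {p : Program} (hp : p[2]? = some emitBody)
    (l : List β) : ∃ t : Trace, Eval p [code l] emitBody t .nil ∧ t.outputs = l.map code ∧
      t.length ≤ 10 * codeSize l := by
  induction l with
  | nil => exact ⟨_, .casesNil (.var rfl) .nil, by simp [Trace.outputs], by simp⟩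
  | cons x l ih =>
    obtain ⟨t, ht, ho, hl⟩ := ih
    refine ⟨_, .casesCons (.var rfl) (.letIn (.emit (.var rfl)) (.call (.var rfl) hp ht)), ?_, ?_⟩
    · simp only [Trace.outputs_append, ho, Trace.outputs_replicate_none]
      simp [Trace.outputs]
    · have : codeSize x = (code x).size := rfl
      simp only [List.length_append, List.length_singleton, List.length_replicate,
        codeSize_cons] at *
      omega

theorem prefix_append_cases {γ : Type} {t u v : List γ} (h : t <+: u ++ v) :
    t <+: u ∨ ∃ v', v' <+: v ∧ t = u ++ v' := by
  rcases le_total t.length u.length with hl | hl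
  · exact .inl (List.prefix_of_prefix_length_le h (List.prefix_append _ _) hl)
  · obtain ⟨v', rfl⟩ := List.prefix_of_prefix_length_le (List.prefix_append u v) h hl
    exact .inr ⟨v', (List.prefix_append_right_inj u).1 h, rfl⟩

variable {α β σ : Type} [TreeCode α] [TreeCode β] [TreeCode σ]

theorem Term.shift_zero (e : Term) : e.shift 0 = e := by
  induction e <;> simp_all [Term.shift]

theorem Computes.append {p : Program} {k : ℕ} {f : α → β} {q : Polynomial ℕ}
    (h : Computes p k f q) (post : Program) : Computes (p ++ post) k f q := by
  have := h.link [] post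
  have hs : Term.shift 0 = id := funext Term.shift_zero
  simpa [hs] using this

open Polynomial in
/-- From a state machine whose parts are computed in polynomial time one gets a program that runs
it and writes the outputs. When the `i`-th state is worked on, all outputs of the previous states
have been written, and the number of steps is at most the sum of a polynomial in the sizes of the
states so far. -/
theorem exists_generator {init : α → σ} {run : σ → Bool} {outs : σ → List β} {next : σ → σ}
    (hi : PolyTime init) (hr : PolyTime run) (ho : PolyTime outs) (hn : PolyTime next) :
    ∃ (p : Program) (q : Polynomial ℕ), ∀ (a : α) (N : ℕ),
      (∀ i < N, run (next^[i] (init a)) = true) → run (next^[N] (init a)) = false →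
      ∃ t : Trace, p.RunsOn (code a) t ∧
        t.outputs = ((List.range N).flatMap fun i => outs (next^[i] (init a))).map code ∧
        ∀ t' : Trace, t' <+: t → ∃ i ≤ N,
          ∑ j ∈ Finset.range i, (outs (next^[j] (init a))).length ≤ t'.outputs.length ∧
          t'.length ≤ q.eval (codeSize a) +
            ∑ j ∈ Finset.range (i + 1), q.eval (codeSize (next^[j] (init a))) := by
  obtain ⟨p, kr, ko, kn, q, h⟩ := hr.common ho hn 3
  obtain ⟨p', ki, _, _, q', h'⟩ := hi.common hi hi (3 + p.length)
  set loop : Term := .cases (.call kr (.var 0)) .nil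
    (.letIn (.call 2 (.call ko (.var 2))) (.call 1 (.call kn (.var 3)))) with hloop
  set main : Term := .call 1 (.call ki (.var 0))
  obtain ⟨h₄, -, -⟩ := h' ([main, loop, emitBody] ++ p) (by simp; omega)
  obtain ⟨h₁, h₂, h₃⟩ : Computes ([main, loop, emitBody] ++ p ++ p') kr run q ∧
      Computes ([main, loop, emitBody] ++ p ++ p') ko outs q ∧
      Computes ([main, loop, emitBody] ++ p ++ p') kn next q := by
    obtain ⟨h₁, h₂, h₃⟩ := h [main, loop, emitBody] rfl
    exact ⟨h₁.append p', h₂.append p', h₃.append p'⟩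
  set P : Program := [main, loop, emitBody] ++ p ++ p'
  set Q : Polynomial ℕ := q + q + q + 10 * q + 40
  have key : ∀ (N : ℕ) (s : σ),
      (∀ i < N, run (next^[i] s) = true) → run (next^[N] s) = false →
      ∃ t : Trace, Eval P [code s] loop t .nil ∧
        t.outputs = ((List.range N).flatMap fun i => outs (next^[i] s)).map code ∧
        ∀ t' : Trace, t' <+: t → ∃ i ≤ N,
          ∑ j ∈ Finset.range i, (outs (next^[j] s)).length ≤ t'.outputs.length ∧
          t'.length ≤ ∑ j ∈ Finset.range (i + 1), Q.eval (codeSize (next^[j] s)) := by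
    intro N
    induction N with
    | zero =>
      intro s _ hs
      have hs : run s = false := hs
      have hc := h₁.call (.var (env := [code s]) (i := 0) rfl)
      rw [hs, code_false] at hc
      obtain ⟨n, hn, hc⟩ := hc.casesNil (c := (.letIn (.call 2 (.call ko (.var 2)))
        (.call 1 (.call kn (.var 3))))) Quiet.nil
      refine ⟨_, hc, by simp [Trace.outputs_replicate_none], fun t' ht' => ⟨0, le_rfl, by simp, ?_⟩⟩
      have := ht'.length_le
      simp [Q] at *
      omega
    | succ N ih =>
      intro s hs hN
      obtain ⟨t, ht, hto, htb⟩ := ih (next s) (fun i hi => by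
        simpa using hs (i + 1) (by omega)) (by simpa using hN)
      have h0 : run s = true := hs 0 (by omega)
      have hc := h₁.call (.var (env := [code s]) (i := 0) rfl)
      rw [h0, code_true] at hc
      obtain ⟨n, hn, hc⟩ := hc
      obtain ⟨te, hte, hteo, htel⟩ := emitBody_correct (p := P) rfl (outs s)
      obtain ⟨m, hm, ho⟩ := h₂.call (.var (env := [.nil, .nil, code s]) (i := 2) rfl)
      obtain ⟨r, hr, hx⟩ := h₃.call (.var (env := [.nil, .nil, .nil, code s]) (i := 3) rfl)
      have hev := Eval.casesCons (a := .nil) hc (.letIn (.call (f := 2) ho rfl hte)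
        (.call (f := 1) hx rfl ht))
      rw [← List.append_assoc, ← List.append_assoc] at hev
      set A : Trace := List.replicate n none ++ [none] ++
        (List.replicate m none ++ [none] ++ te ++ [none] ++ (List.replicate r none ++ [none]))
        with hA
      have hAo : A.outputs = (outs s).map code := by
        simp only [hA, Trace.outputs_append, Trace.outputs_replicate_none, hteo]
        simp [Trace.outputs]
      have hAl : A.length ≤ Q.eval (codeSize s) := by
        have := h₂.size_le s
        simp [hA, Q] at *
        omega
      have hev' : Eval P [code s] loop (A ++ t) .nil := by
        convert hev using 1
        simp [hA]
      refine ⟨A ++ t, hev', ?_, fun t' ht' => ?_⟩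
      · rw [Trace.outputs_append, hAo, hto, List.range_succ_eq_map]
        simp [List.flatMap_map]
      · rcases prefix_append_cases ht' with h | ⟨v, hv, rfl⟩
        · refine ⟨0, by omega, by simp, ?_⟩
          simpa using h.length_le.trans hAl
        · obtain ⟨i, hi, hi1, hi2⟩ := htb v hv
          refine ⟨i + 1, by omega, ?_, ?_⟩
          · rw [Finset.sum_range_succ', Trace.outputs_append, hAo]
            simp only [Function.iterate_succ_apply, Function.iterate_zero, id_eq,
              List.length_append, List.length_map]
            omega
          · rw [Finset.sum_range_succ', List.length_append]
            simp only [Function.iterate_succ_apply, Function.iterate_zero, id_eq]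
            omega
  refine ⟨P, Q + q' + 10, fun a N hs hN => ?_⟩
  obtain ⟨t, ht, hto, htb⟩ := key N (init a) hs hN
  obtain ⟨n, hn, hi⟩ := h₄.call (.var (env := [code a]) (i := 0) rfl)
  refine ⟨_, ⟨_, .call (.var rfl) (body := main) rfl (.call (f := 1) hi rfl ht)⟩, ?_,
    fun t' ht' => ?_⟩
  · simp only [Trace.outputs_append, Trace.outputs_replicate_none, hto]
    simp [Trace.outputs]
  · rw [← List.append_assoc] at ht'
    rcases prefix_append_cases ht' with h | ⟨v, hv, rfl⟩
    · refine ⟨0, by omega, by simp, ?_⟩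
      have := h.length_le
      simp at *
      omega
    · obtain ⟨i, hi, hi1, hi2⟩ := htb v hv
      refine ⟨i, hi, ?_, ?_⟩
      · rw [Trace.outputs_append, List.length_append]; omega
      · have : ∑ j ∈ Finset.range (i + 1), Q.eval (codeSize (next^[j] (init a))) ≤
            ∑ j ∈ Finset.range (i + 1), (Q + q' + 10).eval (codeSize (next^[j] (init a))) :=
          Finset.sum_le_sum fun j _ => by simp only [eval_add]; omega
        simp at *
        omega

end NegFlow

namespace NegFlow

/-! ### Simple directed cycles -/

section Cycles

variable {α V : Type} {src tgt : α → V}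

/-- The list of the arcs of a simple directed cycle, in reverse order: the tail of each arc is the
head of the arc after it in the list, cyclically, and no vertex is passed twice. -/
def IsCyc (src tgt : α → V) (l : List α) : Prop :=
  l ≠ [] ∧ Cycle.Chain (fun e f => src e = tgt f) (l : Cycle α) ∧ (l.map src).Nodup

theorem isCyc_cons {h : α} {t : List α} : IsCyc src tgt (h :: t) ↔
    List.IsChain (fun e f => src e = tgt f) (h :: (t ++ [h])) ∧ ((h :: t).map src).Nodup := by
  simp only [IsCyc, Cycle.chain_coe_cons, ne_eq, reduceCtorEq, not_false_eq_true, true_and]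

theorem map_src_of_isChain {h : α} {t : List α} {c : α}
    (hc : List.IsChain (fun e f => src e = tgt f) (h :: (t ++ [c]))) :
    (h :: t).map src = (t ++ [c]).map tgt := by
  induction t generalizing h with
  | nil => simpa using hc
  | cons x t ih =>
    rw [List.cons_append, List.isChain_cons_cons] at hc
    rw [List.map_cons, ih hc.2, List.cons_append, List.map_cons, hc.1]

namespace IsCyc

variable {l : List α}

theorem rotate {X Y : List α} (h : IsCyc src tgt (X ++ Y)) : IsCyc src tgt (Y ++ X) := by
  obtain ⟨h1, h2, h3⟩ := h
  refine ⟨by simpa [and_comm] using h1, ?_, ?_⟩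
  · have : ((Y ++ X : List α) : Cycle α) = (X ++ Y : List α) :=
      Cycle.coe_eq_coe.2 List.isRotated_append
    rwa [this]
  · rw [List.map_append] at h3 ⊢
    exact List.nodup_append_comm.1 h3

theorem perm (h : IsCyc src tgt l) : (l.map src).Perm (l.map tgt) := by
  cases l with
  | nil => exact absurd rfl h.1
  | cons a t =>
    rw [map_src_of_isChain (isCyc_cons.1 h).1]
    exact (List.perm_append_singleton a t).map tgt

theorem nodup (h : IsCyc src tgt l) : l.Nodup := h.2.2.of_map

theorem src_inj (h : IsCyc src tgt l) {e f : α} (he : e ∈ l) (hf : f ∈ l)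
    (hs : src e = src f) : e = f := List.inj_on_of_nodup_map h.2.2 he hf hs

theorem tgt_inj (h : IsCyc src tgt l) {e f : α} (he : e ∈ l) (hf : f ∈ l)
    (hs : tgt e = tgt f) : e = f :=
  List.inj_on_of_nodup_map (h.perm.nodup_iff.1 h.2.2) he hf hs

theorem exists_succ (h : IsCyc src tgt l) {e : α} (he : e ∈ l) : ∃ f ∈ l, src f = tgt e := by
  simpa using h.perm.mem_iff.2 (List.mem_map_of_mem (f := tgt) he)

theorem exists_pred (h : IsCyc src tgt l) {e : α} (he : e ∈ l) : ∃ f ∈ l, tgt f = src e := by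
  simpa using h.perm.mem_iff.1 (List.mem_map_of_mem (f := src) he)

theorem sum_src {M : Type} [AddCommMonoid M] (h : IsCyc src tgt l) (π : V → M) :
    (l.map fun e => π (src e)).sum = (l.map fun e => π (tgt e)).sum := by
  simpa [Function.comp_def] using (h.perm.map π).sum_eq

/-- A property that passes on from each arc of a cycle to the next one holds for none of the arcs
or for all of them. -/
theorem forall_of_mem (h : IsCyc src tgt l) {P : α → Prop}
    (hP : ∀ e ∈ l, ∀ f ∈ l, src f = tgt e → P e → P f) {e : α} (he : e ∈ l) (hPe : P e) :
    ∀ f ∈ l, P f := by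
  obtain ⟨X, Y, rfl⟩ := List.append_of_mem he
  have h' := h.rotate
  rw [List.cons_append, isCyc_cons] at h'
  have key : ∀ t : List α, ∀ a, List.IsChain (fun e f => src e = tgt f) (a :: (t ++ [e])) →
      (∀ x ∈ a :: t, x ∈ X ++ e :: Y) → ∀ x ∈ a :: t, P x := by
    intro t
    induction t with
    | nil =>
      intro a hc ha x hx
      obtain rfl := List.mem_singleton.1 hx
      exact hP e (by simp) x (ha x hx) (by simpa using hc) hPe
    | cons b t ih =>
      intro a hc ha x hx
      rw [List.cons_append, List.isChain_cons_cons] at hc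
      have hb := ih b hc.2 (fun x hx => ha x (List.mem_cons_of_mem _ hx))
      rcases List.mem_cons.1 hx with rfl | hx
      · exact hP b (ha b (by simp)) x (ha x (by simp)) hc.1 (hb b (by simp))
      · exact hb x hx
  intro f hf
  refine key (Y ++ X) e h'.1 (fun x hx => ?_) f ?_
  · simp at hx ⊢; tauto
  · simp at hf ⊢; tauto

theorem mem_iff_of_subset (h : IsCyc src tgt l) {l' : List α} (h' : IsCyc src tgt l')
    (hs : ∀ e ∈ l', e ∈ l) (e : α) : e ∈ l' ↔ e ∈ l := by
  refine ⟨hs e, fun he => ?_⟩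
  obtain ⟨a, ha⟩ := List.exists_mem_of_ne_nil _ h'.1
  refine h.forall_of_mem (P := (· ∈ l')) (fun e _ f hf hfe he' => ?_) (hs a ha) ha e he
  obtain ⟨g, hg, hge⟩ := h'.exists_succ he'
  rwa [h.src_inj hf (hs g hg) (hfe.trans hge.symm)]

theorem perm_of_mem_iff (h : IsCyc src tgt l) {l' : List α} (h' : IsCyc src tgt l')
    (hs : ∀ e, e ∈ l' ↔ e ∈ l) : l'.Perm l := (List.perm_ext_iff_of_nodup h'.nodup h.nodup).2 hs

/-- A cycle is determined by its first arc and the set of its arcs. -/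
theorem ext_of_cons {a : α} {t t' : List α} (h : IsCyc src tgt (a :: t))
    (h' : IsCyc src tgt (a :: t')) (hs : ∀ e, e ∈ a :: t' ↔ e ∈ a :: t) : t = t' := by
  have hl := (h.perm_of_mem_iff h' hs).length_eq
  have key : ∀ u u' : List α, ∀ b, u.length = u'.length →
      List.IsChain (fun e f => src e = tgt f) (b :: (u ++ [a])) →
      List.IsChain (fun e f => src e = tgt f) (b :: (u' ++ [a])) →
      (∀ x ∈ u, x ∈ a :: t) → (∀ x ∈ u', x ∈ a :: t) → u = u' := by
    intro u
    induction u with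
    | nil => intro u' b hl _ _ _ _; exact (List.length_eq_zero_iff.1 hl.symm).symm
    | cons x u ih =>
      rintro (_ | ⟨x', u'⟩) b hl hc hc' hu hu'
      · simp at hl
      · rw [List.cons_append, List.isChain_cons_cons] at hc hc'
        obtain rfl := h.tgt_inj (hu x (by simp)) (hu' x' (by simp)) (hc.1.symm.trans hc'.1)
        rw [ih u' x (by simpa using hl) hc.2 hc'.2 (fun y hy => hu y (by simp [hy]))
          fun y hy => hu' y (by simp [hy])]
  exact key t t' a (by simpa using hl.symm) (isCyc_cons.1 h).1 (isCyc_cons.1 h').1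
    (fun x hx => by simp [hx]) fun x hx => (hs x).1 (by simp [hx])

end IsCyc

theorem isCyc_map {β W : Type} {src' tgt' : β → W} {f : α → β} {g : V → W}
    (hg : Function.Injective g) (hs : ∀ e, src' (f e) = g (src e))
    (ht : ∀ e, tgt' (f e) = g (tgt e)) {l : List α} :
    IsCyc src' tgt' (l.map f) ↔ IsCyc src tgt l := by
  cases l with
  | nil => simp [IsCyc]
  | cons a t =>
    rw [List.map_cons, isCyc_cons, isCyc_cons]
    have h1 : f a :: (t.map f ++ [f a]) = (a :: (t ++ [a])).map f := by simp
    have h2 : ((f a :: t.map f).map src') = ((a :: t).map src).map g := by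
      simp [hs, Function.comp_def]
    rw [h1, h2, List.isChain_map, List.nodup_map_iff hg]
    simp only [hs, ht, hg.eq_iff]

/-- A finite nonempty set of arcs, each of which is followed by another one, contains a cycle. -/
theorem exists_isCyc {S : Set α} (hfin : S.Finite) {a : α} (ha : a ∈ S)
    (hS : ∀ e ∈ S, ∃ f ∈ S, src f = tgt e) : ∃ l, IsCyc src tgt l ∧ ∀ e ∈ l, e ∈ S := by
  classical
  -- the next arc may depend only on the vertex that has been reached
  have hS' : ∀ v : V, ∃ f, (∃ e ∈ S, tgt e = v) → f ∈ S ∧ src f = v := by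
    intro v
    by_cases h : ∃ e ∈ S, tgt e = v
    · obtain ⟨e, he, rfl⟩ := h
      obtain ⟨f, hf⟩ := hS e he
      exact ⟨f, fun _ => hf⟩
    · exact ⟨a, fun h' => absurd h' h⟩
  choose out hout using hS'
  set nx : α → α := fun e => out (tgt e)
  have hnx : ∀ e ∈ S, nx e ∈ S ∧ src (nx e) = tgt e := fun e he => hout _ ⟨e, he, rfl⟩
  have hit : ∀ n, ∀ e ∈ S, nx^[n] e ∈ S := by
    intro n
    induction n with
    | zero => exact fun e he => he
    | succ n ih =>
      intro e he
      rw [Function.iterate_succ_apply]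
      exact ih _ (hnx e he).1
  have : Finite S := hfin
  obtain ⟨i, j, hij, h⟩ :=
    Finite.exists_ne_map_eq_of_infinite fun n : ℕ => (⟨nx^[n] a, hit n a ha⟩ : S)
  rw [Subtype.mk.injEq] at h
  wlog hlt : i < j generalizing i j
  · exact this j i hij.symm h.symm (by omega)
  set b := nx^[i] a
  have hb : b ∈ S := hit i a ha
  have hper : b ∈ Function.periodicPts nx := by
    refine ⟨j - i, by omega, ?_⟩
    change nx^[j - i] (nx^[i] a) = nx^[i] a
    rw [← Function.iterate_add_apply, Nat.sub_add_cancel hlt.le]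
    exact h.symm
  have hp := Function.minimalPeriod_pos_of_mem_periodicPts hper
  obtain ⟨m, hm⟩ : ∃ m, Function.minimalPeriod nx b = m + 1 := ⟨_, (Nat.sub_add_cancel hp).symm⟩
  have hback : nx^[m + 1] b = b := hm ▸ Function.iterate_minimalPeriod
  have hout' : ∀ n, out (src (nx^[n] b)) = nx^[n] b := by
    intro n
    cases n with
    | zero =>
      rw [Function.iterate_zero, id, ← hback, Function.iterate_succ_apply',
        (hnx _ (hit m b hb)).2]
    | succ n => rw [Function.iterate_succ_apply', (hnx _ (hit n b hb)).2]
  have hl : b :: (List.range m).map (fun i => nx^[i + 1] b) =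
      (List.range (m + 1)).map fun i => nx^[i] b := by
    rw [List.range_succ_eq_map]; simp [Function.comp_def]
  refine ⟨b :: ((List.range m).map fun i => nx^[i + 1] b).reverse, isCyc_cons.2 ⟨?_, ?_⟩, ?_⟩
  · have h1 : List.IsChain (fun e f => tgt e = src f)
        ((List.range (m + 2)).map fun i => nx^[i] b) := by
      rw [List.isChain_map, List.isChain_range_succ]
      intro i _
      rw [Function.iterate_succ_apply', (hnx _ (hit i b hb)).2]
    rw [List.range_succ, List.map_append, ← hl, List.map_singleton, hback,
      ← List.isChain_reverse] at h1
    simpa [eq_comm] using h1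
  · have h1 : ((b :: ((List.range m).map fun i => nx^[i + 1] b).reverse).map src).Perm
        (((List.range (m + 1)).map fun i => nx^[i] b).map src) := by
      rw [← hl]
      exact ((List.reverse_perm _).cons b).map src
    rw [h1.nodup_iff, List.map_map]
    refine List.Nodup.map_on (fun x hx y hy hxy => ?_) List.nodup_range
    have h2 : nx^[x] b = nx^[y] b := by
      rw [← hout' x, ← hout' y]; exact congrArg out hxy
    refine Function.iterate_injOn_Iio_minimalPeriod (f := nx) (x := b) ?_ ?_ h2
    · rw [hm]; simpa using hx
    · rw [hm]; simpa using hy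
  · intro e he
    simp only [List.mem_cons, List.mem_reverse, List.mem_map] at he
    rcases he with rfl | ⟨k, -, rfl⟩
    · exact hb
    · exact hit _ b hb

/-- A closed walk within a set of arcs contains a cycle. -/
theorem exists_isCyc_of_transGen {S : Set α} (hfin : S.Finite) {x : V}
    (h : Relation.TransGen (fun u v => ∃ e ∈ S, src e = u ∧ tgt e = v) x x) :
    ∃ l, IsCyc src tgt l ∧ ∀ e ∈ l, e ∈ S := by
  obtain ⟨y, ⟨e, he, rfl, rfl⟩, h'⟩ := Relation.TransGen.head'_iff.1 h
  set T : Set α := {f | f ∈ S ∧ Relation.ReflTransGen (fun u v => ∃ e ∈ S, src e = u ∧ tgt e = v)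
    (tgt f) (src e)}
  have hT : ∀ f ∈ T, ∃ g ∈ T, src g = tgt f := by
    intro f hf
    rcases Relation.ReflTransGen.cases_head hf.2 with h0 | ⟨z, ⟨g, hg, hg1, rfl⟩, hz⟩
    · exact ⟨e, ⟨he, h'⟩, h0.symm⟩
    · exact ⟨g, ⟨hg, hz⟩, hg1⟩
  obtain ⟨l, hl, hlT⟩ := exists_isCyc (S := T) (hfin.subset fun f hf => hf.1) ⟨he, h'⟩ hT
  exact ⟨l, hl, fun e he => (hlT e he).1⟩

theorem IsCyc.transGen {l : List α} (hl : IsCyc src tgt l) {e : α} (he : e ∈ l) :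
    Relation.TransGen (fun u v => ∃ f ∈ l, src f = u ∧ tgt f = v) (src e) (src e) := by
  have := hl.forall_of_mem (P := fun f => Relation.TransGen
    (fun u v => ∃ f ∈ l, src f = u ∧ tgt f = v) (src e) (tgt f))
    (fun f hf g hg hgf h => h.tail ⟨g, hg, hgf, rfl⟩) he (.single ⟨e, he, rfl, rfl⟩)
  obtain ⟨f, hf, hfe⟩ := hl.exists_pred he
  exact hfe ▸ this f hf

end Cycles
end NegFlow

namespace NegFlow

/-! ### Circulations and cycles -/

namespace WDigraph

variable {G : WDigraph}

/-- The characteristic vector of a list of arcs. -/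
def chi (G : WDigraph) (l : List (Fin G.nE)) : Fin G.nE → ℝ := fun e => if e ∈ l then 1 else 0

/-- The total weight of a vector. -/
def weight (G : WDigraph) (y : Fin G.nE → ℝ) : ℝ := ∑ e, (G.wt e : ℝ) * y e

/-- Nonnegative circulations. -/
def IsFlow (G : WDigraph) (y : Fin G.nE → ℝ) : Prop :=
  (∀ u : Fin G.nV, ∑ e with G.src e = u, y e = ∑ e with G.tgt e = u, y e) ∧ ∀ e, 0 ≤ y e

/-- The simple directed cycles of a graph. -/
abbrev Cyc (G : WDigraph) (l : List (Fin G.nE)) : Prop := IsCyc G.src G.tgt l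

theorem mem_polyhedron {y : Fin G.nE → ℝ} :
    y ∈ G.polyhedron ↔ G.IsFlow y ∧ G.weight y = -1 := by
  simp only [polyhedron, Set.mem_ofPred_eq, IsFlow, weight, sub_eq_zero]; tauto

theorem chi_of_mem {l : List (Fin G.nE)} {e : Fin G.nE} (h : e ∈ l) : G.chi l e = 1 := if_pos h

theorem chi_of_not_mem {l : List (Fin G.nE)} {e : Fin G.nE} (h : e ∉ l) : G.chi l e = 0 :=
  if_neg h

theorem chi_nonneg (l : List (Fin G.nE)) (e : Fin G.nE) : 0 ≤ G.chi l e := by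
  unfold chi; split_ifs <;> norm_num

theorem chi_congr {l l' : List (Fin G.nE)} (h : ∀ e, e ∈ l ↔ e ∈ l') : G.chi l = G.chi l' := by
  funext e; simp only [chi, h]

theorem sum_mul_chi {l : List (Fin G.nE)} (hl : l.Nodup) (f : Fin G.nE → ℝ) :
    ∑ e, f e * G.chi l e = (l.map f).sum := by
  rw [← List.sum_toFinset f hl]
  simp [chi, Finset.sum_ite]
  congr 1; ext; simp

theorem weight_chi {l : List (Fin G.nE)} (hl : l.Nodup) :
    G.weight (G.chi l) = (l.map fun e => (G.wt e : ℝ)).sum := sum_mul_chi hl _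

theorem sum_chi {l : List (Fin G.nE)} (hl : l.Nodup) : ∑ e, G.chi l e = l.length := by
  simpa using sum_mul_chi (G := G) hl fun _ => 1

theorem weight_add (x y : Fin G.nE → ℝ) : G.weight (x + y) = G.weight x + G.weight y := by
  simp [weight, mul_add, Finset.sum_add_distrib]

theorem weight_smul (c : ℝ) (y : Fin G.nE → ℝ) : G.weight (c • y) = c * G.weight y := by
  simp only [weight, Finset.mul_sum, Pi.smul_apply, smul_eq_mul]
  exact Finset.sum_congr rfl fun _ _ => by ring

theorem weight_sub (x y : Fin G.nE → ℝ) : G.weight (x - y) = G.weight x - G.weight y := by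
  simp [weight, mul_sub, Finset.sum_sub_distrib]

theorem IsFlow.add {x y : Fin G.nE → ℝ} (hx : G.IsFlow x) (hy : G.IsFlow y) : G.IsFlow (x + y) :=
  ⟨fun u => by simp [Finset.sum_add_distrib, hx.1 u, hy.1 u],
    fun e => add_nonneg (hx.2 e) (hy.2 e)⟩

theorem IsFlow.smul {y : Fin G.nE → ℝ} (hy : G.IsFlow y) {c : ℝ} (hc : 0 ≤ c) :
    G.IsFlow (c • y) :=
  ⟨fun u => by simp [← Finset.mul_sum, hy.1 u], fun e => mul_nonneg hc (hy.2 e)⟩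

theorem IsFlow.add_smul {x y : Fin G.nE → ℝ} (hx : G.IsFlow x) (hy : G.IsFlow y) {c : ℝ}
    (h : ∀ e, 0 ≤ x e + c * y e) : G.IsFlow (x + c • y) :=
  ⟨fun u => by simp [Finset.sum_add_distrib, ← Finset.mul_sum, hx.1 u, hy.1 u], h⟩

theorem isFlow_chi {l : List (Fin G.nE)} (hl : G.Cyc l) : G.IsFlow (G.chi l) := by
  refine ⟨fun u => ?_, chi_nonneg l⟩
  have h := hl.sum_src fun v => if v = u then (1 : ℝ) else 0
  rw [← sum_mul_chi hl.nodup, ← sum_mul_chi hl.nodup] at h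
  simpa [Finset.sum_filter] using h

/-- A circulation on a cycle is constant. -/
theorem IsFlow.eq_smul_chi {y : Fin G.nE → ℝ} (hy : G.IsFlow y) {l : List (Fin G.nE)}
    (hl : G.Cyc l) (hs : ∀ e, e ∉ l → y e = 0) : ∃ c : ℝ, 0 ≤ c ∧ y = c • G.chi l := by
  obtain ⟨a, ha⟩ := List.exists_mem_of_ne_nil _ hl.1
  have key := hl.forall_of_mem (P := fun e => y e = y a) (fun e he f hf hfe hea => ?_) ha rfl
  · refine ⟨y a, hy.2 a, funext fun e => ?_⟩
    by_cases he : e ∈ l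
    · simp [chi_of_mem he, key e he]
    · simp [chi_of_not_mem he, hs e he]
  · have h := hy.1 (G.tgt e)
    rw [Finset.sum_eq_single_of_mem f (by simpa using hfe), Finset.sum_eq_single_of_mem e (by simp)]
      at h
    · exact h.trans hea
    · intro g hg hne
      by_contra h0
      exact hne (hl.tgt_inj (by_contra fun h => h0 (hs g h)) he (by simpa using hg))
    · intro g hg hne
      by_contra h0
      exact hne (hl.src_inj (by_contra fun h => h0 (hs g h)) hf
        ((by simpa using hg : G.src g = G.tgt e).trans hfe.symm))

theorem IsFlow.exists_cyc {y : Fin G.nE → ℝ} (hy : G.IsFlow y) (h0 : y ≠ 0) :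
    ∃ l, G.Cyc l ∧ ∀ e ∈ l, 0 < y e := by
  obtain ⟨a, ha⟩ := Function.ne_iff.1 h0
  refine exists_isCyc (S := {e | 0 < y e}) (Set.toFinite _) (a := a)
    (lt_of_le_of_ne (hy.2 a) (Ne.symm ha))
    fun e he => ?_
  by_contra! h
  have h1 : ∑ f with G.src f = G.tgt e, y f = 0 :=
    Finset.sum_eq_zero fun f hf => le_antisymm
      (not_lt.1 fun hlt => h f hlt (by simpa using hf)) (hy.2 f)
  rw [hy.1, Finset.sum_eq_zero_iff_of_nonneg fun f _ => hy.2 f] at h1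
  have he : 0 < y e := he
  exact he.ne' (h1 e (by simp))

/-- Every nonnegative circulation is a conic combination of cycles in its support. -/
theorem IsFlow.induction {S : Set (Fin G.nE)} {motive : (Fin G.nE → ℝ) → Prop} (h0 : motive 0)
    (hadd : ∀ y l (c : ℝ), G.IsFlow y → G.Cyc l → (∀ e ∈ l, e ∈ S) → 0 ≤ c → motive y →
      motive (y + c • G.chi l)) {y : Fin G.nE → ℝ} (hy : G.IsFlow y) (hS : ∀ e, y e ≠ 0 → e ∈ S) :
    motive y := by
  classical
  induction hn : (Finset.univ.filter fun e => y e ≠ 0).card using Nat.strong_induction_on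
    generalizing y with
  | _ n ih =>
    by_cases hy0 : y = 0
    · exact hy0 ▸ h0
    obtain ⟨l, hl, hlp⟩ := hy.exists_cyc hy0
    obtain ⟨a, ha, hmin⟩ := Finset.exists_min_image l.toFinset y
      (by obtain ⟨a, ha⟩ := List.exists_mem_of_ne_nil _ hl.1; exact ⟨a, by simpa using ha⟩)
    simp only [List.mem_toFinset] at ha hmin
    have hle : ∀ e, 0 ≤ y e + -y a * G.chi l e := by
      intro e
      by_cases he : e ∈ l
      · rw [chi_of_mem he]; linarith [hmin e he]
      · rw [chi_of_not_mem he]; linarith [hy.2 e]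
    have hz := hy.add_smul (isFlow_chi hl) hle
    have hsub : ∀ e, (y + -y a • G.chi l) e ≠ 0 → y e ≠ 0 := by
      intro e h h'
      have he : e ∉ l := fun he => (hlp e he).ne' h'
      exact h (by simp [h', chi_of_not_mem he])
    have hlt : (Finset.univ.filter fun e => (y + -y a • G.chi l) e ≠ 0).card < n := by
      rw [← hn]
      refine Finset.card_lt_card ⟨fun e he => ?_, fun h => ?_⟩
      · simpa using hsub e (by simpa using he)
      · have := h (show a ∈ _ by simpa using (hlp a ha).ne')
        simp [chi_of_mem ha] at this
    have := hadd _ l (y a) hz hl (fun e he => hS e (hlp e he).ne') (hy.2 a)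
      (ih _ hlt hz (fun e he => hS e (hsub e he)) rfl)
    rwa [show y + -y a • G.chi l + y a • G.chi l = y by module] at this

theorem IsFlow.weight_nonneg {y : Fin G.nE → ℝ} (hy : G.IsFlow y)
    (h : ∀ l, G.Cyc l → (∀ e ∈ l, y e ≠ 0) → 0 ≤ G.weight (G.chi l)) : 0 ≤ G.weight y :=
  hy.induction (S := {e | y e ≠ 0}) (motive := fun z => 0 ≤ G.weight z) (by simp [weight])
    (fun z l c _ hl hS hc hz => by
      rw [weight_add, weight_smul]; exact add_nonneg hz (mul_nonneg hc (h l hl hS)))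
    fun _ h => h

theorem IsFlow.weight_nonpos {y : Fin G.nE → ℝ} (hy : G.IsFlow y)
    (h : ∀ l, G.Cyc l → (∀ e ∈ l, y e ≠ 0) → G.weight (G.chi l) ≤ 0) : G.weight y ≤ 0 :=
  hy.induction (S := {e | y e ≠ 0}) (motive := fun z => G.weight z ≤ 0) (by simp [weight])
    (fun z l c _ hl hS hc hz => by
      rw [weight_add, weight_smul]
      exact add_nonpos hz (mul_nonpos_of_nonneg_of_nonpos hc (h l hl hS)))
    fun _ h => h

/-- A vector whose support lies in that of `y ≥ 0` has a small multiple that stays below `y`. -/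
theorem exists_pos_le {y z : Fin G.nE → ℝ} (hy : ∀ e, 0 ≤ y e) (h : ∀ e, z e ≠ 0 → y e ≠ 0) :
    ∃ c : ℝ, 0 < c ∧ ∀ e, c * |z e| ≤ y e := by
  classical
  by_cases hne : (Finset.univ.filter fun e => z e ≠ 0).Nonempty
  · obtain ⟨a, ha, hmin⟩ := Finset.exists_min_image _ (fun e => y e / |z e|) hne
    simp only [Finset.mem_filter, Finset.mem_univ, true_and] at ha hmin
    refine ⟨y a / |z a|, div_pos (lt_of_le_of_ne (hy a) (h a ha).symm) (abs_pos.2 ha), fun e => ?_⟩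
    by_cases he : z e = 0
    · simpa [he] using hy e
    · exact (le_div_iff₀ (abs_pos.2 he)).1 (hmin e he)
  · refine ⟨1, one_pos, fun e => ?_⟩
    have : z e = 0 := by
      by_contra h0
      exact hne ⟨e, by simpa using h0⟩
    simpa [this] using hy e

/-! ### Extreme points -/

theorem mem_verts_iff {x : Fin G.nE → ℝ} : x ∈ G.verts ↔
    ∃ l, G.Cyc l ∧ G.weight (G.chi l) < 0 ∧ x = (-G.weight (G.chi l))⁻¹ • G.chi l := by
  constructor
  · rintro ⟨hx, hext⟩
    obtain ⟨hf, hw⟩ := mem_polyhedron.1 hx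
    obtain ⟨l, hl, hls, hneg⟩ : ∃ l, G.Cyc l ∧ (∀ e ∈ l, x e ≠ 0) ∧ G.weight (G.chi l) < 0 := by
      by_contra! h
      linarith [hf.weight_nonneg h]
    refine ⟨l, hl, hneg, ?_⟩
    set z := (-G.weight (G.chi l))⁻¹ • G.chi l with hz
    have hzf : G.IsFlow z := (isFlow_chi hl).smul (inv_nonneg.2 (by linarith))
    have hzw : G.weight z = -1 := by
      rw [hz, weight_smul, inv_neg, neg_mul, inv_mul_cancel₀ hneg.ne]
    obtain ⟨c, hc, hcle⟩ := exists_pos_le (y := x) (z := x - z) hf.2 (fun e he h0 => he (by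
      have : e ∉ l := fun h => hls e h h0
      simp [h0, hz, chi_of_not_mem this]))
    have hmem : ∀ s : ℝ, |s| = c → x + s • (x - z) ∈ G.polyhedron := by
      intro s hs
      refine mem_polyhedron.2 ⟨⟨fun u => ?_, fun e => ?_⟩, ?_⟩
      · simp [Finset.sum_add_distrib, ← Finset.mul_sum, Finset.sum_sub_distrib, hf.1 u, hzf.1 u]
      · have h1 := hcle e
        rw [← hs, ← abs_mul] at h1
        have h2 := neg_abs_le (s * (x - z) e)
        simp only [Pi.add_apply, Pi.smul_apply, smul_eq_mul]
        linarith
      · rw [weight_add, weight_smul, weight_sub, hw, hzw]; ring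
    have h1 := hext (hmem c (abs_of_pos hc)) (hmem (-c) (by rw [abs_neg, abs_of_pos hc]))
      ⟨1 / 2, 1 / 2, by norm_num, by norm_num, by norm_num, by module⟩
    have h2 : c • (x - z) = 0 := by simpa using h1
    rcases smul_eq_zero.1 h2 with h | h
    · exact absurd h hc.ne'
    · exact sub_eq_zero.1 h
  · rintro ⟨l, hl, hneg, rfl⟩
    have hpos : 0 < (-G.weight (G.chi l))⁻¹ := inv_pos.2 (by linarith)
    refine ⟨mem_polyhedron.2 ⟨(isFlow_chi hl).smul hpos.le, ?_⟩, ?_⟩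
    · rw [weight_smul, inv_neg, neg_mul, inv_mul_cancel₀ hneg.ne]
    · rintro y hy z hz ⟨a, b, ha, hb, hab, he⟩
      obtain ⟨hyf, hyw⟩ := mem_polyhedron.1 hy
      obtain ⟨hzf, hzw⟩ := mem_polyhedron.1 hz
      obtain ⟨c, hc, rfl⟩ := hyf.eq_smul_chi hl (fun e hel => by
        have h := congrFun he e
        simp only [Pi.add_apply, Pi.smul_apply, smul_eq_mul, chi_of_not_mem hel, mul_zero] at h
        have h1 := mul_nonneg ha.le (hyf.2 e)
        have h2 := mul_nonneg hb.le (hzf.2 e)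
        exact (mul_eq_zero.1 (by linarith : a * y e = 0)).resolve_left ha.ne')
      rw [weight_smul] at hyw
      congr 1
      exact eq_inv_of_mul_eq_one_left (by rw [mul_neg, hyw, neg_neg])

/-! ### Extreme directions -/

theorem isDirection_iff (hP : G.polyhedron.Nonempty) {d : Fin G.nE → ℝ} :
    IsDirection G.polyhedron d ↔ G.IsFlow d ∧ G.weight d = 0 := by
  constructor
  · intro hd
    obtain ⟨x, hx⟩ := hP
    obtain ⟨hxf, hxw⟩ := mem_polyhedron.1 hx
    obtain ⟨h1f, h1w⟩ := mem_polyhedron.1 (hd x hx 1 zero_le_one)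
    refine ⟨⟨fun u => ?_, fun e => ?_⟩, ?_⟩
    · have := h1f.1 u
      simpa [Finset.sum_add_distrib, hxf.1 u] using this
    · by_contra! hneg
      have hμ : 0 ≤ (x e + 1) / -d e := div_nonneg (by linarith [hxf.2 e]) (by linarith)
      have := (mem_polyhedron.1 (hd x hx _ hμ)).1.2 e
      have h2 : (x e + 1) / -d e * d e = -(x e + 1) := by
        rw [div_neg, neg_mul, div_mul_cancel₀ _ hneg.ne]
      simp only [Pi.add_apply, Pi.smul_apply, smul_eq_mul, h2] at this
      linarith
    · rw [weight_add, hxw, weight_smul] at h1w; linarith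
  · rintro ⟨hf, hw⟩ x hx μ hμ
    obtain ⟨hxf, hxw⟩ := mem_polyhedron.1 hx
    exact mem_polyhedron.2 ⟨hxf.add (hf.smul hμ), by rw [weight_add, weight_smul, hw, hxw]; ring⟩

theorem dirs_eq_empty (hP : ¬ G.polyhedron.Nonempty) : G.dirs = ∅ := by
  -- every vector is a direction of the empty set, in particular the opposite of a given one
  have hdir : ∀ d, IsDirection G.polyhedron d := fun d x hx => absurd ⟨x, hx⟩ hP
  refine Set.eq_empty_of_forall_notMem fun d hd => ?_
  obtain ⟨⟨h0, -, h⟩, -⟩ := hd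
  have := (h d (-d) (hdir _) (hdir _) 2 1 (by norm_num) one_pos (by module)).2
  obtain ⟨r, hr, he⟩ := this.exists_pos_left (neg_ne_zero.2 h0) h0
  have h1 : (1 + r) • d = 0 := by
    rw [add_smul, one_smul]; nth_rewrite 1 [← he]; module
  rcases smul_eq_zero.1 h1 with h1 | h1
  · linarith
  · exact h0 h1

/-- Two cycles whose union contains no further cycle. -/
def NoThird (G : WDigraph) (l₁ l₂ : List (Fin G.nE)) : Prop :=
  ∀ l, G.Cyc l → (∀ e ∈ l, e ∈ l₁ ∨ e ∈ l₂) → (∀ e, e ∈ l ↔ e ∈ l₁) ∨ ∀ e, e ∈ l ↔ e ∈ l₂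

/-- A direction that lies in the support of an extreme direction is a multiple of it. -/
theorem eq_smul_of_extreme (hP : G.polyhedron.Nonempty) {d z : Fin G.nE → ℝ}
    (hd : IsExtremeDirection G.polyhedron d) (hz : G.IsFlow z) (hzw : G.weight z = 0)
    (hz0 : z ≠ 0) (hs : ∀ e, z e ≠ 0 → d e ≠ 0) : ∃ c : ℝ, 0 < c ∧ d = c • z := by
  obtain ⟨h0, hdir, hext⟩ := hd
  obtain ⟨hdf, hdw⟩ := (isDirection_iff hP).1 hdir
  obtain ⟨c, hc, hle⟩ := exists_pos_le hdf.2 hs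
  have h1 : IsDirection G.polyhedron (d + -c • z) := by
    refine (isDirection_iff hP).2 ⟨hdf.add_smul hz fun e => ?_, ?_⟩
    · have := hle e
      rw [abs_of_nonneg (hz.2 e)] at this
      linarith
    · rw [weight_add, weight_smul, hdw, hzw]; ring
  obtain ⟨-, h2⟩ := hext _ z h1 ((isDirection_iff hP).2 ⟨hz, hzw⟩) 1 c one_pos hc (by module)
  obtain ⟨r, hr, he⟩ := h2.exists_pos_left hz0 h0
  exact ⟨r, hr, he.symm⟩

/-- The direction with support on the cycles `l₁` and `l₂`, of negative and positive weight. -/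
def pairDir (G : WDigraph) (l₁ l₂ : List (Fin G.nE)) : Fin G.nE → ℝ :=
  G.weight (G.chi l₂) • G.chi l₁ + -G.weight (G.chi l₁) • G.chi l₂

theorem isFlow_pairDir {l₁ l₂ : List (Fin G.nE)} (h₁ : G.Cyc l₁) (h₂ : G.Cyc l₂)
    (hn : G.weight (G.chi l₁) < 0) (hp : 0 < G.weight (G.chi l₂)) : G.IsFlow (G.pairDir l₁ l₂) :=
  ((isFlow_chi h₁).smul hp.le).add ((isFlow_chi h₂).smul (by linarith))

theorem weight_pairDir (l₁ l₂ : List (Fin G.nE)) : G.weight (G.pairDir l₁ l₂) = 0 := by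
  rw [pairDir, weight_add, weight_smul, weight_smul]; ring

theorem pairDir_ne_zero_iff {l₁ l₂ : List (Fin G.nE)} (hn : G.weight (G.chi l₁) < 0)
    (hp : 0 < G.weight (G.chi l₂)) (e : Fin G.nE) :
    G.pairDir l₁ l₂ e ≠ 0 ↔ e ∈ l₁ ∨ e ∈ l₂ := by
  by_cases h1 : e ∈ l₁ <;> by_cases h2 : e ∈ l₂ <;>
    simp [pairDir, chi_of_mem, chi_of_not_mem, h1, h2, hn.ne, hp.ne']
  linarith

theorem chi_ne_zero_iff {l : List (Fin G.nE)} (e : Fin G.nE) : G.chi l e ≠ 0 ↔ e ∈ l := by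
  by_cases h : e ∈ l <;> simp [chi_of_mem, chi_of_not_mem, h]

theorem Cyc.chi_ne_zero {l : List (Fin G.nE)} (hl : G.Cyc l) : G.chi l ≠ 0 := by
  obtain ⟨a, ha⟩ := List.exists_mem_of_ne_nil _ hl.1
  exact Function.ne_iff.2 ⟨a, (chi_ne_zero_iff a).2 ha⟩

theorem Cyc.pairDir_ne_zero {l₁ l₂ : List (Fin G.nE)} (h₁ : G.Cyc l₁)
    (hn : G.weight (G.chi l₁) < 0) (hp : 0 < G.weight (G.chi l₂)) : G.pairDir l₁ l₂ ≠ 0 := by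
  obtain ⟨a, ha⟩ := List.exists_mem_of_ne_nil _ h₁.1
  exact Function.ne_iff.2 ⟨a, (pairDir_ne_zero_iff hn hp a).2 (.inl ha)⟩

/-- Removing a little of a cycle of positive weight leaves a circulation of negative weight. -/
theorem IsFlow.exists_neg_cyc {d : Fin G.nE → ℝ} (hd : G.IsFlow d) (hw : G.weight d = 0)
    {l : List (Fin G.nE)} (hl : G.Cyc l) (hs : ∀ e ∈ l, d e ≠ 0)
    (hp : 0 < G.weight (G.chi l)) :
    ∃ l', G.Cyc l' ∧ (∀ e ∈ l', d e ≠ 0) ∧ G.weight (G.chi l') < 0 := by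
  by_contra! h
  obtain ⟨c, hc, hle⟩ := exists_pos_le (z := G.chi l) hd.2
    fun e he => hs e ((chi_ne_zero_iff e).1 he)
  have hf : G.IsFlow (d + -c • G.chi l) := hd.add_smul (isFlow_chi hl) fun e => by
    have := hle e
    rw [abs_of_nonneg (chi_nonneg l e)] at this
    linarith
  have := hf.weight_nonneg fun l' hl' hs' => h l' hl' fun e he h0 => hs' e he (by
    have : e ∉ l := fun he => hs e he h0
    simp [h0, chi_of_not_mem this])
  rw [weight_add, weight_smul, hw] at this
  have := mul_pos hc hp
  linarith

/-- Removing a little of a cycle of negative weight leaves a circulation of positive weight. -/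
theorem IsFlow.exists_pos_cyc {d : Fin G.nE → ℝ} (hd : G.IsFlow d) (hw : G.weight d = 0)
    {l : List (Fin G.nE)} (hl : G.Cyc l) (hs : ∀ e ∈ l, d e ≠ 0)
    (hp : G.weight (G.chi l) < 0) :
    ∃ l', G.Cyc l' ∧ (∀ e ∈ l', d e ≠ 0) ∧ 0 < G.weight (G.chi l') := by
  by_contra! h
  obtain ⟨c, hc, hle⟩ := exists_pos_le (z := G.chi l) hd.2
    fun e he => hs e ((chi_ne_zero_iff e).1 he)
  have hf : G.IsFlow (d + -c • G.chi l) := hd.add_smul (isFlow_chi hl) fun e => by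
    have := hle e
    rw [abs_of_nonneg (chi_nonneg l e)] at this
    linarith
  have := hf.weight_nonpos fun l' hl' hs' => h l' hl' fun e he h0 => hs' e he (by
    have : e ∉ l := fun he => hs e he h0
    simp [h0, chi_of_not_mem this])
  rw [weight_add, weight_smul, hw] at this
  have := mul_pos_of_neg_of_neg hp (neg_lt_zero.2 hc)
  linarith

/-- Characteristic vectors of distinct cycles satisfy no relation of this shape. -/
theorem mem_iff_of_comb_eq {l l₁ l₂ : List (Fin G.nE)} (hl : G.Cyc l) (h₁ : G.Cyc l₁)
    (h₂ : G.Cyc l₂) {α β γ δ : ℝ} (hγ : 0 < γ)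
    (h : α • G.chi l₁ + β • G.chi l₂ = γ • G.chi l + δ • G.chi l₂)
    (hsub : ∀ e ∈ l, e ∈ l₁ ∨ e ∈ l₂) (hne : ¬ ∀ e, e ∈ l ↔ e ∈ l₂) :
    ∀ e, e ∈ l ↔ e ∈ l₁ := by
  have hc : ∀ e, α * G.chi l₁ e + β * G.chi l₂ e = γ * G.chi l e + δ * G.chi l₂ e :=
    fun e => congrFun h e
  obtain ⟨a, ha, ha2⟩ : ∃ a ∈ l, a ∉ l₂ := by
    by_contra! h'
    exact hne (h₂.mem_iff_of_subset hl h')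
  have hαγ : α = γ := by
    have := hc a
    simpa [chi_of_mem ha, chi_of_not_mem ha2, chi_of_mem ((hsub a ha).resolve_right ha2)] using this
  refine h₁.mem_iff_of_subset hl fun f hf => ?_
  by_contra hf1
  have hf2 := (hsub f hf).resolve_left hf1
  have hβ : β = γ + δ := by
    have := hc f
    simpa [chi_of_mem hf, chi_of_mem hf2, chi_of_not_mem hf1] using this
  refine hne fun e => (hl.mem_iff_of_subset h₂ (fun g hg => ?_) e).symm
  by_contra hgl
  have h1 := hc g
  rw [chi_of_mem hg, chi_of_not_mem hgl, hαγ, hβ] at h1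
  have := mul_nonneg hγ.le (chi_nonneg l₁ g)
  linarith

theorem isExtremeDirection_smul (hP : G.polyhedron.Nonempty) {z : Fin G.nE → ℝ} {c : ℝ}
    (hc : 0 < c) (hz : G.IsFlow z) (hzw : G.weight z = 0) (hz0 : z ≠ 0)
    (h : ∀ y, G.IsFlow y → G.weight y = 0 → (∀ e, y e ≠ 0 → z e ≠ 0) →
      ∃ r : ℝ, 0 ≤ r ∧ y = r • z) : IsExtremeDirection G.polyhedron (c • z) := by
  refine ⟨smul_ne_zero hc.ne' hz0, (isDirection_iff hP).2 ⟨hz.smul hc.le, by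
    rw [weight_smul, hzw, mul_zero]⟩, fun d₁ d₂ h₁ h₂ μ₁ μ₂ hμ₁ hμ₂ he => ?_⟩
  obtain ⟨h₁f, h₁w⟩ := (isDirection_iff hP).1 h₁
  obtain ⟨h₂f, h₂w⟩ := (isDirection_iff hP).1 h₂
  have hsupp : ∀ e, z e = 0 → d₁ e = 0 ∧ d₂ e = 0 := by
    intro e h0
    have h3 := congrFun he e
    simp only [Pi.add_apply, Pi.smul_apply, smul_eq_mul, h0, mul_zero] at h3
    have h4 := mul_nonneg hμ₁.le (h₁f.2 e)
    have h5 := mul_nonneg hμ₂.le (h₂f.2 e)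
    exact ⟨(mul_eq_zero.1 (by linarith : μ₁ * d₁ e = 0)).resolve_left hμ₁.ne',
      (mul_eq_zero.1 (by linarith : μ₂ * d₂ e = 0)).resolve_left hμ₂.ne'⟩
  obtain ⟨r₁, hr₁, rfl⟩ := h d₁ h₁f h₁w fun e hne h0 => hne (hsupp e h0).1
  obtain ⟨r₂, hr₂, rfl⟩ := h d₂ h₂f h₂w fun e hne h0 => hne (hsupp e h0).2
  have key : ∀ r : ℝ, 0 ≤ r → SameRay ℝ (r • z) (c • z) := fun r hr =>
    (SameRay.sameRay_nonneg_smul_left z hr).pos_smul_right hc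
  exact ⟨key _ hr₁, key _ hr₂⟩

theorem isExtremeDirection_iff (hP : G.polyhedron.Nonempty) {d : Fin G.nE → ℝ} :
    IsExtremeDirection G.polyhedron d ↔ ∃ c : ℝ, 0 < c ∧
      ((∃ l, G.Cyc l ∧ G.weight (G.chi l) = 0 ∧ d = c • G.chi l) ∨
        ∃ l₁ l₂, G.Cyc l₁ ∧ G.Cyc l₂ ∧ G.weight (G.chi l₁) < 0 ∧ 0 < G.weight (G.chi l₂) ∧
          G.NoThird l₁ l₂ ∧ d = c • G.pairDir l₁ l₂) := by
  constructor
  · intro hd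
    obtain ⟨hdf, hdw⟩ := (isDirection_iff hP).1 hd.2.1
    by_cases hzero : ∃ l, G.Cyc l ∧ (∀ e ∈ l, d e ≠ 0) ∧ G.weight (G.chi l) = 0
    · obtain ⟨l, hl, hs, hw⟩ := hzero
      obtain ⟨c, hc, he⟩ := eq_smul_of_extreme hP hd (isFlow_chi hl) hw hl.chi_ne_zero
        fun e he => hs e ((chi_ne_zero_iff e).1 he)
      exact ⟨c, hc, .inl ⟨l, hl, hw, he⟩⟩
    push Not at hzero
    have hpair : ∃ l₁ l₂, (G.Cyc l₁ ∧ (∀ e ∈ l₁, d e ≠ 0) ∧ G.weight (G.chi l₁) < 0) ∧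
        (G.Cyc l₂ ∧ (∀ e ∈ l₂, d e ≠ 0) ∧ 0 < G.weight (G.chi l₂)) := by
      obtain ⟨l, hl, hlp⟩ := hdf.exists_cyc hd.1
      have hls : ∀ e ∈ l, d e ≠ 0 := fun e he => (hlp e he).ne'
      rcases lt_or_gt_of_ne (hzero l hl hls) with h | h
      · obtain ⟨l', h'⟩ := hdf.exists_pos_cyc hdw hl hls h
        exact ⟨l, l', ⟨hl, hls, h⟩, h'⟩
      · obtain ⟨l', h'⟩ := hdf.exists_neg_cyc hdw hl hls h
        exact ⟨l', l, h', hl, hls, h⟩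
    obtain ⟨l₁, l₂, ⟨h₁, hs₁, hw₁⟩, h₂, hs₂, hw₂⟩ := hpair
    have heq : ∀ l₁ l₂, G.Cyc l₁ → (∀ e ∈ l₁, d e ≠ 0) → G.weight (G.chi l₁) < 0 →
        G.Cyc l₂ → (∀ e ∈ l₂, d e ≠ 0) → 0 < G.weight (G.chi l₂) →
        ∃ c : ℝ, 0 < c ∧ d = c • G.pairDir l₁ l₂ := fun l₁ l₂ h₁ hs₁ hw₁ h₂ hs₂ hw₂ =>
      eq_smul_of_extreme hP hd (isFlow_pairDir h₁ h₂ hw₁ hw₂) (weight_pairDir _ _)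
        (h₁.pairDir_ne_zero hw₁ hw₂) fun e he =>
          ((pairDir_ne_zero_iff hw₁ hw₂ e).1 he).elim (hs₁ e) (hs₂ e)
    obtain ⟨c, hc, he⟩ := heq l₁ l₂ h₁ hs₁ hw₁ h₂ hs₂ hw₂
    refine ⟨c, hc, .inr ⟨l₁, l₂, h₁, h₂, hw₁, hw₂, fun l hl hsub => ?_, he⟩⟩
    have hls : ∀ e ∈ l, d e ≠ 0 := fun e he => (hsub e he).elim (hs₁ e) (hs₂ e)
    -- a third cycle would yield a second representation of `d`
    rcases lt_or_gt_of_ne (hzero l hl hls) with hw | hw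
    · left
      obtain ⟨c', hc', he'⟩ := heq l l₂ hl hls hw h₂ hs₂ hw₂
      refine mem_iff_of_comb_eq hl h₁ h₂ (α := c * G.weight (G.chi l₂))
        (β := c * -G.weight (G.chi l₁)) (γ := c' * G.weight (G.chi l₂))
        (δ := c' * -G.weight (G.chi l)) (mul_pos hc' hw₂) ?_ hsub fun h => ?_
      · have := he.symm.trans he'
        simp only [pairDir, smul_add, smul_smul] at this
        exact this
      · rw [chi_congr h] at hw; linarith
    · right
      obtain ⟨c', hc', he'⟩ := heq l₁ l h₁ hs₁ hw₁ hl hls hw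
      refine mem_iff_of_comb_eq hl h₂ h₁ (α := c * -G.weight (G.chi l₁))
        (β := c * G.weight (G.chi l₂)) (γ := c' * -G.weight (G.chi l₁))
        (δ := c' * G.weight (G.chi l)) (mul_pos hc' (by linarith)) ?_
        (fun e he => (hsub e he).symm) fun h => ?_
      · have := he.symm.trans he'
        simp only [pairDir, smul_add, smul_smul] at this
        rw [add_comm, this, add_comm]
      · rw [chi_congr h] at hw; linarith
  · rintro ⟨c, hc, ⟨l, hl, hw, rfl⟩ | ⟨l₁, l₂, h₁, h₂, hw₁, hw₂, hno, rfl⟩⟩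
    · refine isExtremeDirection_smul hP hc (isFlow_chi hl) hw hl.chi_ne_zero fun y hy _ hs => ?_
      exact hy.eq_smul_chi hl fun e he => by_contra fun h => he ((chi_ne_zero_iff e).1 (hs e h))
    · refine isExtremeDirection_smul hP hc (isFlow_pairDir h₁ h₂ hw₁ hw₂) (weight_pairDir _ _)
        (h₁.pairDir_ne_zero hw₁ hw₂) fun y hy hyw hs => ?_
      have key : ∃ a b : ℝ, 0 ≤ a ∧ 0 ≤ b ∧ y = a • G.chi l₁ + b • G.chi l₂ := by
        refine hy.induction (S := {e | e ∈ l₁ ∨ e ∈ l₂})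
          (motive := fun y => ∃ a b : ℝ, 0 ≤ a ∧ 0 ≤ b ∧ y = a • G.chi l₁ + b • G.chi l₂)
          ⟨0, 0, le_rfl, le_rfl, by simp⟩ ?_ fun e he =>
            (pairDir_ne_zero_iff hw₁ hw₂ e).1 (hs e he)
        rintro _ l r _ hl hsub hr ⟨a, b, ha, hb, rfl⟩
        rcases hno l hl hsub with h | h
        · exact ⟨a + r, b, by linarith, hb, by rw [chi_congr h]; module⟩
        · exact ⟨a, b + r, ha, by linarith, by rw [chi_congr h]; module⟩
      obtain ⟨a, b, ha, hb, rfl⟩ := key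
      rw [weight_add, weight_smul, weight_smul] at hyw
      refine ⟨a / G.weight (G.chi l₂), div_nonneg ha hw₂.le, ?_⟩
      have hb' : b = a / G.weight (G.chi l₂) * -G.weight (G.chi l₁) := by
        field_simp; linarith
      rw [pairDir, smul_add, smul_smul, smul_smul, ← hb', div_mul_cancel₀ _ hw₂.ne']

theorem mem_dirs_iff (hP : G.polyhedron.Nonempty) {d : Fin G.nE → ℝ} : d ∈ G.dirs ↔
    (∃ l, G.Cyc l ∧ G.weight (G.chi l) = 0 ∧ d = (l.length : ℝ)⁻¹ • G.chi l) ∨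
      ∃ l₁ l₂, G.Cyc l₁ ∧ G.Cyc l₂ ∧ G.weight (G.chi l₁) < 0 ∧ 0 < G.weight (G.chi l₂) ∧
        G.NoThird l₁ l₂ ∧ d = (G.weight (G.chi l₂) * l₁.length +
          -G.weight (G.chi l₁) * l₂.length)⁻¹ • G.pairDir l₁ l₂ := by
  have hsum : ∀ l₁ l₂, G.Cyc l₁ → G.Cyc l₂ → ∑ e, G.pairDir l₁ l₂ e =
      G.weight (G.chi l₂) * l₁.length + -G.weight (G.chi l₁) * l₂.length := by
    intro l₁ l₂ h₁ h₂
    simp only [pairDir, Pi.add_apply, Pi.smul_apply, smul_eq_mul, Finset.sum_add_distrib,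
      ← Finset.mul_sum, sum_chi h₁.nodup, sum_chi h₂.nodup]
  have hlen : ∀ l, G.Cyc l → (0 : ℝ) < l.length := fun l hl =>
    Nat.cast_pos.2 (List.length_pos_of_ne_nil hl.1)
  have hsmul : ∀ (c : ℝ) (z : Fin G.nE → ℝ), ∑ e, (c • z) e = c * ∑ e, z e := fun c z => by
    simp [Finset.mul_sum]
  rw [dirs, extremeDirections, Set.mem_ofPred_eq, isExtremeDirection_iff hP]
  constructor
  · rintro ⟨⟨c, hc, ⟨l, hl, hw, rfl⟩ | ⟨l₁, l₂, h₁, h₂, hw₁, hw₂, hno, rfl⟩⟩, hs⟩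
    · rw [hsmul, sum_chi hl.nodup] at hs
      exact .inl ⟨l, hl, hw, by rw [eq_inv_of_mul_eq_one_left hs]⟩
    · rw [hsmul, hsum _ _ h₁ h₂] at hs
      exact .inr ⟨l₁, l₂, h₁, h₂, hw₁, hw₂, hno, by rw [eq_inv_of_mul_eq_one_left hs]⟩
  · rintro (⟨l, hl, hw, rfl⟩ | ⟨l₁, l₂, h₁, h₂, hw₁, hw₂, hno, rfl⟩)
    · refine ⟨⟨_, inv_pos.2 (hlen l hl), .inl ⟨l, hl, hw, rfl⟩⟩, ?_⟩
      rw [hsmul, sum_chi hl.nodup, inv_mul_cancel₀ (hlen l hl).ne']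
    · have hpos : 0 < G.weight (G.chi l₂) * l₁.length + -G.weight (G.chi l₁) * l₂.length :=
        add_pos (mul_pos hw₂ (hlen _ h₁)) (mul_pos (by linarith) (hlen _ h₂))
      refine ⟨⟨_, inv_pos.2 hpos, .inr ⟨l₁, l₂, h₁, h₂, hw₁, hw₂, hno, rfl⟩⟩, ?_⟩
      rw [hsmul, hsum _ _ h₁ h₂, inv_mul_cancel₀ hpos.ne']

end WDigraph
end NegFlow

namespace NegFlow

/-! ### The enumeration algorithm -/

namespace Gen

/-- An arc as it is given in the input: its end points and its weight. -/
abbrev A : Type := (ℕ × ℕ) × (Bool × ℕ × ℕ)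

/-- A vector as it is written to the output. -/
abbrev Out : Type := List (Bool × ℕ × ℕ)

/-- Twice the absolute value of the weight of an arc, for weights in `½ℤ`. -/
def twiceAbs (a : A) : ℕ := if a.2.2.2 = 1 then 2 * a.2.2.1 else a.2.2.1

/-- Twice the sum of the positive weights of a list of arcs. -/
def posWt (l : List A) : ℕ := (l.map fun a => if a.2.1 = true then 0 else twiceAbs a).sum

/-- Twice the absolute value of the sum of the negative weights of a list of arcs. -/
def negWt (l : List A) : ℕ := (l.map fun a => if a.2.1 = true then twiceAbs a else 0).sum

/-- One step of the test `linked`: the pair consists of the result so far and of the last arc. -/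
def linkStep (s : Bool × A) (x : A) : Bool × A := (s.1 && decide (s.2.1.1 = x.1.2), x)

/-- Test whether each arc starts where the next arc in the list ends, cyclically. -/
def linked (d : A) (l : List A) : Bool :=
  ((l.tail ++ [l.headD d]).foldl linkStep (true, l.headD d)).1

/-- An arbitrary arc, used as a default value. -/
def dummy : A := ((0, 0), (false, 0, 0))

/-- Test whether a list of arcs is a simple directed cycle in reverse order. -/
def isCycle (l : List A) : Bool :=
  !l.isEmpty && (linked dummy l &&
    l.all fun e => decide ((l.filter fun f => decide (f.1.1 = e.1.1)).length = 1))

/-- One round of a breadth-first search from the vertex `u`. -/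
def reachStep (B : List A) (u : ℕ) (W : List A) : List A :=
  B.filter fun f => decide (f.1.1 = u) || W.any fun g => decide (g.1.2 = f.1.1)

/-- The arcs of `B` that lie on walks in `B` from `u`. -/
def reach (B : List A) (u : ℕ) : List A := B.foldl (fun W _ => reachStep B u W) []

/-- Test whether a nonempty walk in `B` leads from `u` to `s`. -/
def reaches (B : List A) (u s : ℕ) : Bool := (reach B u).any fun f => decide (f.1.2 = s)

/-- The first vertex of a path, given by its arcs in reverse order. -/
def root (τ : List A) : ℕ := (τ.reverse.headD dummy).1.1

/-- The last vertex of a path, given by its arcs in reverse order. -/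
def cur (τ : List A) : ℕ := (τ.headD dummy).1.2

/-- The arcs that may be used to continue the path `τ` to a cycle. -/
def allowed (arcs τ : List A) : List A :=
  arcs.filter fun f => decide (f.1.2 = root τ) ||
    (!decide (f.1.2 ∈ τ.map fun e => e.1.1) && !decide (f.1.2 = cur τ))

/-- Test whether the path `τ` is simple and can be extended to a simple cycle. -/
def extendable (arcs τ : List A) : Bool :=
  !decide (cur τ ∈ τ.map fun e => e.1.1) && reaches (allowed arcs τ) (cur τ) (root τ)

/-- The paths that are kept: simple cycles and paths that extend to such. -/
def good (arcs τ : List A) : Bool := isCycle τ || extendable arcs τ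

/-- The good paths with one more arc. -/
def children (arcs τ : List A) : List (List A) :=
  (arcs.filter fun f => decide (f.1.1 = cur τ) && good arcs (f :: τ)).map fun f => f :: τ

/-- All suffixes of a list. -/
def suffixes (l : List A) : List (List A) :=
  l.foldl (fun acc _ => (acc.headD []).tail :: acc) [l]

/-- All contiguous segments of a list. -/
def segments (l : List A) : List (List A) :=
  (suffixes l).flatMap fun m => (suffixes m.reverse).map fun r => r.reverse

/-- The lists that arise from cyclic segments of `C` by adding an arc. -/
def chords (arcs C : List A) : List (List A) :=
  (segments (C ++ C)).flatMap fun P => arcs.map fun f => f :: P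

/-- The lists of two arcs. -/
def pairsOf (arcs : List A) : List (List A) := arcs.flatMap fun e => arcs.map fun f => [e, f]

/-- The cycles that are derived from a list `K` of known cycles: these, all cycles of length two
and the cycles that consist of a segment of a known cycle and of one more arc. -/
def closure (arcs : List A) (K : List (List A)) : List (List A) :=
  (pairsOf arcs ++ (K ++ K.flatMap fun C => chords arcs C)).filter fun C => isCycle C

/-- Test whether the union of two cycles contains no further cycle: the existence of a further
cycle means that some cycle misses an arc of each of the two. -/
def noThird (C₁ C₂ : List A) : Bool :=
  C₁.all fun e => C₂.all fun f =>
    let B := (C₁ ++ C₂).filter fun g => !decide (g = e) && !decide (g = f)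
    !B.any fun g => reaches B g.1.1 g.1.1

/-- The vector with denominator `d` whose numerators are `a` on the arcs of `C₁` plus `b` on those
of `C₂`. -/
def vec (arcs : List A) (a : ℕ) (C₁ : List A) (b : ℕ) (C₂ : List A) (d : ℕ) : Out :=
  arcs.map fun e => (false, (if e ∈ C₁ then a else 0) + (if e ∈ C₂ then b else 0), d)

/-- The extreme direction of a cycle of weight zero. -/
def zeroVec (arcs C : List A) : Out := vec arcs 1 C 0 [] C.length

/-- The extreme direction of a cycle of negative and one of positive weight. -/
def pairVec (arcs C₁ C₂ : List A) : Out :=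
  vec arcs (posWt C₂ - negWt C₂) C₁ (negWt C₁ - posWt C₁) C₂
    ((posWt C₂ - negWt C₂) * C₁.length + (negWt C₁ - posWt C₁) * C₂.length)

/-- The extreme point of a cycle of negative weight. -/
def vertVec (arcs C : List A) : Out := vec arcs 2 C 0 [] (negWt C - posWt C)

/-- The extreme directions that come from a list of cycles. -/
def dirVecs (arcs : List A) (L : List (List A)) : List Out :=
  (L.filter fun C => decide (posWt C = negWt C)).map (fun C => zeroVec arcs C) ++
    (L.filter fun C => decide (posWt C < negWt C)).flatMap fun C₁ =>
      (L.filter fun C₂ => decide (negWt C₂ < posWt C₂) && noThird C₁ C₂).map fun C₂ =>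
        pairVec arcs C₁ C₂

/-- The extreme points that come from a list of cycles. -/
def vertVecs (arcs : List A) (L : List (List A)) : List Out :=
  (L.filter fun C => decide (posWt C < negWt C)).map fun C => vertVec arcs C

/-- The vectors that come from a list of cycles: extreme directions, and extreme points if `b` is
true. -/
def candidates (b : Bool) (arcs : List A) (L : List (List A)) : List Out :=
  if b = true then vertVecs arcs L ++ dirVecs arcs L else dirVecs arcs L

/-- The elements of a list that are not in `M`, each of them once. -/
def fresh (M L : List Out) : List Out :=
  L.foldl (fun acc x => if x ∈ M ++ acc then acc else x :: acc) []

/-- The state of the enumeration: the arcs of the graph, a stack of paths that are still to be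
extended, the cycles found so far, and the vectors written so far. -/
abbrev State : Type := List A × List (List A) × List (List A) × List Out

/-- The initial state. -/
def init (x : ℕ × List A) : State :=
  (x.2, (x.2.map fun e => [e]).filter fun τ => good x.2 τ, [], [])

/-- The enumeration goes on as long as the stack is not empty. -/
def run (s : State) : Bool := !s.2.1.isEmpty

/-- The list of known cycles after the path on top of the stack has been dealt with. -/
def newK (s : State) : List (List A) :=
  if isCycle (s.2.1.headD []) = true then s.2.1.headD [] :: s.2.2.1 else s.2.2.1

/-- The stack after the path on its top has been replaced by its extensions. -/
def newStack (s : State) : List (List A) :=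
  if isCycle (s.2.1.headD []) = true then s.2.1.tail
  else children s.1 (s.2.1.headD []) ++ s.2.1.tail

/-- The vectors that are written when the path on top of the stack is dealt with. -/
def outs (b : Bool) (s : State) : List Out :=
  fresh s.2.2.2 (candidates b s.1 (closure s.1 (newK s)))

/-- The next state. -/
def next (b : Bool) (s : State) : State :=
  (s.1, newStack s, newK s, outs b s ++ s.2.2.2)

/-! ### The enumeration steps take polynomial time -/

@[fun_prop]
theorem polyTime_twiceAbs : PolyTime twiceAbs := by unfold twiceAbs; fun_prop

@[fun_prop]
theorem polyTime_posWt : PolyTime posWt := by unfold posWt; fun_prop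

@[fun_prop]
theorem polyTime_negWt : PolyTime negWt := by unfold negWt; fun_prop

@[fun_prop]
theorem polyTime_linked : PolyTime fun x : A × List A => linked x.1 x.2 := by
  unfold linked linkStep
  refine PolyTime.fst.comp ?_
  refine PolyTime.foldl_additive (S := fun (_ : A × List A) (s : Bool × A) (x : A) =>
      (s.1 && decide (s.2.1.1 = x.1.2), x))
    (by fun_prop) (by fun_prop) (by fun_prop) (Polynomial.X + 3) fun a s x => ?_
  have := codeSize_bool (s.1 && decide (s.2.1.1 = x.1.2))
  have := one_le_codeSize s
  simp only [codeSize_pair (x := (_, x)), Polynomial.eval_add, Polynomial.eval_X,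
    Polynomial.eval_ofNat]
  have := one_le_codeSize a
  omega

@[fun_prop]
theorem polyTime_isCycle : PolyTime isCycle := by unfold isCycle; fun_prop

@[fun_prop]
theorem polyTime_reachStep :
    PolyTime fun x : List A × ℕ × List A => reachStep x.1 x.2.1 x.2.2 := by
  unfold reachStep; fun_prop

theorem codeSize_filter_le {α : Type} [TreeCode α] (p : α → Bool) (l : List α) :
    codeSize (l.filter p) ≤ codeSize l := by
  induction l with
  | nil => simp
  | cons a l ih =>
    by_cases h : p a
    · simp only [List.filter_cons_of_pos h, codeSize_cons]; omega
    · simp only [List.filter_cons_of_neg h, codeSize_cons]; omega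

@[fun_prop]
theorem polyTime_reach : PolyTime fun x : List A × ℕ => reach x.1 x.2 := by
  unfold reach
  refine PolyTime.foldl (S := fun (x : List A × ℕ) W (_ : A) => reachStep x.1 x.2 W)
    (i := fun _ => [])
    (by fun_prop) (by fun_prop) ?_ Polynomial.X fun a l' hl' => ?_
  · exact polyTime_reachStep.comp (f := fun z : (List A × ℕ) × List A × A => (z.1.1, z.1.2, z.2.1))
      (by fun_prop)
  · have : ∀ W : List A, codeSize W ≤ codeSize a →
        codeSize (l'.foldl (fun W _ => reachStep a.1 a.2 W) W) ≤ codeSize a := by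
      clear hl'
      induction l' with
      | nil => exact fun W h => h
      | cons x l' ih =>
        intro W _
        refine ih _ ((codeSize_filter_le _ _).trans ?_)
        simp only [codeSize_pair (x := a)]; omega
    simpa using this [] (one_le_codeSize a)

@[fun_prop]
theorem polyTime_reaches :
    PolyTime fun x : List A × ℕ × ℕ => reaches x.1 x.2.1 x.2.2 := by
  unfold reaches; fun_prop

@[fun_prop]
theorem polyTime_root : PolyTime root := by unfold root; fun_prop

@[fun_prop]
theorem polyTime_cur : PolyTime cur := by unfold cur; fun_prop

@[fun_prop]
theorem polyTime_allowed : PolyTime fun x : List A × List A => allowed x.1 x.2 := by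
  unfold allowed; fun_prop

@[fun_prop]
theorem polyTime_extendable : PolyTime fun x : List A × List A => extendable x.1 x.2 := by
  unfold extendable; fun_prop

@[fun_prop]
theorem polyTime_good : PolyTime fun x : List A × List A => good x.1 x.2 := by
  unfold good; fun_prop

@[fun_prop]
theorem polyTime_children : PolyTime fun x : List A × List A => children x.1 x.2 := by
  unfold children; fun_prop

theorem mem_suffixes_aux {l : List A} (l' : List A) {x : List A} :
    x ∈ l'.foldl (fun acc _ => (acc.headD []).tail :: acc) [l] ↔ ∃ i ≤ l'.length, x = l.drop i := by
  have : l'.foldl (fun acc _ => (acc.headD []).tail :: acc) [l] =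
      ((List.range (l'.length + 1)).map fun i => l.drop i).reverse := by
    induction l' using List.reverseRecOn with
    | nil => simp
    | append_singleton l' a ih =>
      rw [List.foldl_append, ih, List.length_append, List.length_singleton,
        List.range_succ (n := l'.length + 1), List.map_append, List.reverse_append,
        List.range_succ]
      simp
  simp only [this, List.mem_reverse, List.mem_map, List.mem_range, Nat.lt_succ_iff, eq_comm]

theorem mem_suffixes {l x : List A} : x ∈ suffixes l ↔ x <:+ l := by
  rw [suffixes, mem_suffixes_aux]
  constructor
  · rintro ⟨i, -, rfl⟩; exact List.drop_suffix i l
  · rintro ⟨t, rfl⟩; exact ⟨t.length, by simp, by simp⟩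

theorem mem_segments {l x : List A} : x ∈ segments l ↔ x <:+: l := by
  simp only [segments, List.mem_flatMap, List.mem_map, mem_suffixes]
  constructor
  · rintro ⟨m, hm, r, hr, rfl⟩
    exact (show r.reverse <+: m by simpa using List.reverse_prefix.2 hr).isInfix.trans hm.isInfix
  · rintro ⟨s, t, rfl⟩
    exact ⟨x ++ t, ⟨s, by simp⟩, x.reverse, ⟨t.reverse, by simp⟩, by simp⟩

theorem codeSize_drop_le {α : Type} [TreeCode α] (l : List α) (i : ℕ) :
    codeSize (l.drop i) ≤ codeSize l := by
  have h := codeSize_append (l.take i) (l.drop i)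
  have := one_le_codeSize (l.take i)
  rw [List.take_append_drop] at h; omega

open Polynomial in
@[fun_prop]
theorem polyTime_suffixes : PolyTime suffixes := by
  unfold suffixes
  refine PolyTime.foldl (S := fun _ acc _ => (acc.headD []).tail :: acc) (i := fun l => [l])
    (by fun_prop) (by fun_prop) (by fun_prop) ((X + 1) * (X + 1) + 1) fun a l' hl' => ?_
  refine (codeSize_list_le (B := codeSize a) fun x hx => ?_).trans ?_
  · obtain ⟨i, -, rfl⟩ := (mem_suffixes_aux l').1 hx
    exact codeSize_drop_le _ _
  · have : (l'.foldl (fun acc _ => (acc.headD []).tail :: acc) [a]).length = l'.length + 1 := by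
      induction l' using List.reverseRecOn with
      | nil => simp
      | append_singleton l' a ih =>
        rw [List.foldl_append, List.foldl_cons, List.foldl_nil, List.length_cons,
          ih ((List.prefix_append _ _).trans hl')]
        simp
    rw [this]
    have h1 := hl'.length_le
    have h2 := length_lt_codeSize a
    simp only [eval_add, eval_mul, eval_X, eval_one]
    exact Nat.add_le_add_right (Nat.mul_le_mul_right _ (by omega)) _

@[fun_prop]
theorem polyTime_segments : PolyTime segments := by unfold segments; fun_prop

@[fun_prop]
theorem polyTime_chords : PolyTime fun x : List A × List A => chords x.1 x.2 := by
  unfold chords; fun_prop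

@[fun_prop]
theorem polyTime_pairsOf : PolyTime pairsOf := by unfold pairsOf; fun_prop

@[fun_prop]
theorem polyTime_closure : PolyTime fun x : List A × List (List A) => closure x.1 x.2 := by
  unfold closure; fun_prop

@[fun_prop]
theorem polyTime_noThird : PolyTime fun x : List A × List A => noThird x.1 x.2 := by
  unfold noThird; fun_prop

@[fun_prop]
theorem polyTime_vec : PolyTime fun x : List A × ℕ × List A × ℕ × List A × ℕ =>
    vec x.1 x.2.1 x.2.2.1 x.2.2.2.1 x.2.2.2.2.1 x.2.2.2.2.2 := by
  unfold vec
  refine PolyTime.map (g := fun (x : List A × ℕ × List A × ℕ × List A × ℕ) (e : A) => (false,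
    (if e ∈ x.2.2.1 then x.2.1 else 0) + (if e ∈ x.2.2.2.2.1 then x.2.2.2.1 else 0),
    x.2.2.2.2.2)) (by fun_prop) ?_
  refine .pair (by fun_prop) (.pair ?_ (by fun_prop))
  refine .add (.ite ?_ ?_ ?_) (.ite ?_ ?_ ?_) <;> fun_prop

@[fun_prop]
theorem polyTime_zeroVec : PolyTime fun x : List A × List A => zeroVec x.1 x.2 := by
  unfold zeroVec; fun_prop

@[fun_prop]
theorem polyTime_pairVec :
    PolyTime fun x : List A × List A × List A => pairVec x.1 x.2.1 x.2.2 := by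
  unfold pairVec; fun_prop

@[fun_prop]
theorem polyTime_vertVec : PolyTime fun x : List A × List A => vertVec x.1 x.2 := by
  unfold vertVec; fun_prop

@[fun_prop]
theorem polyTime_dirVecs : PolyTime fun x : List A × List (List A) => dirVecs x.1 x.2 := by
  unfold dirVecs; fun_prop

@[fun_prop]
theorem polyTime_vertVecs : PolyTime fun x : List A × List (List A) => vertVecs x.1 x.2 := by
  unfold vertVecs; fun_prop

@[fun_prop]
theorem polyTime_candidates (b : Bool) :
    PolyTime fun x : List A × List (List A) => candidates b x.1 x.2 := by
  unfold candidates; cases b <;> simp <;> fun_prop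

open Polynomial in
@[fun_prop]
theorem polyTime_fresh : PolyTime fun x : List Out × List Out => fresh x.1 x.2 := by
  unfold fresh
  refine PolyTime.foldl_additive (S := fun (a : List Out × List Out) acc x =>
      if x ∈ a.1 ++ acc then acc else x :: acc) (i := fun _ => [])
    (by fun_prop) (by fun_prop) (by fun_prop) (X + 1) fun a s x => ?_
  simp only [eval_add, eval_X, eval_one]
  split_ifs
  · omega
  · rw [codeSize_cons]; omega

@[fun_prop]
theorem polyTime_init : PolyTime init := by unfold init; fun_prop

@[fun_prop]
theorem polyTime_run : PolyTime run := by unfold run; fun_prop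

@[fun_prop]
theorem polyTime_newK : PolyTime newK := by unfold newK; fun_prop

@[fun_prop]
theorem polyTime_newStack : PolyTime newStack := by unfold newStack; fun_prop

@[fun_prop]
theorem polyTime_outs (b : Bool) : PolyTime (outs b) := by unfold outs; fun_prop

@[fun_prop]
theorem polyTime_next (b : Bool) : PolyTime (next b) := by unfold next; fun_prop

end Gen
end NegFlow

namespace NegFlow

open TreeCode (code)

namespace Gen

/-! ### Correctness of the tests -/

/-- Tail of an arc. -/
def src (a : A) : ℕ := a.1.1

/-- Head of an arc. -/
def tgt (a : A) : ℕ := a.1.2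

theorem linkStep_foldl (l : List A) : ∀ (b : Bool) (a : A), ((l.foldl linkStep (b, a)).1 = true ↔
    b = true ∧ List.IsChain (fun e f => src e = tgt f) (a :: l)) := by
  induction l with
  | nil => simp
  | cons x l ih =>
    intro b a
    rw [List.foldl_cons, linkStep, ih]
    simp [List.isChain_cons_cons, src, tgt, and_assoc]

theorem isCycle_iff {l : List A} : isCycle l = true ↔ IsCyc src tgt l := by
  have hnd : (l.all fun e => decide ((l.filter fun f => decide (f.1.1 = e.1.1)).length = 1)) = true
      ↔ (l.map src).Nodup := by
    have h : ∀ e, (l.map src).count (src e) =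
        (l.filter fun f => decide (f.1.1 = e.1.1)).length := by
      intro e
      rw [List.count, List.countP_map, List.countP_eq_length_filter]
      rfl
    simp only [List.nodup_iff_count_eq_one, List.forall_mem_map, h, List.all_eq_true,
      decide_eq_true_eq]
  unfold isCycle
  rw [Bool.and_eq_true, Bool.and_eq_true, hnd]
  cases l with
  | nil => simp [IsCyc]
  | cons a t =>
    rw [isCyc_cons, linked, List.headD_cons, List.tail_cons, linkStep_foldl]
    simp

theorem reach_subset_step (B : List A) (u : ℕ) {W W' : List A} (h : ∀ x ∈ W, x ∈ W') :
    (reachStep B u W).Sublist (reachStep B u W') := by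
  refine List.monotone_filter_right B fun f hf => ?_
  simp only [Bool.or_eq_true, decide_eq_true_eq, List.any_eq_true] at hf ⊢
  exact hf.imp id fun ⟨g, hg, h'⟩ => ⟨g, h g hg, h'⟩

theorem reach_eq_iterate (B : List A) (u : ℕ) : reach B u = (reachStep B u)^[B.length] [] := by
  have : ∀ (l W : List A), l.foldl (fun W _ => reachStep B u W) W =
      (reachStep B u)^[l.length] W := by
    intro l
    induction l with
    | nil => simp
    | cons a l ih => simp [ih]
  exact this B []

theorem reachStep_reach (B : List A) (u : ℕ) : reachStep B u (reach B u) = reach B u := by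
  have hsub : ∀ n, ((reachStep B u)^[n] []).Sublist ((reachStep B u)^[n + 1] []) := by
    intro n
    induction n with
    | zero => simp
    | succ n ih =>
      rw [Function.iterate_succ_apply', Function.iterate_succ_apply' _ (n + 1)]
      exact reach_subset_step B u ih.subset
  have heq : ∀ n, ((reachStep B u)^[n] []).length = ((reachStep B u)^[n + 1] []).length →
      (reachStep B u)^[n] [] = (reachStep B u)^[n + 1] [] := fun n h => (hsub n).eq_of_length h
  have := Nat.stabilises_of_monotone (f := fun n => ((reachStep B u)^[n] []).length)
    (b := B.length) (n := B.length + 1) (monotone_nat_of_le_succ fun n => (hsub n).length_le)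
    (fun m => by
      cases m with
      | zero => simp
      | succ m => rw [Function.iterate_succ_apply']; exact List.length_filter_le _ _)
    (fun m h => by
      have h' := heq m h
      change ((reachStep B u)^[m + 1] []).length = ((reachStep B u)^[m + 2] []).length
      rw [Function.iterate_succ_apply' (reachStep B u) (m + 1), ← h',
        ← Function.iterate_succ_apply' (reachStep B u), ← h'])
    (by omega)
  rw [reach_eq_iterate, ← Function.iterate_succ_apply' (reachStep B u)]
  exact (heq _ this.symm).symm

theorem reaches_iff {B : List A} {u s : ℕ} : reaches B u s = true ↔
    Relation.TransGen (fun v w => ∃ e ∈ {e | e ∈ B}, src e = v ∧ tgt e = w) u s := by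
  have hmem : ∀ f, f ∈ reach B u ↔ f ∈ B ∧ (src f = u ∨ ∃ g ∈ reach B u, tgt g = src f) := by
    intro f
    conv_lhs => rw [← reachStep_reach, reachStep]
    simp [src, tgt]
  have hsound : ∀ n, ∀ f ∈ (reachStep B u)^[n] [],
      Relation.TransGen (fun v w => ∃ e ∈ {e | e ∈ B}, src e = v ∧ tgt e = w) u (tgt f) := by
    intro n
    induction n with
    | zero => simp
    | succ n ih =>
      intro f hf
      rw [Function.iterate_succ_apply', reachStep] at hf
      simp only [List.mem_filter, Bool.or_eq_true, decide_eq_true_eq, List.any_eq_true] at hf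
      rcases hf.2 with h | ⟨g, hg, h⟩
      · exact .single ⟨f, hf.1, h, rfl⟩
      · exact (ih g hg).tail ⟨f, hf.1, h.symm, rfl⟩
  simp only [reaches, List.any_eq_true, decide_eq_true_eq]
  constructor
  · rintro ⟨f, hf, rfl⟩
    rw [reach_eq_iterate] at hf
    exact hsound _ f hf
  · intro h
    induction h with
    | single h =>
      obtain ⟨e, he, h1, h2⟩ := h
      exact ⟨e, (hmem e).2 ⟨he, .inl h1⟩, h2⟩
    | tail _ h ih =>
      obtain ⟨e, he, h1, h2⟩ := h
      obtain ⟨f, hf, hfe⟩ := ih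
      exact ⟨e, (hmem e).2 ⟨he, .inr ⟨f, hf, hfe.trans h1.symm⟩⟩, h2⟩

theorem noThird_iff {C₁ C₂ : List A} (h₁ : IsCyc src tgt C₁) (h₂ : IsCyc src tgt C₂) :
    noThird C₁ C₂ = true ↔ ∀ l, IsCyc src tgt l → (∀ e ∈ l, e ∈ C₁ ∨ e ∈ C₂) →
      (∀ e, e ∈ l ↔ e ∈ C₁) ∨ ∀ e, e ∈ l ↔ e ∈ C₂ := by
  have hB : ∀ e f g, g ∈ ((C₁ ++ C₂).filter fun g => !decide (g = e) && !decide (g = f)) ↔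
      (g ∈ C₁ ∨ g ∈ C₂) ∧ g ≠ e ∧ g ≠ f := by
    intro e f g
    simp only [List.mem_filter, List.mem_append, Bool.and_eq_true, Bool.not_eq_true',
      decide_eq_false_iff_not, ne_eq]
  simp only [noThird, List.all_eq_true, Bool.not_eq_true', List.any_eq_false,
    Bool.not_eq_true]
  constructor
  · intro h l hl hsub
    by_contra! hcon
    obtain ⟨e, he, hel⟩ : ∃ e ∈ C₁, e ∉ l := by
      by_contra! h'
      obtain ⟨e, he⟩ := hcon.1
      have := hl.mem_iff_of_subset h₁ h' e
      tauto
    obtain ⟨f, hf, hfl⟩ : ∃ f ∈ C₂, f ∉ l := by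
      by_contra! h'
      obtain ⟨e, he⟩ := hcon.2
      have := hl.mem_iff_of_subset h₂ h' e
      tauto
    obtain ⟨g, hg⟩ := List.exists_mem_of_ne_nil _ hl.1
    have hlB : ∀ g ∈ l, g ∈ ((C₁ ++ C₂).filter fun g => !decide (g = e) && !decide (g = f)) :=
      fun g hg => (hB e f g).2 ⟨hsub g hg, fun h => hel (h ▸ hg), fun h => hfl (h ▸ hg)⟩
    have := h e he f hf g (hlB g hg)
    rw [← Bool.not_eq_true, reaches_iff] at this
    refine this (Relation.TransGen.mono (r := fun u v => ∃ x ∈ l, src x = u ∧ tgt x = v) ?_ _ _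
      (hl.transGen hg))
    exact fun _ _ ⟨x, hx, h⟩ => ⟨x, hlB x hx, h⟩
  · intro h e he f hf g hg
    rw [← Bool.not_eq_true, reaches_iff]
    intro hr
    obtain ⟨l, hl, hlB⟩ := exists_isCyc_of_transGen (List.finite_toSet _) hr
    have hlB' := fun x hx => (hB e f x).1 (hlB x hx)
    rcases h l hl fun x hx => (hlB' x hx).1 with h | h
    · exact (hlB' e ((h e).2 he)).2.1 rfl
    · exact (hlB' f ((h f).2 hf)).2.2 rfl

end Gen

/-! ### Cycles of the graph and vectors as data -/

namespace WDigraph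

/-- The data of an arc. -/
def arc (G : WDigraph) (e : Fin G.nE) : Gen.A :=
  ((G.src e, G.tgt e), (decide (G.wt e < 0), (G.wt e).num.natAbs, (G.wt e).den))

/-- The list of the data of all arcs. -/
def arcs (G : WDigraph) : List Gen.A := List.ofFn G.arc

theorem encode_eq (G : WDigraph) : G.encode = code (G.nV, G.arcs) := by
  change Data.cons _ _ = Data.cons _ (Data.ofList _)
  rw [arcs, List.map_ofFn]
  rfl

/-- The properties of graphs that the enumeration relies on: all weights are in `½ℤ`, and there
are no two arcs with the same data. -/
structure Tidy (G : WDigraph) : Prop where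
  inj : Function.Injective G.arc
  half : ∀ e, (G.wt e).den = 1 ∨ (G.wt e).den = 2

variable {G : WDigraph}

theorem mem_arcs {a : Gen.A} : a ∈ G.arcs ↔ ∃ e, G.arc e = a := by simp [arcs, List.mem_ofFn]

theorem exists_map_arc {l : List Gen.A} (h : ∀ a ∈ l, a ∈ G.arcs) :
    ∃ L : List (Fin G.nE), l = L.map G.arc := by
  induction l with
  | nil => exact ⟨[], rfl⟩
  | cons a l ih =>
    obtain ⟨L, rfl⟩ := ih fun b hb => h b (by simp [hb])
    obtain ⟨e, rfl⟩ := mem_arcs.1 (h a (by simp))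
    exact ⟨e :: L, rfl⟩

namespace Tidy

variable (hG : G.Tidy)
include hG

omit hG in
theorem isCyc_iff {L : List (Fin G.nE)} :
    IsCyc Gen.src Gen.tgt (L.map G.arc) ↔ G.Cyc L :=
  isCyc_map (f := G.arc) (g := Fin.val) Fin.val_injective (fun _ => rfl) fun _ => rfl

theorem mem_map_iff {L : List (Fin G.nE)} {e : Fin G.nE} : G.arc e ∈ L.map G.arc ↔ e ∈ L :=
  List.mem_map_of_injective hG.inj

theorem weight_eq {L : List (Fin G.nE)} (hL : L.Nodup) : 2 * G.weight (G.chi L) =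
    Gen.posWt (L.map G.arc) - Gen.negWt (L.map G.arc) := by
  have hw : ∀ e, 2 * (G.wt e : ℝ) = (if (G.arc e).2.1 = true then 0 else Gen.twiceAbs (G.arc e)) -
      (if (G.arc e).2.1 = true then Gen.twiceAbs (G.arc e) else 0) := by
    intro e
    have h1 : (G.wt e : ℝ) = (G.wt e).num / (G.wt e).den := Rat.cast_def _
    have h2 : (((G.wt e).num.natAbs : ℕ) : ℝ) = |((G.wt e).num : ℝ)| := by
      rw [Nat.cast_natAbs, Int.cast_abs]
    have h3 : (Gen.twiceAbs (G.arc e) : ℝ) = 2 * |(G.wt e : ℝ)| := by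
      change (((if (G.wt e).den = 1 then 2 * (G.wt e).num.natAbs else (G.wt e).num.natAbs : ℕ)) : ℝ)
        = _
      rcases hG.half e with h | h <;> rw [h1, h]
      · rw [if_pos rfl]
        push_cast
        rw [h2, div_one]
      · rw [if_neg (by norm_num), h2, abs_div]
        norm_num
        ring
    by_cases hneg : G.wt e < 0
    · have : (G.wt e : ℝ) < 0 := by exact_mod_cast hneg
      rw [if_pos (by simpa [arc] using hneg), if_pos (by simpa [arc] using hneg), h3,
        abs_of_neg this]
      push_cast; ring
    · have : (0 : ℝ) ≤ G.wt e := by exact_mod_cast not_lt.1 hneg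
      rw [if_neg (by simpa [arc] using hneg), if_neg (by simpa [arc] using hneg),
        h3, abs_of_nonneg this]
      push_cast; ring
  rw [weight_chi hL, Gen.posWt, Gen.negWt]
  clear hL
  induction L with
  | nil => simp
  | cons e L ih =>
    simp only [List.map_cons, List.sum_cons, mul_add, ih, hw e]
    push_cast
    ring

theorem posWt_eq_iff {L : List (Fin G.nE)} (hL : L.Nodup) :
    Gen.posWt (L.map G.arc) = Gen.negWt (L.map G.arc) ↔ G.weight (G.chi L) = 0 := by
  rw [← Nat.cast_inj (R := ℝ), ← sub_eq_zero, ← hG.weight_eq hL]; simp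

theorem posWt_lt_iff {L : List (Fin G.nE)} (hL : L.Nodup) :
    Gen.posWt (L.map G.arc) < Gen.negWt (L.map G.arc) ↔ G.weight (G.chi L) < 0 := by
  rw [← Nat.cast_lt (α := ℝ), ← sub_neg, ← hG.weight_eq hL]
  constructor <;> intro h <;> linarith

theorem negWt_lt_iff {L : List (Fin G.nE)} (hL : L.Nodup) :
    Gen.negWt (L.map G.arc) < Gen.posWt (L.map G.arc) ↔ 0 < G.weight (G.chi L) := by
  rw [← Nat.cast_lt (α := ℝ), ← sub_pos, ← hG.weight_eq hL]
  constructor <;> intro h <;> linarith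

theorem noThird_iff {L₁ L₂ : List (Fin G.nE)} (h₁ : G.Cyc L₁) (h₂ : G.Cyc L₂) :
    Gen.noThird (L₁.map G.arc) (L₂.map G.arc) = true ↔ G.NoThird L₁ L₂ := by
  rw [Gen.noThird_iff (isCyc_iff.2 h₁) (isCyc_iff.2 h₂)]
  have hm : ∀ {L L' : List (Fin G.nE)},
      (∀ a, a ∈ L.map G.arc ↔ a ∈ L'.map G.arc) ↔ ∀ e, e ∈ L ↔ e ∈ L' := by
    intro L L'
    refine ⟨fun h e => by simpa only [hG.mem_map_iff] using h (G.arc e), fun h a => ?_⟩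
    simp only [List.mem_map, h]
  constructor
  · intro h L hL hs
    have := h _ (isCyc_iff.2 hL) fun a ha => by
      obtain ⟨e, he, rfl⟩ := List.mem_map.1 ha
      simpa only [hG.mem_map_iff] using hs e he
    rwa [hm, hm] at this
  · intro h l hl hs
    obtain ⟨L, rfl⟩ := exists_map_arc (G := G) (l := l) fun a ha => by
      rcases hs a ha with h | h <;> obtain ⟨e, -, rfl⟩ := List.mem_map.1 h <;>
        exact mem_arcs.2 ⟨e, rfl⟩
    rw [hm, hm]
    exact h L (isCyc_iff.1 hl) fun e he => by
      simpa only [hG.mem_map_iff] using hs (G.arc e) (List.mem_map_of_mem he)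

end Tidy

/-- The vector that is given by a list of fractions. -/
noncomputable def val (G : WDigraph) (o : Gen.Out) : Fin G.nE → ℝ := fun e =>
  ((o.getD e (false, 0, 0)).2.1 : ℝ) / ((o.getD e (false, 0, 0)).2.2 : ℝ)

/-- The output stands for the vector that is given by it. -/
def Proper (G : WDigraph) (o : Gen.Out) : Prop := (code o).IsVector (G.val o)

theorem vec_eq_ofFn (a : ℕ) (C₁ : List Gen.A) (b : ℕ) (C₂ : List Gen.A) (d : ℕ) :
    Gen.vec G.arcs a C₁ b C₂ d = List.ofFn fun e => (false,
      (if G.arc e ∈ C₁ then a else 0) + (if G.arc e ∈ C₂ then b else 0), d) := by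
  rw [Gen.vec, arcs, List.map_ofFn]; rfl

theorem proper_vec (a : ℕ) (C₁ : List Gen.A) (b : ℕ) (C₂ : List Gen.A) {d : ℕ} (hd : d ≠ 0) :
    G.Proper (Gen.vec G.arcs a C₁ b C₂ d) := by
  refine ⟨fun e => code (false,
      (if G.arc e ∈ C₁ then a else 0) + (if G.arc e ∈ C₂ then b else 0), d), ?_, fun e => ?_⟩
  · rw [vec_eq_ofFn]
    change Data.ofList (List.map _ _) = _
    rw [List.map_ofFn]; rfl
  · refine ⟨false, _, d, hd, rfl, ?_⟩
    rw [val, vec_eq_ofFn]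
    simp [List.getD_eq_getElem?_getD]

theorem Tidy.val_vec (hG : G.Tidy) (a : ℕ) (L₁ : List (Fin G.nE)) (b : ℕ)
    (L₂ : List (Fin G.nE)) (d : ℕ) : G.val (Gen.vec G.arcs a (L₁.map G.arc) b (L₂.map G.arc) d) =
      (d : ℝ)⁻¹ • ((a : ℝ) • G.chi L₁ + (b : ℝ) • G.chi L₂) := by
  funext e
  rw [val, vec_eq_ofFn]
  simp [List.getD_eq_getElem?_getD, -List.mem_map, hG.mem_map_iff, chi, div_eq_inv_mul]

/-- The kinds of vectors that are written. -/
inductive Kind (G : WDigraph) (o : Gen.Out) : Prop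
  | zero (L : List (Fin G.nE)) (hL : G.Cyc L) (hw : G.weight (G.chi L) = 0)
    (ho : o = Gen.zeroVec G.arcs (L.map G.arc))
    (hv : G.val o = (L.length : ℝ)⁻¹ • G.chi L)
  | pair (L₁ L₂ : List (Fin G.nE)) (h₁ : G.Cyc L₁) (h₂ : G.Cyc L₂)
    (hw₁ : G.weight (G.chi L₁) < 0) (hw₂ : 0 < G.weight (G.chi L₂)) (hno : G.NoThird L₁ L₂)
    (ho : o = Gen.pairVec G.arcs (L₁.map G.arc) (L₂.map G.arc))
    (hv : G.val o = (G.weight (G.chi L₂) * L₁.length +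
      -G.weight (G.chi L₁) * L₂.length)⁻¹ • G.pairDir L₁ L₂)
  | vert (L : List (Fin G.nE)) (hL : G.Cyc L) (hw : G.weight (G.chi L) < 0)
    (ho : o = Gen.vertVec G.arcs (L.map G.arc))
    (hv : G.val o = (-G.weight (G.chi L))⁻¹ • G.chi L)

theorem smul_ne_zero_iff {x : Fin G.nE → ℝ} {c : ℝ} (hc : c ≠ 0) (e : Fin G.nE) :
    (c • x) e ≠ 0 ↔ x e ≠ 0 := by simp [hc]

namespace Tidy

variable (hG : G.Tidy)
include hG

theorem val_zeroVec (L : List (Fin G.nE)) :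
    G.val (Gen.zeroVec G.arcs (L.map G.arc)) = (L.length : ℝ)⁻¹ • G.chi L := by
  have := hG.val_vec 1 L 0 [] (L.map G.arc).length
  simpa [Gen.zeroVec] using this

theorem val_vertVec {L : List (Fin G.nE)} (hL : L.Nodup) (hw : G.weight (G.chi L) < 0) :
    G.val (Gen.vertVec G.arcs (L.map G.arc)) = (-G.weight (G.chi L))⁻¹ • G.chi L := by
  have h := hG.val_vec 2 L 0 [] (Gen.negWt (L.map G.arc) - Gen.posWt (L.map G.arc))
  have h2 := hG.weight_eq hL
  rw [Nat.cast_sub ((hG.posWt_lt_iff hL).2 hw).le] at h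
  rw [Gen.vertVec]
  refine h.trans ?_
  rw [show (Gen.negWt (L.map G.arc) : ℝ) - Gen.posWt (L.map G.arc) = 2 * -G.weight (G.chi L) by
    linarith, mul_inv]
  simp only [Nat.cast_ofNat, Nat.cast_zero, zero_smul, add_zero, smul_smul]
  congr 1
  ring

theorem val_pairVec {L₁ L₂ : List (Fin G.nE)} (h₁ : L₁.Nodup) (h₂ : L₂.Nodup)
    (hw₁ : G.weight (G.chi L₁) < 0) (hw₂ : 0 < G.weight (G.chi L₂)) :
    G.val (Gen.pairVec G.arcs (L₁.map G.arc) (L₂.map G.arc)) =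
      (G.weight (G.chi L₂) * L₁.length + -G.weight (G.chi L₁) * L₂.length)⁻¹ •
        G.pairDir L₁ L₂ := by
  rw [Gen.pairVec, hG.val_vec]
  push_cast
  rw [Nat.cast_sub ((hG.posWt_lt_iff h₁).2 hw₁).le, Nat.cast_sub ((hG.negWt_lt_iff h₂).2 hw₂).le,
    ← hG.weight_eq h₂, show (Gen.negWt (L₁.map G.arc) : ℝ) - Gen.posWt (L₁.map G.arc) =
      2 * -G.weight (G.chi L₁) by linarith [hG.weight_eq h₁], List.length_map, List.length_map,
    show ∀ a b c d : ℝ, 2 * a * b + 2 * c * d = 2 * (a * b + c * d) by intros; ring, mul_inv,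
    pairDir]
  module

theorem proper {o : Gen.Out} (ho : G.Kind o) : G.Proper o := by
  cases ho with
  | zero L hL hw ho hv =>
    rw [ho]
    exact proper_vec _ _ _ _ (by simpa using hL.1)
  | pair L₁ L₂ h₁ h₂ hw₁ hw₂ hno ho hv =>
    rw [ho]
    refine proper_vec _ _ _ _ (Nat.ne_of_gt (Nat.add_pos_left (Nat.mul_pos ?_ ?_) _))
    · have := (hG.negWt_lt_iff h₂.nodup).2 hw₂; omega
    · simpa using List.length_pos_of_ne_nil h₁.1
  | vert L hL hw ho hv =>
    rw [ho]
    refine proper_vec _ _ _ _ ?_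
    have := (hG.posWt_lt_iff hL.nodup).2 hw; omega

omit hG in
theorem mem_dirVecs {Ls : List (List Gen.A)} {o : Gen.Out} : o ∈ Gen.dirVecs G.arcs Ls ↔
    (∃ C ∈ Ls, Gen.posWt C = Gen.negWt C ∧ o = Gen.zeroVec G.arcs C) ∨
      ∃ C₁ ∈ Ls, ∃ C₂ ∈ Ls, Gen.posWt C₁ < Gen.negWt C₁ ∧ Gen.negWt C₂ < Gen.posWt C₂ ∧
        Gen.noThird C₁ C₂ = true ∧ o = Gen.pairVec G.arcs C₁ C₂ := by
  simp only [Gen.dirVecs, List.mem_append, List.mem_map, List.mem_filter, List.mem_flatMap,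
    decide_eq_true_eq, Bool.and_eq_true]
  constructor
  · rintro (⟨C, ⟨h1, h2⟩, rfl⟩ | ⟨C₁, ⟨h1, h2⟩, C₂, ⟨h3, h4, h5⟩, rfl⟩)
    · exact .inl ⟨C, h1, h2, rfl⟩
    · exact .inr ⟨C₁, h1, C₂, h3, h2, h4, h5, rfl⟩
  · rintro (⟨C, h1, h2, rfl⟩ | ⟨C₁, h1, C₂, h3, h2, h4, h5, rfl⟩)
    · exact .inl ⟨C, ⟨h1, h2⟩, rfl⟩
    · exact .inr ⟨C₁, ⟨h1, h2⟩, C₂, ⟨h3, h4, h5⟩, rfl⟩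

omit hG in
theorem mem_vertVecs {Ls : List (List Gen.A)} {o : Gen.Out} : o ∈ Gen.vertVecs G.arcs Ls ↔
    ∃ C ∈ Ls, Gen.posWt C < Gen.negWt C ∧ o = Gen.vertVec G.arcs C := by
  simp only [Gen.vertVecs, List.mem_map, List.mem_filter, decide_eq_true_eq]
  constructor
  · rintro ⟨C, ⟨h1, h2⟩, rfl⟩; exact ⟨C, h1, h2, rfl⟩
  · rintro ⟨C, h1, h2, rfl⟩; exact ⟨C, ⟨h1, h2⟩, rfl⟩

theorem zeroVec_mem {Ls : List (List Gen.A)} {L : List (Fin G.nE)} (h : L.map G.arc ∈ Ls)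
    (hL : L.Nodup) (hw : G.weight (G.chi L) = 0) :
    Gen.zeroVec G.arcs (L.map G.arc) ∈ Gen.dirVecs G.arcs Ls :=
  mem_dirVecs.2 (.inl ⟨_, h, (hG.posWt_eq_iff hL).2 hw, rfl⟩)

theorem pairVec_mem {Ls : List (List Gen.A)} {L₁ L₂ : List (Fin G.nE)} (h₁ : L₁.map G.arc ∈ Ls)
    (h₂ : L₂.map G.arc ∈ Ls) (hL₁ : G.Cyc L₁) (hL₂ : G.Cyc L₂) (hw₁ : G.weight (G.chi L₁) < 0)
    (hw₂ : 0 < G.weight (G.chi L₂)) (hno : G.NoThird L₁ L₂) :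
    Gen.pairVec G.arcs (L₁.map G.arc) (L₂.map G.arc) ∈ Gen.dirVecs G.arcs Ls :=
  mem_dirVecs.2 (.inr ⟨_, h₁, _, h₂, (hG.posWt_lt_iff hL₁.nodup).2 hw₁,
    (hG.negWt_lt_iff hL₂.nodup).2 hw₂, (hG.noThird_iff hL₁ hL₂).2 hno, rfl⟩)

section Sound

variable {Ls : List (List Gen.A)} (hLs : ∀ C ∈ Ls, ∃ L, C = L.map G.arc ∧ G.Cyc L)
include hLs

theorem kind_of_mem_vertVecs {o : Gen.Out} (ho : o ∈ Gen.vertVecs G.arcs Ls) :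
    G.Kind o ∧ G.val o ∈ G.verts := by
  obtain ⟨C, hC, hw, rfl⟩ := mem_vertVecs.1 ho
  obtain ⟨L, rfl, hL⟩ := hLs C hC
  rw [hG.posWt_lt_iff hL.nodup] at hw
  have hv := hG.val_vertVec hL.nodup hw
  exact ⟨.vert L hL hw rfl hv, mem_verts_iff.2 ⟨L, hL, hw, hv⟩⟩

theorem kind_of_mem_dirVecs {o : Gen.Out} (ho : o ∈ Gen.dirVecs G.arcs Ls) :
    G.Kind o ∧ (G.polyhedron.Nonempty → G.val o ∈ G.dirs) := by
  rcases mem_dirVecs.1 ho with ⟨C, hC, hw, rfl⟩ | ⟨C₁, hC₁, C₂, hC₂, hw₁, hw₂, hno, rfl⟩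
  · obtain ⟨L, rfl, hL⟩ := hLs C hC
    rw [hG.posWt_eq_iff hL.nodup] at hw
    have hv := hG.val_zeroVec L
    exact ⟨.zero L hL hw rfl hv, fun hP => (mem_dirs_iff hP).2 (.inl ⟨L, hL, hw, hv⟩)⟩
  · obtain ⟨L₁, rfl, h₁⟩ := hLs C₁ hC₁
    obtain ⟨L₂, rfl, h₂⟩ := hLs C₂ hC₂
    rw [hG.posWt_lt_iff h₁.nodup] at hw₁
    rw [hG.negWt_lt_iff h₂.nodup] at hw₂
    rw [hG.noThird_iff h₁ h₂] at hno
    have hv := hG.val_pairVec h₁.nodup h₂.nodup hw₁ hw₂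
    exact ⟨.pair L₁ L₂ h₁ h₂ hw₁ hw₂ hno rfl hv, fun hP =>
      (mem_dirs_iff hP).2 (.inr ⟨L₁, L₂, h₁, h₂, hw₁, hw₂, hno, hv⟩)⟩

theorem kind_of_mem_candidates {b : Bool} {o : Gen.Out}
    (ho : o ∈ Gen.candidates b G.arcs Ls) : G.Kind o := by
  cases b with
  | false => exact (hG.kind_of_mem_dirVecs hLs (by simpa [Gen.candidates] using ho)).1
  | true =>
    rcases List.mem_append.1 (show o ∈ Gen.vertVecs G.arcs Ls ++ Gen.dirVecs G.arcs Ls by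
      simpa [Gen.candidates] using ho) with h | h
    · exact (hG.kind_of_mem_vertVecs hLs h).1
    · exact (hG.kind_of_mem_dirVecs hLs h).1

end Sound

section Complete

variable {Ls : List (List Gen.A)}
  (hLs : ∀ L, G.Cyc L → ∃ L', L'.map G.arc ∈ Ls ∧ G.Cyc L' ∧ ∀ e, e ∈ L' ↔ e ∈ L)
include hLs

theorem exists_vertVec {x : Fin G.nE → ℝ} (hx : x ∈ G.verts) :
    ∃ o ∈ Gen.vertVecs G.arcs Ls, G.val o = x := by
  obtain ⟨L, hL, hw, rfl⟩ := mem_verts_iff.1 hx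
  obtain ⟨L', hm, hL', he⟩ := hLs L hL
  rw [← chi_congr he] at hw ⊢
  exact ⟨_, mem_vertVecs.2 ⟨_, hm, (hG.posWt_lt_iff hL'.nodup).2 hw, rfl⟩,
    hG.val_vertVec hL'.nodup hw⟩

theorem exists_dirVec (hP : G.polyhedron.Nonempty) {x : Fin G.nE → ℝ} (hx : x ∈ G.dirs) :
    ∃ o ∈ Gen.dirVecs G.arcs Ls, G.val o = x := by
  rcases (mem_dirs_iff hP).1 hx with ⟨L, hL, hw, rfl⟩ | ⟨L₁, L₂, h₁, h₂, hw₁, hw₂, hno, rfl⟩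
  · obtain ⟨L', hm, hL', he⟩ := hLs L hL
    rw [← chi_congr he] at hw ⊢
    refine ⟨_, hG.zeroVec_mem hm hL'.nodup hw, ?_⟩
    rw [hG.val_zeroVec, (hL.perm_of_mem_iff hL' he).length_eq]
  · obtain ⟨L₁', hm₁, h₁', he₁⟩ := hLs L₁ h₁
    obtain ⟨L₂', hm₂, h₂', he₂⟩ := hLs L₂ h₂
    rw [pairDir, ← chi_congr he₁, ← chi_congr he₂]
    rw [← chi_congr he₁] at hw₁
    rw [← chi_congr he₂] at hw₂
    refine ⟨_, hG.pairVec_mem hm₁ hm₂ h₁' h₂' hw₁ hw₂ ?_, ?_⟩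
    · intro L hL hs
      simp only [he₁, he₂] at hs ⊢
      exact hno L hL hs
    · rw [hG.val_pairVec h₁'.nodup h₂'.nodup hw₁ hw₂, (h₁.perm_of_mem_iff h₁' he₁).length_eq,
        (h₂.perm_of_mem_iff h₂' he₂).length_eq, pairDir]

end Complete

end Tidy

theorem posWt_perm {C C' : List Gen.A} (h : C.Perm C') : Gen.posWt C = Gen.posWt C' :=
  (h.map _).sum_eq

theorem negWt_perm {C C' : List Gen.A} (h : C.Perm C') : Gen.negWt C = Gen.negWt C' :=
  (h.map _).sum_eq

theorem vec_congr {arcs C₁ C₁' C₂ C₂' : List Gen.A} (h₁ : C₁.Perm C₁') (h₂ : C₂.Perm C₂')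
    (a b d : ℕ) : Gen.vec arcs a C₁ b C₂ d = Gen.vec arcs a C₁' b C₂' d := by
  simp only [Gen.vec, h₁.mem_iff, h₂.mem_iff]

theorem weight_inv_smul_chi {L : List (Fin G.nE)} (hw : G.weight (G.chi L) < 0) :
    G.weight ((-G.weight (G.chi L))⁻¹ • G.chi L) = -1 := by
  rw [weight_smul, inv_neg, neg_mul, inv_mul_cancel₀ hw.ne]

theorem pair_coeff_pos {L₁ L₂ : List (Fin G.nE)} (h₁ : G.Cyc L₁)
    (hw₁ : G.weight (G.chi L₁) < 0) (hw₂ : 0 < G.weight (G.chi L₂)) :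
    0 < (G.weight (G.chi L₂) * L₁.length + -G.weight (G.chi L₁) * L₂.length)⁻¹ := by
  have : (0 : ℝ) < L₁.length := Nat.cast_pos.2 (List.length_pos_of_ne_nil h₁.1)
  have h2 : (0 : ℝ) ≤ L₂.length := Nat.cast_nonneg _
  exact inv_pos.2 (add_pos_of_pos_of_nonneg (mul_pos hw₂ this) (mul_nonneg (by linarith) h2))

theorem length_inv_pos {L : List (Fin G.nE)} (h : G.Cyc L) : (0 : ℝ) < (L.length : ℝ)⁻¹ :=
  inv_pos.2 (Nat.cast_pos.2 (List.length_pos_of_ne_nil h.1))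

/-- The support of a pair of cycles does not contain a cycle of weight zero. -/
theorem NoThird.weight_ne_zero {L₁ L₂ L : List (Fin G.nE)} (hno : G.NoThird L₁ L₂)
    (hw₁ : G.weight (G.chi L₁) < 0) (hw₂ : 0 < G.weight (G.chi L₂)) (hL : G.Cyc L)
    (hs : ∀ e ∈ L, e ∈ L₁ ∨ e ∈ L₂) : G.weight (G.chi L) ≠ 0 := by
  rcases hno L hL hs with h | h <;> rw [chi_congr h]
  · exact hw₁.ne
  · exact hw₂.ne'

/-- Distinct outputs stand for distinct vectors. -/
theorem Kind.ext {o o' : Gen.Out} (h : G.Kind o) (h' : G.Kind o') (he : G.val o = G.val o') :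
    o = o' := by
  have hv : ∀ {L : List (Fin G.nE)}, G.weight (G.chi L) < 0 →
      (-G.weight (G.chi L))⁻¹ ≠ 0 := fun hw => inv_ne_zero (by linarith)
  cases h with
  | zero L hL hw ho hval =>
    rw [hval] at he
    cases h' with
    | zero L' hL' hw' ho' hval' =>
      rw [hval'] at he
      have hm : ∀ e, e ∈ L ↔ e ∈ L' := fun e => by
        rw [← chi_ne_zero_iff, ← chi_ne_zero_iff (l := L'),
          ← smul_ne_zero_iff (length_inv_pos hL).ne', he, smul_ne_zero_iff (length_inv_pos hL').ne']
      have hp := (hL'.perm_of_mem_iff hL hm).map G.arc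
      rw [ho, ho', Gen.zeroVec, Gen.zeroVec, hp.length_eq, vec_congr hp (.refl _)]
    | pair L₁ L₂ h₁ h₂ hw₁ hw₂ hno ho' hval' =>
      rw [hval'] at he
      refine absurd hw (hno.weight_ne_zero hw₁ hw₂ hL fun e hel => ?_)
      rwa [← pairDir_ne_zero_iff hw₁ hw₂, ← smul_ne_zero_iff (pair_coeff_pos h₁ hw₁ hw₂).ne', ← he,
        smul_ne_zero_iff (length_inv_pos hL).ne', chi_ne_zero_iff]
    | vert L' hL' hw' ho' hval' =>
      rw [hval'] at he
      have := congrArg G.weight he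
      rw [weight_inv_smul_chi hw', weight_smul, hw] at this
      norm_num at this
  | pair L₁ L₂ h₁ h₂ hw₁ hw₂ hno ho hval =>
    rw [hval] at he
    cases h' with
    | zero L hL hw ho' hval' =>
      rw [hval'] at he
      refine absurd hw (hno.weight_ne_zero hw₁ hw₂ hL fun e hel => ?_)
      rwa [← pairDir_ne_zero_iff hw₁ hw₂, ← smul_ne_zero_iff (pair_coeff_pos h₁ hw₁ hw₂).ne', he,
        smul_ne_zero_iff (length_inv_pos hL).ne', chi_ne_zero_iff]
    | pair L₁' L₂' h₁' h₂' hw₁' hw₂' hno' ho' hval' =>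
      rw [hval'] at he
      have hm : ∀ e, (e ∈ L₁ ∨ e ∈ L₂) ↔ e ∈ L₁' ∨ e ∈ L₂' := fun e => by
        rw [← pairDir_ne_zero_iff hw₁ hw₂, ← pairDir_ne_zero_iff hw₁' hw₂',
          ← smul_ne_zero_iff (pair_coeff_pos h₁ hw₁ hw₂).ne', he,
          smul_ne_zero_iff (pair_coeff_pos h₁' hw₁' hw₂').ne']
      have hm₁ : ∀ e, e ∈ L₁ ↔ e ∈ L₁' := by
        rcases hno' L₁ h₁ fun e hel => (hm e).1 (.inl hel) with h | h
        · exact h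
        · rw [chi_congr h] at hw₁; linarith
      have hm₂ : ∀ e, e ∈ L₂ ↔ e ∈ L₂' := by
        rcases hno' L₂ h₂ fun e hel => (hm e).1 (.inr hel) with h | h
        · rw [chi_congr h] at hw₂; linarith
        · exact h
      have hp₁ := (h₁'.perm_of_mem_iff h₁ hm₁).map G.arc
      have hp₂ := (h₂'.perm_of_mem_iff h₂ hm₂).map G.arc
      rw [ho, ho', Gen.pairVec, Gen.pairVec, posWt_perm hp₁, negWt_perm hp₁, posWt_perm hp₂,
        negWt_perm hp₂, hp₁.length_eq, hp₂.length_eq, vec_congr hp₁ hp₂]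
    | vert L' hL' hw' ho' hval' =>
      rw [hval'] at he
      have := congrArg G.weight he
      rw [weight_inv_smul_chi hw', weight_smul, weight_pairDir] at this
      norm_num at this
  | vert L hL hw ho hval =>
    rw [hval] at he
    cases h' with
    | zero L' hL' hw' ho' hval' =>
      rw [hval'] at he
      have := congrArg G.weight he
      rw [weight_inv_smul_chi hw, weight_smul, hw'] at this
      norm_num at this
    | pair L₁' L₂' h₁' h₂' hw₁' hw₂' hno' ho' hval' =>
      rw [hval'] at he
      have := congrArg G.weight he
      rw [weight_inv_smul_chi hw, weight_smul, weight_pairDir] at this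
      norm_num at this
    | vert L' hL' hw' ho' hval' =>
      rw [hval'] at he
      have hm : ∀ e, e ∈ L ↔ e ∈ L' := fun e => by
        rw [← chi_ne_zero_iff, ← chi_ne_zero_iff (l := L'),
          ← smul_ne_zero_iff (hv hw), he, smul_ne_zero_iff (hv hw')]
      have hp := (hL'.perm_of_mem_iff hL hm).map G.arc
      rw [ho, ho', Gen.vertVec, Gen.vertVec, posWt_perm hp, negWt_perm hp, vec_congr hp (.refl _)]

end WDigraph
end NegFlow

namespace NegFlow

namespace Gen

/-! ### Invariants of the enumeration -/

/-- The list of the arcs of a walk without repeated tails, in reverse order. -/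
structure IsPath (arcs τ : List A) : Prop where
  ne_nil : τ ≠ []
  subset : ∀ e ∈ τ, e ∈ arcs
  chain : List.IsChain (fun e f => src e = tgt f) τ
  nodup : (τ.map src).Nodup

theorem IsPath.length_le {arcs τ : List A} (h : IsPath arcs τ) : τ.length ≤ arcs.length :=
  (h.nodup.of_map.subperm h.subset).length_le

theorem cur_cons (f : A) (τ : List A) : cur (f :: τ) = tgt f := rfl

theorem root_append (τ : List A) (r : A) : root (τ ++ [r]) = src r := by simp [root, src]

theorem root_cons (f : A) {τ : List A} (h : τ ≠ []) : root (f :: τ) = root τ := by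
  obtain ⟨t, r, rfl⟩ := τ.eq_nil_or_concat.resolve_left h
  rw [List.concat_eq_append, ← List.cons_append, root_append, root_append]

theorem isCyc_iff_isPath {arcs l : List A} (hl : l ≠ []) :
    (IsCyc src tgt l ∧ ∀ e ∈ l, e ∈ arcs) ↔ IsPath arcs l ∧ cur l = root l := by
  obtain ⟨a, t, rfl⟩ := List.exists_cons_of_ne_nil hl
  have h1 : List.IsChain (fun e f => src e = tgt f) (a :: (t ++ [a])) ↔
      List.IsChain (fun e f => src e = tgt f) (a :: t) ∧ root (a :: t) = tgt a := by
    obtain ⟨u, r, hu⟩ := (a :: t).eq_nil_or_concat.resolve_left hl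
    rw [← List.cons_append, hu, List.concat_eq_append, root_append, List.isChain_append]
    simp
  rw [isCyc_cons, h1, cur_cons]
  exact ⟨fun h => ⟨⟨hl, h.2, h.1.1.1, h.1.2⟩, h.1.1.2.symm⟩,
    fun h => ⟨⟨⟨h.1.3, h.2.symm⟩, h.1.4⟩, h.1.2⟩⟩

theorem mem_allowed {arcs τ : List A} {f : A} : f ∈ allowed arcs τ ↔
    f ∈ arcs ∧ (tgt f = root τ ∨ tgt f ∉ τ.map src ∧ tgt f ≠ cur τ) := by
  change f ∈ List.filter _ _ ↔ _
  rw [List.mem_filter, Bool.or_eq_true, decide_eq_true_eq, Bool.and_eq_true, Bool.not_eq_true',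
    Bool.not_eq_true', decide_eq_false_iff_not, decide_eq_false_iff_not]
  rfl

/-- The arc relation of a list of arcs. -/
def Step (B : List A) (v w : ℕ) : Prop := ∃ e ∈ B, src e = v ∧ tgt e = w

theorem extendable_iff {arcs τ : List A} : extendable arcs τ = true ↔
    cur τ ∉ τ.map src ∧ Relation.TransGen (Step (allowed arcs τ)) (cur τ) (root τ) := by
  rw [extendable, Bool.and_eq_true, reaches_iff, Bool.not_eq_true', decide_eq_false_iff_not]
  rfl

theorem good_iff {arcs τ : List A} :
    good arcs τ = true ↔ IsCyc src tgt τ ∨ extendable arcs τ = true := by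
  rw [good, Bool.or_eq_true, isCycle_iff]

/-- Where a walk enters the vertex `v` before its end, its beginning can be cut off. -/
theorem transGen_avoid {V : Type} {r : V → V → Prop} {v s x : V} (h : Relation.TransGen r x s) :
    Relation.TransGen (fun a b => r a b ∧ (b = s ∨ b ≠ v)) x s ∨
      Relation.TransGen (fun a b => r a b ∧ (b = s ∨ b ≠ v)) v s := by
  induction h using Relation.TransGen.head_induction_on with
  | single h => exact .inl (.single ⟨h, .inl rfl⟩)
  | head h _ ih =>
    rename_i a c h'
    rcases ih with ih | ih
    · by_cases hc : c = v
      · exact .inr (hc ▸ ih)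
      · exact .inl (.head ⟨h, .inr hc⟩ ih)
    · exact .inr ih

/-- An extendable path has a good extension. -/
theorem IsPath.exists_child {arcs τ : List A} (h : IsPath arcs τ)
    (he : extendable arcs τ = true) : ∃ τ', τ' ∈ children arcs τ := by
  obtain ⟨hcur, hr⟩ := extendable_iff.1 he
  obtain ⟨v, ⟨f, hf, hfs, rfl⟩, hv⟩ := Relation.TransGen.head'_iff.1 hr
  have hfa := (mem_allowed.1 hf).1
  refine ⟨f :: τ, List.mem_map_of_mem (List.mem_filter.2 ⟨hfa, ?_⟩)⟩
  rw [Bool.and_eq_true, decide_eq_true_eq]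
  refine ⟨hfs, good_iff.2 ?_⟩
  have hp : IsPath arcs (f :: τ) := by
    obtain ⟨a, t, rfl⟩ := List.exists_cons_of_ne_nil h.1
    refine ⟨by simp, List.forall_mem_cons.2 ⟨hfa, h.2⟩, List.isChain_cons_cons.2 ⟨hfs, h.3⟩, ?_⟩
    rw [List.map_cons, List.nodup_cons, hfs]
    exact ⟨hcur, h.4⟩
  by_cases hs : tgt f = root τ
  · left
    exact ((isCyc_iff_isPath hp.1).2 ⟨hp, by rw [cur_cons, root_cons f h.1, hs]⟩).1
  · right
    obtain ⟨h1, h2⟩ := (mem_allowed.1 hf).2.resolve_left hs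
    have hv' := (Relation.reflTransGen_iff_eq_or_transGen.1 hv).resolve_left (Ne.symm hs)
    rw [extendable_iff, cur_cons, root_cons f h.1]
    refine ⟨?_, Relation.TransGen.mono ?_ _ _ (or_self_iff.1 (transGen_avoid (v := tgt f) hv'))⟩
    · rw [List.map_cons, List.mem_cons, hfs]
      exact not_or.2 ⟨h2, h1⟩
    · rintro a b ⟨⟨g, hg, hga, hgb⟩, hb⟩
      refine ⟨g, mem_allowed.2 ⟨(mem_allowed.1 hg).1, ?_⟩, hga, hgb⟩
      rw [cur_cons, root_cons f h.1, List.map_cons, List.mem_cons, hfs, hgb, not_or]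
      rcases (mem_allowed.1 hg).2 with h' | ⟨h3, h4⟩
      · exact .inl (hgb ▸ h')
      · exact hb.imp id fun hb => ⟨⟨hgb ▸ h4, hgb ▸ h3⟩, hb⟩

theorem isPath_of_mem_children {arcs τ τ' : List A} (h : IsPath arcs τ)
    (he : cur τ ∉ τ.map src) (h' : τ' ∈ children arcs τ) : IsPath arcs τ' := by
  obtain ⟨f, hf, rfl⟩ := List.mem_map.1 h'
  rw [List.mem_filter, Bool.and_eq_true, decide_eq_true_eq] at hf
  obtain ⟨hfa, hfs, -⟩ := hf
  obtain ⟨a, t, rfl⟩ := List.exists_cons_of_ne_nil h.1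
  refine ⟨by simp, List.forall_mem_cons.2 ⟨hfa, h.2⟩, List.isChain_cons_cons.2 ⟨hfs, h.3⟩, ?_⟩
  rw [List.map_cons, List.nodup_cons, show src f = _ from hfs]
  exact ⟨he, h.4⟩

theorem transGen_of_isChain {t : List A} (ht : t ≠ []) {h : A}
    (hc : List.IsChain (fun e f => src e = tgt f) (t ++ [h])) :
    Relation.TransGen (Step t) (tgt h) (cur t) := by
  induction t with
  | nil => exact absurd rfl ht
  | cons x t ih =>
    cases t with
    | nil => exact .single ⟨x, by simp, by simpa using hc, rfl⟩
    | cons y t =>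
      rw [List.cons_append, List.cons_append, List.isChain_cons_cons] at hc
      exact .tail (Relation.TransGen.mono (fun a b ⟨e, he, h⟩ => ⟨e, by simp [he], h⟩) _ _
        (ih (by simp) hc.2)) ⟨x, by simp, hc.1, rfl⟩

/-- The paths that lie on a cycle are good. -/
theorem good_of_suffix {arcs t ρ : List A} (hC : IsCyc src tgt (t ++ ρ))
    (hs : ∀ e ∈ t ++ ρ, e ∈ arcs) (hρ : ρ ≠ []) : good arcs ρ = true := by
  rw [good_iff]
  rcases eq_or_ne t [] with rfl | ht
  · exact .inl hC
  right
  obtain ⟨hp, hcl⟩ := (isCyc_iff_isPath (arcs := arcs) hC.1).1 ⟨hC, hs⟩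
  obtain ⟨a, u, rfl⟩ := List.exists_cons_of_ne_nil hρ
  obtain ⟨x, t', rfl⟩ := List.exists_cons_of_ne_nil ht
  have hroot : root (x :: t' ++ a :: u) = root (a :: u) := by
    obtain ⟨w, r, hw⟩ := (a :: u).eq_nil_or_concat.resolve_left hρ
    rw [hw, List.concat_eq_append, ← List.append_assoc, root_append, root_append]
  rw [hroot] at hcl
  have hnd := hC.nodup
  rw [List.nodup_append] at hnd
  -- the heads of the arcs of `t` are the tails of other arcs than those of `ρ`, up to the last
  have key : ∀ y ∈ x :: t', tgt y ∈ (a :: u).map src → tgt y = root (a :: u) := by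
    intro y hy h
    obtain ⟨w, r, hw⟩ := (a :: u).eq_nil_or_concat.resolve_left hρ
    rw [List.concat_eq_append] at hw
    obtain ⟨e, he, hey⟩ := List.mem_map.1 h
    obtain ⟨w₁, w₂, h12⟩ := List.append_of_mem he
    cases w₂ with
    | nil => rw [h12, root_append, hey]
    | cons e' w₂ =>
      have hch := hp.3
      rw [h12, ← List.append_assoc] at hch
      have := (List.isChain_cons_cons.1 (List.isChain_append.1 hch).2.1).1
      refine absurd (hC.tgt_inj (List.mem_append_left _ hy) (f := e') ?_ ?_) ?_
      · exact List.mem_append_right _ (h12 ▸ by simp)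
      · rw [← hey, this]
      · exact hnd.2.2 y hy e' (h12 ▸ by simp)
  have hcur : cur (a :: u) ∉ (a :: u).map src := by
    obtain ⟨w, y, hw⟩ := (x :: t').eq_nil_or_concat.resolve_left ht
    rw [List.concat_eq_append] at hw
    have hch := hp.3
    rw [hw, List.append_assoc] at hch
    have h1 := (List.isChain_cons_cons.1 (List.isChain_append.1 hch).2.1).1
    have h2 := hp.4
    rw [List.map_append, List.nodup_append] at h2
    intro h
    exact h2.2.2 (src y) (List.mem_map_of_mem (hw ▸ by simp)) _ h h1
  refine extendable_iff.2 ⟨hcur, ?_⟩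
  have hch : List.IsChain (fun e f => src e = tgt f) ((x :: t') ++ [a]) :=
    hp.3.prefix (by simp)
  have h := transGen_of_isChain ht hch
  rw [show cur (x :: t') = root (a :: u) from hcl] at h
  refine Relation.TransGen.mono ?_ _ _ h
  rintro v w ⟨y, hy, hyv, hyw⟩
  refine ⟨y, mem_allowed.2 ⟨hs y (List.mem_append_left _ hy), ?_⟩, hyv, hyw⟩
  by_cases h' : tgt y ∈ (a :: u).map src
  · exact .inl (key y hy h')
  · refine .inr ⟨h', fun h'' => ?_⟩
    exact hnd.2.2 y hy a (by simp)
      (hC.tgt_inj (List.mem_append_left _ hy) (List.mem_append_right _ (by simp)) h'')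

theorem eq_of_suffix {C C' : List A} (h : IsCyc src tgt C) (h' : IsCyc src tgt C')
    (hs : C <:+ C') : C = C' :=
  hs.eq_of_length (h'.perm_of_mem_iff h (h'.mem_iff_of_subset h fun _ he => hs.subset he)).length_eq

/-- Neither of two lists is a suffix of the other. -/
def Incomp (x y : List A) : Prop := ¬ x <:+ y ∧ ¬ y <:+ x

theorem Incomp.symm {x y : List A} (h : Incomp x y) : Incomp y x := ⟨h.2, h.1⟩

/-- What is true of the paths on the stack and the cycles found at any time: the paths are good,
none of these lists is a suffix of another one, and every cycle has been found or will be found by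
extending a path on the stack. -/
structure Inv (arcs : List A) (s : State) : Prop where
  arcs_eq : s.1 = arcs
  path : ∀ τ ∈ s.2.1, IsPath arcs τ ∧ good arcs τ = true
  cyc : ∀ C ∈ s.2.2.1, IsCyc src tgt C ∧ ∀ e ∈ C, e ∈ arcs
  incomp : (s.2.2.1 ++ s.2.1).Pairwise Incomp
  complete : ∀ C, IsCyc src tgt C → (∀ e ∈ C, e ∈ arcs) → C ∈ s.2.2.1 ∨ ∃ τ ∈ s.2.1, τ <:+ C

theorem inv_init {n : ℕ} {arcs : List A} (hnd : arcs.Nodup) : Inv arcs (init (n, arcs)) where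
  arcs_eq := rfl
  path τ hτ := by
    obtain ⟨h, hg⟩ := List.mem_filter.1 hτ
    obtain ⟨e, he, rfl⟩ := List.mem_map.1 h
    exact ⟨⟨by simp, by simpa using he, by simp, by simp⟩, hg⟩
  cyc C hC := by simp [init] at hC
  incomp := by
    refine List.Pairwise.filter _ (List.pairwise_map.2 (hnd.imp ?_))
    intro e f hef
    simp [Incomp, List.suffix_cons_iff, hef, hef.symm]
  complete C hC hs := by
    right
    obtain ⟨t, r, rfl⟩ := C.eq_nil_or_concat.resolve_left hC.1
    rw [List.concat_eq_append] at *
    exact ⟨[r], List.mem_filter.2 ⟨List.mem_map_of_mem (hs r (by simp)),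
      good_of_suffix hC hs (by simp)⟩, by simp⟩

theorem Inv.next {arcs : List A} (hnd : arcs.Nodup) {s : State} (h : Inv arcs s)
    (hr : run s = true) (b : Bool) : Inv arcs (next b s) := by
  obtain ⟨a, st, K, M⟩ := s
  obtain rfl : a = arcs := h.1
  obtain ⟨τ, σ, rfl⟩ := List.exists_cons_of_ne_nil (l := st) (by rintro rfl; simp [run] at hr)
  obtain ⟨hp, hg⟩ := h.2 τ (by simp)
  by_cases hc : isCycle τ = true
  · have hn : Gen.next b (a, τ :: σ, K, M) =
        (a, σ, τ :: K, outs b (a, τ :: σ, K, M) ++ M) := by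
      simp [Gen.next, newStack, newK, hc]
    have hcy := isCycle_iff.1 hc
    rw [hn]
    refine ⟨rfl, fun ρ hρ => h.2 ρ (by simp [hρ]), ?_, ?_, fun C hC hs => ?_⟩
    · exact List.forall_mem_cons.2 ⟨⟨hcy, hp.2⟩, h.3⟩
    · exact (List.Perm.pairwise_iff Incomp.symm List.perm_middle).1 h.4
    · rcases h.5 C hC hs with h' | ⟨ρ, hρ, hρC⟩
      · exact .inl (by simp [h'])
      · rcases List.mem_cons.1 hρ with rfl | hρ
        · exact .inl (by simp [eq_of_suffix hcy hC hρC])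
        · exact .inr ⟨ρ, hρ, hρC⟩
  · have hn : Gen.next b (a, τ :: σ, K, M) =
        (a, children a τ ++ σ, K, outs b (a, τ :: σ, K, M) ++ M) := by
      simp [Gen.next, newStack, newK, hc]
    rw [isCycle_iff] at hc
    have hcur := (extendable_iff.1 ((good_iff.1 hg).resolve_left hc)).1
    have hin := (List.Perm.pairwise_iff Incomp.symm List.perm_middle).1 h.4
    rw [List.pairwise_cons] at hin
    rw [hn]
    refine ⟨rfl, fun ρ hρ => ?_, h.3, ?_, fun C hC hs => ?_⟩
    · rcases List.mem_append.1 hρ with hρ | hρ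
      · refine ⟨isPath_of_mem_children hp hcur hρ, ?_⟩
        obtain ⟨f, hf, rfl⟩ := List.mem_map.1 hρ
        rw [List.mem_filter, Bool.and_eq_true] at hf
        exact hf.2.2
      · exact h.2 ρ (by simp [hρ])
    · have hperm : (K ++ (children a τ ++ σ)).Perm (children a τ ++ (K ++ σ)) := by
        rw [← List.append_assoc, ← List.append_assoc]
        exact List.perm_append_comm.append_right σ
      refine (List.Perm.pairwise_iff Incomp.symm hperm).2 (List.pairwise_append.2 ⟨?_, hin.2, ?_⟩)
      · refine List.pairwise_map.2 (List.Pairwise.filter _ (hnd.imp fun {e f} hef => ?_))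
        have : ∀ e f : A, e ≠ f → ¬ e :: τ <:+ f :: τ := fun e f hef hs =>
          hef (List.cons.inj (hs.eq_of_length (by simp))).1
        exact ⟨this e f hef, this f e hef.symm⟩
      · intro ρ hρ x hx
        obtain ⟨f, hf, rfl⟩ := List.mem_map.1 hρ
        have h1 := hin.1 x hx
        refine ⟨fun h' => h1.1 ((List.suffix_cons f τ).trans h'), fun h' => ?_⟩
        rcases List.suffix_cons_iff.1 h' with rfl | h'
        · exact h1.1 (List.suffix_cons f τ)
        · exact h1.2 h'
    · rcases h.5 C hC hs with h' | ⟨ρ, hρ, hρC⟩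
      · exact .inl h'
      right
      rcases List.mem_cons.1 hρ with rfl | hρ
      · obtain ⟨t, rfl⟩ := hρC
        rcases t.eq_nil_or_concat with rfl | ⟨t, f, rfl⟩
        · exact absurd hC hc
        rw [List.concat_eq_append, List.append_assoc, List.singleton_append] at *
        refine ⟨f :: ρ, List.mem_append_left _ (List.mem_map_of_mem (List.mem_filter.2
          ⟨hs f (by simp), ?_⟩)), ⟨t, rfl⟩⟩
        rw [Bool.and_eq_true, decide_eq_true_eq]
        refine ⟨?_, good_of_suffix hC hs (by simp)⟩
        obtain ⟨c, u, rfl⟩ := List.exists_cons_of_ne_nil hp.1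
        have hch := ((isCyc_iff_isPath (arcs := a) hC.1).1 ⟨hC, hs⟩).1.3
        exact (List.isChain_cons_cons.1 (List.isChain_append.1 hch).2.1).1
      · exact ⟨ρ, List.mem_append_right _ hρ, hρC⟩

theorem Inv.nodup {arcs : List A} {s : State} (h : Inv arcs s) : s.2.2.1.Nodup :=
  (List.pairwise_append.1 h.4).1.imp fun {x y} hxy => by
    rintro rfl; exact hxy.1 List.suffix_rfl

/-- Each step either finds a cycle or makes the path on top of the stack longer. -/
theorem Inv.next_length {arcs : List A} {s : State} (h : Inv arcs s)
    (hr : run s = true) (b : Bool) {i : ℕ}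
    (hi : i ≤ (arcs.length + 1) * s.2.2.1.length + (s.2.1.headD []).length) :
    i + 1 ≤ (arcs.length + 1) * (Gen.next b s).2.2.1.length +
      ((Gen.next b s).2.1.headD []).length := by
  obtain ⟨a, st, K, M⟩ := s
  obtain rfl : a = arcs := h.1
  obtain ⟨τ, σ, rfl⟩ := List.exists_cons_of_ne_nil (l := st) (by rintro rfl; simp [run] at hr)
  obtain ⟨hp, hg⟩ := h.2 τ (by simp)
  have hl := hp.length_le
  by_cases hc : isCycle τ = true
  · have hn : Gen.next b (a, τ :: σ, K, M) =
        (a, σ, τ :: K, outs b (a, τ :: σ, K, M) ++ M) := by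
      simp [Gen.next, newStack, newK, hc]
    rw [hn]
    simp only [List.headD_cons, List.length_cons, mul_add, mul_one] at hi ⊢
    omega
  · have hn : Gen.next b (a, τ :: σ, K, M) =
        (a, children a τ ++ σ, K, outs b (a, τ :: σ, K, M) ++ M) := by
      simp [Gen.next, newStack, newK, hc]
    rw [isCycle_iff] at hc
    obtain ⟨τ', hτ'⟩ := hp.exists_child ((good_iff.1 hg).resolve_left hc)
    obtain ⟨ρ, ρs, hρ⟩ := List.exists_cons_of_ne_nil (List.ne_nil_of_mem hτ')
    have : ρ ∈ children a τ := by simp [hρ]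
    obtain ⟨f, -, rfl⟩ := List.mem_map.1 this
    rw [hn, hρ]
    simp only [List.headD_cons, List.length_cons, List.cons_append] at hi ⊢
    omega

theorem children_length_le (arcs τ : List A) : (children arcs τ).length ≤ arcs.length := by
  rw [children, List.length_map]; exact List.length_filter_le _ _

theorem next_length_le (b : Bool) (s : State) : (next b s).2.1.length ≤ s.1.length + s.2.1.length ∧
    (next b s).2.2.1.length ≤ s.2.2.1.length + 1 := by
  constructor
  · change (newStack s).length ≤ _
    unfold newStack
    have := children_length_le s.1 (s.2.1.headD [])
    split_ifs
    · simp only [List.length_tail]; omega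
    · simp only [List.length_append, List.length_tail]; omega
  · change (newK s).length ≤ _
    unfold newK
    split_ifs <;> simp

theorem subset_newK (s : State) : s.2.2.1 ⊆ newK s := by
  unfold newK; split_ifs <;> simp

/-! ### The vectors that are written -/

theorem fresh_aux (M : List Out) : ∀ (L acc : List Out), (M ++ acc).Nodup →
    (∀ x, x ∈ M ++ L.foldl (fun acc x => if x ∈ M ++ acc then acc else x :: acc) acc ↔
      x ∈ M ++ acc ∨ x ∈ L) ∧
    (M ++ L.foldl (fun acc x => if x ∈ M ++ acc then acc else x :: acc) acc).Nodup := by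
  intro L
  induction L with
  | nil => simp
  | cons a L ih =>
    intro acc hacc
    rw [List.foldl_cons]
    split_ifs with ha
    · obtain ⟨h1, h2⟩ := ih acc hacc
      refine ⟨fun x => ?_, h2⟩
      rw [h1, List.mem_cons]
      constructor
      · tauto
      · rintro (h | rfl | h) <;> tauto
    · obtain ⟨h1, h2⟩ := ih (a :: acc) (by
        rw [List.perm_middle.nodup_iff]; exact List.nodup_cons.2 ⟨ha, hacc⟩)
      refine ⟨fun x => ?_, h2⟩
      rw [h1, List.mem_cons, List.mem_append, List.mem_append, List.mem_cons]
      tauto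

theorem mem_fresh {M L : List Out} (hM : M.Nodup) {x : Out} :
    x ∈ fresh M L ++ M ↔ x ∈ M ∨ x ∈ L := by
  have := (fresh_aux M L [] (by simpa using hM)).1 x
  rw [List.append_nil] at this
  rw [← this, List.mem_append, List.mem_append, or_comm]
  rfl

theorem nodup_fresh {M L : List Out} (hM : M.Nodup) : (fresh M L ++ M).Nodup :=
  List.nodup_append_comm.1 (fresh_aux M L [] (by simpa using hM)).2

theorem mem_closure {arcs C : List A} {K : List (List A)} : C ∈ closure arcs K ↔
    IsCyc src tgt C ∧ (C ∈ pairsOf arcs ∨ C ∈ K ∨ ∃ D ∈ K, C ∈ chords arcs D) := by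
  rw [closure, List.mem_filter, isCycle_iff, List.mem_append, List.mem_append, List.mem_flatMap,
    and_comm]

theorem mem_pairsOf {arcs C : List A} : C ∈ pairsOf arcs ↔ ∃ e ∈ arcs, ∃ f ∈ arcs, [e, f] = C := by
  simp [pairsOf]

theorem mem_chords {arcs C D : List A} :
    C ∈ chords arcs D ↔ ∃ P, P <:+: D ++ D ∧ ∃ f ∈ arcs, f :: P = C := by
  simp only [chords, List.mem_flatMap, mem_segments, List.mem_map]

theorem closure_mono (arcs : List A) {K K' : List (List A)} (h : K ⊆ K') :
    closure arcs K ⊆ closure arcs K' := fun C hC => by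
  rw [mem_closure] at hC ⊢
  exact ⟨hC.1, hC.2.imp id (.imp (@h C) fun ⟨D, hD, h'⟩ => ⟨D, h hD, h'⟩)⟩

theorem subset_of_mem_closure {arcs : List A} {K : List (List A)}
    (hK : ∀ C ∈ K, ∀ e ∈ C, e ∈ arcs) {C : List A} (hC : C ∈ closure arcs K) :
    ∀ e ∈ C, e ∈ arcs := by
  rcases (mem_closure.1 hC).2 with h | h | ⟨D, hD, h⟩
  · obtain ⟨e, he, f, hf, rfl⟩ := mem_pairsOf.1 h
    simp [he, hf]
  · exact hK C h
  · obtain ⟨P, hP, f, hf, rfl⟩ := mem_chords.1 h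
    refine List.forall_mem_cons.2 ⟨hf, fun e he => hK D hD e ?_⟩
    simpa using hP.subset he

theorem candidates_mono (b : Bool) (arcs : List A) {L L' : List (List A)} (h : L ⊆ L') :
    candidates b arcs L ⊆ candidates b arcs L' := by
  have h1 : vertVecs arcs L ⊆ vertVecs arcs L' :=
    List.map_subset _ (List.filter_subset _ h)
  have h2 : dirVecs arcs L ⊆ dirVecs arcs L' := by
    refine List.append_subset.2 ⟨fun x hx => List.mem_append_left _
      (List.map_subset _ (List.filter_subset _ h) hx), fun x hx => List.mem_append_right _ ?_⟩
    obtain ⟨C₁, h1, h2⟩ := List.mem_flatMap.1 hx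
    exact List.mem_flatMap.2 ⟨C₁, List.filter_subset _ h h1,
      List.map_subset _ (List.filter_subset _ h) h2⟩
  unfold candidates
  split_ifs
  · exact List.append_subset.2 ⟨fun x hx => List.mem_append_left _ (h1 hx),
      fun x hx => List.mem_append_right _ (h2 hx)⟩
  · exact h2

end Gen
end NegFlow

namespace NegFlow

open TreeCode (code)

namespace Gen

/-! ### The running time in terms of the number of cycles found -/

/-- What is true of the state after `i` steps: in addition to `Inv`, the lists are not too long and
the vectors written are those that come from the cycles found. -/
structure InvAt (b : Bool) (arcs : List A) (i : ℕ) (s : State) : Prop extends Inv arcs s where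
  index_le : i ≤ (arcs.length + 1) * s.2.2.1.length + (s.2.1.headD []).length
  stack_le : s.2.1.length ≤ arcs.length * (i + 1)
  found_le : s.2.2.1.length ≤ i
  nodup_out : s.2.2.2.Nodup
  sound : ∀ o ∈ s.2.2.2, o ∈ candidates b arcs (closure arcs s.2.2.1)
  written : i ≠ 0 → ∀ o ∈ candidates b arcs (closure arcs s.2.2.1), o ∈ s.2.2.2

theorem invAt_init (b : Bool) {n : ℕ} {arcs : List A} (hnd : arcs.Nodup) :
    InvAt b arcs 0 (init (n, arcs)) where
  toInv := inv_init hnd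
  index_le := Nat.zero_le _
  stack_le := by
    simpa [init] using List.length_filter_le (good arcs) (arcs.map fun e => [e])
  found_le := le_rfl
  nodup_out := List.nodup_nil
  sound o ho := by simp [init] at ho
  written h := absurd rfl h

theorem InvAt.next {b : Bool} {arcs : List A} (hnd : arcs.Nodup) {i : ℕ} {s : State}
    (h : InvAt b arcs i s) (hr : run s = true) : InvAt b arcs (i + 1) (Gen.next b s) := by
  have hl := next_length_le b s
  have hmem : ∀ o, o ∈ (Gen.next b s).2.2.2 ↔
      o ∈ s.2.2.2 ∨ o ∈ candidates b arcs (closure arcs (newK s)) := by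
    intro o
    change o ∈ fresh s.2.2.2 _ ++ s.2.2.2 ↔ _
    rw [mem_fresh h.nodup_out, h.arcs_eq]
  refine ⟨h.toInv.next hnd hr b, h.toInv.next_length hr b h.index_le, ?_, ?_, ?_, ?_, ?_⟩
  · rw [h.arcs_eq] at hl
    have := h.stack_le
    rw [mul_add_one]
    omega
  · have := h.found_le
    omega
  · exact nodup_fresh h.nodup_out
  · intro o ho
    rcases (hmem o).1 ho with ho | ho
    · exact candidates_mono b arcs (closure_mono arcs (subset_newK s)) (h.sound o ho)
    · exact ho
  · exact fun _ o ho => (hmem o).2 (.inr ho)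

theorem InvAt.index_le' {b : Bool} {arcs : List A} {i : ℕ} {s : State} (h : InvAt b arcs i s) :
    i ≤ (arcs.length + 1) * (s.2.2.1.length + 1) := by
  have h1 := h.index_le
  have h2 : (s.2.1.headD []).length ≤ arcs.length := by
    cases h3 : s.2.1 with
    | nil => simp
    | cons τ σ => exact (h.path τ (by simp [h3])).1.length_le
  rw [mul_add_one]
  omega

theorem codeSize_le_of_subset {arcs τ : List A} (hs : ∀ e ∈ τ, e ∈ arcs)
    (hl : τ.length ≤ arcs.length) :
    codeSize τ ≤ codeSize arcs * (codeSize arcs + 1) + 1 :=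
  (codeSize_list_le fun e he => (codeSize_mem (hs e he)).le).trans <|
    Nat.add_le_add_right (Nat.mul_le_mul_right _ (hl.trans (length_lt_codeSize arcs).le)) _

open Polynomial in
/-- The states have polynomial size. -/
theorem exists_codeSize_le (b : Bool) : ∃ r : Polynomial ℕ, ∀ (arcs : List A) (i : ℕ) (s : State),
    InvAt b arcs i s → codeSize s ≤ r.eval (codeSize arcs + i) := by
  obtain ⟨p, c, hc⟩ : PolyTime fun x : List A × List (List A) =>
    candidates b x.1 (closure x.1 x.2) := by fun_prop
  have hc := fun x => hc.size_le x
  set P : Polynomial ℕ := X * (X + 1) + 1 with hP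
  set S : Polynomial ℕ := c.comp (X + (X * (P + 1) + 1) + 1) with hS
  refine ⟨X + (X * (X + 1) * (P + 1) + 1) + (X * (P + 1) + 1) + (S * (S + 1) + 1) + 3,
    fun arcs i s h => ?_⟩
  set m := codeSize arcs + i with hm
  have hi : i ≤ m := by omega
  have ha : codeSize arcs ≤ m := by omega
  have hn : arcs.length ≤ m := (length_lt_codeSize arcs).le.trans ha
  have hlist : ∀ τ : List A, (∀ e ∈ τ, e ∈ arcs) → τ.length ≤ arcs.length →
      codeSize τ ≤ P.eval m := fun τ h1 h2 => (codeSize_le_of_subset h1 h2).trans (by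
    simp only [hP, eval_add, eval_mul, eval_X, eval_one]; gcongr)
  have h2 : codeSize s.2.1 ≤ m * (m + 1) * (P.eval m + 1) + 1 :=
    (codeSize_list_le fun τ hτ => hlist τ (h.path τ hτ).1.2 (h.path τ hτ).1.length_le).trans (by
      have := h.stack_le; gcongr; exact this.trans (by gcongr))
  have h3 : codeSize s.2.2.1 ≤ m * (P.eval m + 1) + 1 :=
    (codeSize_list_le fun C hC => hlist C (h.cyc C hC).2
      ((isCyc_iff_isPath (h.cyc C hC).1.1).1 (h.cyc C hC)).1.length_le).trans (by
        have := h.found_le; gcongr; omega)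
  have h4 : codeSize (candidates b arcs (closure arcs s.2.2.1)) ≤ S.eval m :=
    (hc (arcs, s.2.2.1)).trans (by
      rw [hS, eval_comp]
      apply polynomial_eval_mono
      simp only [codeSize_pair, eval_add, eval_mul, eval_X, eval_one]
      omega)
  have h5 : codeSize s.2.2.2 ≤ S.eval m * (S.eval m + 1) + 1 := by
    have hl := (h.nodup_out.subperm h.sound).length_le.trans (length_lt_codeSize _).le
    exact (codeSize_list_le fun o ho => (codeSize_mem (h.sound o ho)).le.trans h4).trans (by
      have := hl.trans h4; gcongr)
  have h1 : codeSize s.1 ≤ m := by rw [h.arcs_eq]; exact ha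
  rw [codeSize_pair, codeSize_pair, codeSize_pair]
  simp only [eval_add, eval_mul, eval_X, eval_one, eval_ofNat]
  omega

theorem finite_cycles (arcs : List A) :
    {C | IsCyc src tgt C ∧ ∀ e ∈ C, e ∈ arcs}.Finite := by
  have : Finite {a // a ∈ arcs} := (List.finite_toSet arcs).to_subtype
  refine ((List.finite_length_le {a // a ∈ arcs} arcs.length).image
    (List.map Subtype.val)).subset fun C hC => ?_
  refine ⟨C.attachWith (· ∈ arcs) hC.2, ?_, by simp [List.attach_map_subtype_val]⟩
  simpa using ((isCyc_iff_isPath hC.1.1).1 hC).1.length_le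

theorem finset_sum_length (f : ℕ → List Out) (n : ℕ) :
    ∑ j ∈ Finset.range n, (f j).length = ((List.range n).flatMap f).length := by
  induction n with
  | zero => simp
  | succ n ih => rw [Finset.sum_range_succ, ih, List.range_succ]; simp

open Polynomial in
/-- The enumeration as a program: it halts when all cycles have been found, and the number of steps
up to any time is bounded in terms of the number of cycles found up to this time. -/
theorem exists_program (b : Bool) : ∃ (p : Program) (Q : Polynomial ℕ), ∀ (n : ℕ) (arcs : List A),
    arcs.Nodup → ∃ (t : Trace) (M : List Out) (Ls : List (List A)), p.RunsOn (code (n, arcs)) t ∧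
      t.outputs = M.map code ∧ M.Nodup ∧
      (∀ C, C ∈ Ls ↔ IsCyc src tgt C ∧ ∀ e ∈ C, e ∈ arcs) ∧
      (∀ o, o ∈ M ↔ o ∈ candidates b arcs Ls) ∧
      ∀ t' : Trace, t' <+: t → ∃ (K : List (List A)) (M' : List Out), K.Nodup ∧
        (∀ C ∈ K, IsCyc src tgt C ∧ ∀ e ∈ C, e ∈ arcs) ∧
        (K ≠ [] → ∀ o ∈ candidates b arcs (closure arcs K), o ∈ M') ∧
        M'.length ≤ t'.outputs.length ∧
        t'.length ≤ Q.eval (codeSize (n, arcs) + K.length) := by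
  obtain ⟨p, q, h⟩ := exists_generator polyTime_init polyTime_run (polyTime_outs b)
    (polyTime_next b)
  obtain ⟨r, hr⟩ := exists_codeSize_le b
  refine ⟨p, q + ((X + 1) * (X + 1) + 1) * q.comp (r.comp (X + (X + 1) * (X + 1))),
    fun n arcs hnd => ?_⟩
  set s : ℕ → State := fun i => (next b)^[i] (init (n, arcs)) with hs
  have hs' : ∀ i, s (i + 1) = next b (s i) := fun i => Function.iterate_succ_apply' _ _ _
  have hinv : ∀ i, (∀ j < i, run (s j) = true) → InvAt b arcs i (s i) := by
    intro i
    induction i with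
    | zero => exact fun _ => invAt_init b hnd
    | succ i ih =>
      intro hj
      rw [hs']
      exact (ih fun j hji => hj j (by omega)).next hnd (hj i (by omega))
  have hout : ∀ i, (s i).2.2.2.Perm ((List.range i).flatMap fun j => outs b (s j)) := by
    intro i
    induction i with
    | zero => exact .refl _
    | succ i ih =>
      rw [hs', List.range_succ, List.flatMap_append, List.flatMap_singleton]
      exact (List.perm_append_comm).trans (ih.append_right _)
  have hhalt : ∃ N, run (s N) = false := by
    by_contra! hcon
    have hcon : ∀ i, run (s i) = true := fun i => by simpa using hcon i
    have hb : ∀ i, (s i).2.2.1.length ≤ (finite_cycles arcs).toFinset.card := by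
      intro i
      have hi := hinv i fun j _ => hcon j
      rw [← List.toFinset_card_of_nodup hi.nodup]
      refine Finset.card_le_card fun C hC => ?_
      rw [Set.Finite.mem_toFinset]
      exact hi.cyc C (List.mem_toFinset.1 hC)
    set k := (finite_cycles arcs).toFinset.card
    have h1 := (hinv ((arcs.length + 1) * (k + 1) + 1) fun j _ => hcon j).index_le'
    have h2 : (arcs.length + 1) * ((s ((arcs.length + 1) * (k + 1) + 1)).2.2.1.length + 1) ≤
      (arcs.length + 1) * (k + 1) := by have := hb ((arcs.length + 1) * (k + 1) + 1); gcongr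
    omega
  classical
  obtain ⟨N, hN, hmin⟩ : ∃ N, run (s N) = false ∧ ∀ i < N, run (s i) = true :=
    ⟨Nat.find hhalt, Nat.find_spec hhalt, fun i hi => by simpa using Nat.find_min hhalt hi⟩
  obtain ⟨t, ht, hto, htt⟩ := h (n, arcs) N hmin hN
  have hiN := hinv N hmin
  have hst : (s N).2.1 = [] := by simpa [run] using hN
  have hall : ∀ C, IsCyc src tgt C → (∀ e ∈ C, e ∈ arcs) → C ∈ (s N).2.2.1 := fun C h1 h2 => by
    simpa [hst] using hiN.complete C h1 h2
  have hcl : ∀ C, C ∈ closure arcs (s N).2.2.1 ↔ IsCyc src tgt C ∧ ∀ e ∈ C, e ∈ arcs := fun C =>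
    ⟨fun hC => ⟨(mem_closure.1 hC).1, subset_of_mem_closure (fun C hC => (hiN.cyc C hC).2) hC⟩,
      fun hC => mem_closure.2 ⟨hC.1, .inr (.inl (hall C hC.1 hC.2))⟩⟩
  refine ⟨t, _, closure arcs (s N).2.2.1, ht, hto, ?_, hcl, fun o => ?_, fun t' ht' => ?_⟩
  · exact (hout N).nodup_iff.1 hiN.nodup_out
  · refine (hout N).mem_iff.symm.trans ⟨hiN.sound o, fun ho => ?_⟩
    rcases eq_or_ne N 0 with rfl | h0
    · -- without any step, there is no cycle and hence no candidate
      have hnil : closure arcs (s 0).2.2.1 = [] := List.eq_nil_iff_forall_not_mem.2 fun C hC =>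
        List.not_mem_nil (hall C ((hcl C).1 hC).1 ((hcl C).1 hC).2)
      rw [hnil] at ho
      cases b <;> simp [candidates, vertVecs, dirVecs] at ho
    · exact hiN.written h0 o ho
  · obtain ⟨i, hi, hcount, htime⟩ := htt t' ht'
    have hi' := hinv i fun j hj => hmin j (by omega)
    refine ⟨(s i).2.2.1, (s i).2.2.2, hi'.nodup, hi'.cyc, fun hK => hi'.written ?_, ?_, ?_⟩
    · rintro rfl; exact hK rfl
    · rw [(hout i).length_eq, ← finset_sum_length]
      exact hcount
    · refine htime.trans ?_
      set m := codeSize (n, arcs) + (s i).2.2.1.length with hm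
      have him : i ≤ (m + 1) * (m + 1) := hi'.index_le'.trans (by
        have := length_lt_codeSize arcs
        rw [codeSize_pair] at hm
        gcongr <;> dsimp only at * <;> omega)
      simp only [eval_add, eval_mul, eval_X, eval_one, eval_comp]
      refine Nat.add_le_add (polynomial_eval_mono _ (by omega)) ?_
      refine (Finset.sum_le_card_nsmul _ _ (q.eval (r.eval (m + (m + 1) * (m + 1))))
        fun j hj => polynomial_eval_mono _ ?_).trans ?_
      · rw [Finset.mem_range] at hj
        refine (hr arcs j _ (hinv j fun k hk => hmin k (by omega))).trans
          (polynomial_eval_mono _ ?_)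
        rw [codeSize_pair] at hm
        dsimp only at hm
        omega
      · rw [Finset.card_range, smul_eq_mul]
        gcongr

end Gen
end NegFlow

namespace NegFlow

/-! ### The cycles of the graph of a formula -/

theorem sum_map_ite_eq_of_nodup {α : Type} [DecidableEq α] {l : List α} (hl : l.Nodup) (a : α)
    (x : ℚ) : (l.map fun e => if e = a then x else 0).sum = if a ∈ l then x else 0 := by
  rw [← List.sum_toFinset _ hl, Finset.sum_ite_eq']
  simp

/-- The differences of a potential cancel along a cycle, so the weights on it may be compared up to
such differences. -/
theorem IsCyc.sum_le_sum {α V : Type} {src tgt : α → V} {l : List α} (h : IsCyc src tgt l)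
    {f g : α → ℚ} (π : V → ℚ) (hfg : ∀ e ∈ l, g e ≤ f e + π (tgt e) - π (src e)) :
    (l.map g).sum ≤ (l.map f).sum := by
  have h1 := List.sum_le_sum hfg
  have h2 : ∀ l : List α, (l.map fun e => f e + π (tgt e) - π (src e)).sum =
      (l.map f).sum + (l.map fun e => π (tgt e)).sum - (l.map fun e => π (src e)).sum := by
    intro l
    induction l with
    | nil => simp
    | cons a l ih => simp only [List.map_cons, List.sum_cons, ih]; ring
  rw [h2, h.sum_src π] at h1
  linarith

/-- In the list of a cycle, an arc is followed by the one that ends at its tail. -/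
theorem IsCyc.exists_eq_cons {α V : Type} {src tgt : α → V} {h e f : α} {u v : List α}
    (hc : IsCyc src tgt (h :: (u ++ e :: v))) (hf : f ∈ u ++ e :: v) (hfe : tgt f = src e) :
    ∃ v', v = f :: v' := by
  have h1 := (isCyc_cons.1 hc).1
  have h2 : List.IsChain (fun e f => src e = tgt f) (e :: (v ++ [h])) :=
    h1.suffix ⟨h :: u, by simp⟩
  have hnd := hc.nodup
  cases v with
  | nil =>
    have h3 : src e = tgt h := by simpa using h2
    obtain rfl := hc.tgt_inj (List.mem_cons_of_mem _ hf) (by simp) (hfe.trans h3)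
    exact absurd hf (List.nodup_cons.1 hnd).1
  | cons g v =>
    have h3 : src e = tgt g := (List.isChain_cons_cons.1 h2).1
    obtain rfl := hc.tgt_inj (List.mem_cons_of_mem _ hf) (by simp) (hfe.trans h3)
    exact ⟨v, rfl⟩

theorem isChain_replace {α V : Type} {src tgt : α → V} {a a' b b' : α} {l : List α}
    (h : List.IsChain (fun e f => src e = tgt f) (a :: (l ++ [b]))) (hl : l ≠ [])
    (ha : src a' = src a) (hb : tgt b' = tgt b) :
    List.IsChain (fun e f => src e = tgt f) (a' :: (l ++ [b'])) := by
  obtain ⟨x, l, rfl⟩ := List.exists_cons_of_ne_nil hl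
  rw [List.cons_append, List.isChain_cons_cons] at h ⊢
  refine ⟨ha.trans h.1, ?_⟩
  rw [← List.cons_append, List.isChain_append] at h ⊢
  obtain ⟨-, h1, -, h2⟩ := h
  refine ⟨h1, by simp, fun x hx y hy => ?_⟩
  obtain rfl : b' = y := by simpa using hy
  rw [hb]
  exact h2 x hx b (by simp)

namespace CNF

open Arc

variable {n m : ℕ} {φ : CNF n m}

section Incidence

variable (l : Literal n) (k : ℕ) (j : Fin (m + 1)) (o : Occ φ)

@[simp] theorem chainNode_ne_nodeA : chainNode φ l k ≠ .nodeA o := by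
  unfold chainNode; split_ifs <;> simp

@[simp] theorem chainNode_ne_nodeB : chainNode φ l k ≠ .nodeB o := by
  unfold chainNode; split_ifs <;> simp

@[simp] theorem clauseNode_ne_nodeA : clauseNode φ j ≠ .nodeA o := by
  cases j using Fin.cases <;> simp [clauseNode]

@[simp] theorem clauseNode_ne_nodeB : clauseNode φ j ≠ .nodeB o := by
  cases j using Fin.cases <;> simp [clauseNode]

variable {e : Arc φ} {o}

theorem arcTgt_eq_nodeA : arcTgt φ e = .nodeA o ↔ e = arcPA o ∨ e = arcBA o := by
  cases e <;> simp [arcTgt]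

theorem arcTgt_eq_nodeB : arcTgt φ e = .nodeB o ↔ e = arcAB o ∨ e = arcRB o := by
  cases e <;> simp [arcTgt]

theorem arcSrc_eq_nodeA : arcSrc φ e = .nodeA o ↔ e = arcAB o ∨ e = arcAS o := by
  cases e <;> simp [arcSrc]

theorem arcSrc_eq_nodeB : arcSrc φ e = .nodeB o ↔ e = arcBQ o ∨ e = arcBA o := by
  cases e <;> simp [arcSrc]

theorem arc_injective : Function.Injective fun e : Arc φ => (arcSrc φ e, arcTgt φ e) := by
  intro e f h
  obtain ⟨h1, h2⟩ := Prod.mk.inj h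
  cases e <;> cases f <;> simp [arcSrc, arcTgt] at h1 h2 ⊢ <;>
    first
    | exact h1
    | exact h2
    | exact absurd h1.symm (by simp)
    | exact absurd h2.symm (by simp)

end Incidence

/-- A potential that is constant on the variable part of the graph. The other arguments are the
values at the nodes between the clauses and at the inner vertices of the occurrences. -/
def potential (φ : CNF n m) (hub : Fin (m + 1) → ℚ) (α β : Occ φ → ℚ) : Vertex φ → ℚ
  | .varV _ => hub 0
  | .clauseV j => hub j.succ
  | .nodeA o => α o
  | .nodeB o => β o
  | .link _ _ _ => hub 0

section Potential

variable (hub : Fin (m + 1) → ℚ) (α β : Occ φ → ℚ)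

@[simp] theorem potential_chainNode (l : Literal n) (k : ℕ) :
    potential φ hub α β (chainNode φ l k) = hub 0 := by
  unfold chainNode; split_ifs <;> rfl

@[simp] theorem potential_clauseNode (j : Fin (m + 1)) :
    potential φ hub α β (clauseNode φ j) = hub j := by
  cases j using Fin.cases <;> rfl

@[simp] theorem potential_varV (i : Fin (n + 1)) : potential φ hub α β (.varV i) = hub 0 := rfl

@[simp] theorem potential_nodeA (o : Occ φ) : potential φ hub α β (.nodeA o) = α o := rfl

@[simp] theorem potential_nodeB (o : Occ φ) : potential φ hub α β (.nodeB o) = β o := rfl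

end Potential

/-- The simple directed cycles of the graph of a formula. -/
abbrev Cyc (φ : CNF n m) (C : List (Arc φ)) : Prop := IsCyc (arcSrc φ) (arcTgt φ) C

/-- The weight of a list of arcs. -/
def wt (C : List (Arc φ)) : ℚ := (C.map (arcWt φ)).sum

theorem cyc_pair (o : Occ φ) : Cyc φ [arcAB o, arcBA o] := by
  simp [isCyc_cons, arcSrc, arcTgt]

theorem wt_pair (o : Occ φ) : wt [arcAB o, arcBA o] = -1 := by
  norm_num [wt, arcWt]

namespace Cyc

variable {C : List (Arc φ)} (h : Cyc φ C)
include h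

/-- How a cycle may pass the two inner vertices of an occurrence. -/
theorem passage (o : Occ φ) :
    (arcPA o ∈ C ∨ arcBA o ∈ C ↔ arcAB o ∈ C ∨ arcAS o ∈ C) ∧
    (arcAB o ∈ C ∨ arcRB o ∈ C ↔ arcBQ o ∈ C ∨ arcBA o ∈ C) ∧
    ¬ (arcPA o ∈ C ∧ arcBA o ∈ C) ∧ ¬ (arcAB o ∈ C ∧ arcAS o ∈ C) ∧
    ¬ (arcAB o ∈ C ∧ arcRB o ∈ C) ∧ ¬ (arcBQ o ∈ C ∧ arcBA o ∈ C) := by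
  have hA : ∀ e ∈ C, arcTgt φ e = .nodeA o → arcAB o ∈ C ∨ arcAS o ∈ C := by
    intro e he h1
    obtain ⟨f, hf, h2⟩ := h.exists_succ he
    rcases arcSrc_eq_nodeA.1 (h2.trans h1) with rfl | rfl <;> tauto
  have hA' : ∀ e ∈ C, arcSrc φ e = .nodeA o → arcPA o ∈ C ∨ arcBA o ∈ C := by
    intro e he h1
    obtain ⟨f, hf, h2⟩ := h.exists_pred he
    rcases arcTgt_eq_nodeA.1 (h2.trans h1) with rfl | rfl <;> tauto
  have hB : ∀ e ∈ C, arcTgt φ e = .nodeB o → arcBQ o ∈ C ∨ arcBA o ∈ C := by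
    intro e he h1
    obtain ⟨f, hf, h2⟩ := h.exists_succ he
    rcases arcSrc_eq_nodeB.1 (h2.trans h1) with rfl | rfl <;> tauto
  have hB' : ∀ e ∈ C, arcSrc φ e = .nodeB o → arcAB o ∈ C ∨ arcRB o ∈ C := by
    intro e he h1
    obtain ⟨f, hf, h2⟩ := h.exists_pred he
    rcases arcTgt_eq_nodeB.1 (h2.trans h1) with rfl | rfl <;> tauto
  refine ⟨⟨?_, ?_⟩, ⟨?_, ?_⟩, fun h1 => ?_, fun h1 => ?_, fun h1 => ?_, fun h1 => ?_⟩
  · rintro (h1 | h1) <;> exact hA _ h1 rfl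
  · rintro (h1 | h1) <;> exact hA' _ h1 rfl
  · rintro (h1 | h1) <;> exact hB _ h1 rfl
  · rintro (h1 | h1) <;> exact hB' _ h1 rfl
  · cases h.tgt_inj h1.1 h1.2 rfl
  · cases h.src_inj h1.1 h1.2 rfl
  · cases h.tgt_inj h1.1 h1.2 rfl
  · cases h.src_inj h1.1 h1.2 rfl

theorem mem_iff_pair {o : Occ φ} (h1 : arcAB o ∈ C) (h2 : arcBA o ∈ C) (e : Arc φ) :
    e ∈ C ↔ e = arcAB o ∨ e = arcBA o := by
  rw [← h.mem_iff_of_subset (cyc_pair o) (by simp [h1, h2]) e]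
  simp

section Long

variable (hlong : ∀ o, ¬ (arcAB o ∈ C ∧ arcBA o ∈ C))
include hlong

theorem back_mem_of_neg (hw : wt C < 0) : back ∈ C ∧ ∀ o, ¬ (arcPA o ∈ C ∧ arcAS o ∈ C) := by
  classical
  set π := potential φ (fun _ => 0) (fun o => if arcPA o ∈ C then -1 / 2 else 1 / 2) (fun _ => 0)
    with hπ
  -- with this potential the reduced weight is negative on no arc of the cycle but `back`
  have hred : ∀ e ∈ C, (e ≠ back → 0 ≤ arcWt φ e + π (arcTgt φ e) - π (arcSrc φ e)) ∧
      (-1 ≤ arcWt φ e + π (arcTgt φ e) - π (arcSrc φ e)) ∧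
      (∀ o, arcPA o ∈ C → e = arcAS o → 1 ≤ arcWt φ e + π (arcTgt φ e) - π (arcSrc φ e)) := by
    intro e he
    have hpass := h.passage
    cases e with
    | arcPA o => norm_num [hπ, arcSrc, arcTgt, arcWt, he]; simp
    | arcAB o =>
      have : arcPA o ∈ C := by have := hpass o; have := hlong o; tauto
      norm_num [hπ, arcSrc, arcTgt, arcWt, this]; simp
    | arcBQ o => norm_num [hπ, arcSrc, arcTgt, arcWt]; simp
    | arcRB o => norm_num [hπ, arcSrc, arcTgt, arcWt]; simp
    | arcBA o =>
      have : arcPA o ∉ C := by have := hpass o; tauto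
      norm_num [hπ, arcSrc, arcTgt, arcWt, this]; simp
    | arcAS o =>
      by_cases hPA : arcPA o ∈ C
      · norm_num [hπ, arcSrc, arcTgt, arcWt, hPA]
      · norm_num [hπ, arcSrc, arcTgt, arcWt, hPA]
        rintro o' ho' rfl
        exact hPA ho'
    | back => norm_num [hπ, arcSrc, arcTgt, arcWt]; simp
  constructor
  · by_contra hb
    have := h.sum_le_sum (f := arcWt φ) (g := fun _ => 0) π fun e he =>
      (hred e he).1 fun h' => hb (h' ▸ he)
    rw [List.sum_map_zero] at this
    exact absurd hw (not_lt.2 this)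
  · rintro o ⟨h1, h2⟩
    have := h.sum_le_sum (f := arcWt φ)
      (g := fun e => (if e = arcAS o then 1 else 0) + if e = back then -1 else 0) π fun e he => by
        obtain ⟨h3, h4, h5⟩ := hred e he
        by_cases he1 : e = back
        · rw [if_neg (by simp [he1]), if_pos he1, zero_add]; exact h4
        · rw [if_neg he1, add_zero]
          split_ifs with he2
          · exact h5 o h1 he2
          · exact h3 he1
    rw [List.sum_map_add, sum_map_ite_eq_of_nodup h.nodup, sum_map_ite_eq_of_nodup h.nodup,
      if_pos h2] at this
    change _ ≤ wt C at this
    split_ifs at this <;> linarith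

section Neg

variable (hw : wt C < 0)
include hw

theorem passage_of_neg (o : Occ φ) : (arcPA o ∈ C ↔ arcAB o ∈ C) ∧ (arcBA o ∈ C ↔ arcAS o ∈ C) ∧
    (arcAB o ∈ C → arcBQ o ∈ C ∧ arcRB o ∉ C) ∧ (arcAS o ∈ C → arcRB o ∈ C ∧ arcAB o ∉ C) := by
  have := (h.back_mem_of_neg hlong hw).2 o
  have := h.passage o
  have := hlong o
  grind

/-- A path from the clause part to the variable part within an occurrence would be a second one,
besides the arc `back`, while a cycle goes only once from the variable part to the clause part. -/
theorem not_mem_of_neg (o : Occ φ) : ¬ (arcRB o ∈ C ∧ arcBQ o ∈ C) := by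
  classical
  rintro ⟨hRB, hBQ⟩
  have hback := (h.back_mem_of_neg hlong hw).1
  have hpass := h.passage_of_neg hlong hw
  set π := potential φ (fun j => if j = 0 then 1 else 0) (fun o => if arcPA o ∈ C then 1 else 0)
    (fun o => if arcPA o ∈ C then 1 else 0) with hπ
  have hm : Fin.last m ≠ 0 := fun h0 => by
    have := o.1.1.2
    have := congrArg Fin.val h0
    simp at this
    omega
  obtain ⟨o₀, ho₀⟩ : ∃ o₀, ∀ o', arcRB o' ∈ C → o'.1.1.castSucc = 0 → o' = o₀ := by
    by_cases hex : ∃ o₀, arcRB o₀ ∈ C ∧ o₀.1.1.castSucc = 0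
    · obtain ⟨o₀, h1, h2⟩ := hex
      refine ⟨o₀, fun o' h3 h4 => ?_⟩
      have := h.src_inj h3 h1 (by simp only [arcSrc, h2, h4])
      simpa using this
    · exact ⟨o, fun o' h1 h2 => absurd ⟨o', h1, h2⟩ hex⟩
  have hred : ∀ e ∈ C, (e ≠ arcRB o₀ → 0 ≤ π (arcTgt φ e) - π (arcSrc φ e)) ∧
      (-1 ≤ π (arcTgt φ e) - π (arcSrc φ e)) ∧
      (e = arcBQ o ∨ e = back → 1 ≤ π (arcTgt φ e) - π (arcSrc φ e)) := by
    intro e he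
    cases e with
    | arcPA o' => simp [hπ, arcSrc, arcTgt, he]
    | arcAB o' => simp [hπ, arcSrc, arcTgt]
    | arcBQ o' =>
      simp only [hπ, arcSrc, arcTgt, potential_chainNode, potential_nodeB, if_true]
      refine ⟨fun _ => by split_ifs <;> simp, by split_ifs <;> simp, fun h1 => ?_⟩
      obtain rfl : o' = o := by simpa using h1
      rw [if_neg (by have := hpass o'; tauto)]
      simp
    | arcRB o' =>
      have h1 : arcPA o' ∉ C := by have := hpass o'; tauto
      simp only [hπ, arcSrc, arcTgt, potential_clauseNode, potential_nodeB, if_neg h1]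
      refine ⟨fun h2 => ?_, by split_ifs <;> simp, by simp⟩
      rw [if_neg fun h3 => h2 (by rw [ho₀ o' he h3])]
      simp
    | arcBA o' => simp [hπ, arcSrc, arcTgt]
    | arcAS o' =>
      have h1 : arcPA o' ∉ C := by have := hpass o'; tauto
      simp [hπ, arcSrc, arcTgt, h1]
    | back => simp [hπ, arcSrc, arcTgt, hm]
  have := h.sum_le_sum (f := fun _ => 0) (g := fun e => (if e = arcBQ o then 1 else 0) +
    ((if e = back then 1 else 0) + if e = arcRB o₀ then -1 else 0)) π fun e he => by
      obtain ⟨h1, h2, h3⟩ := hred e he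
      rw [zero_add]
      by_cases he1 : e = arcRB o₀
      · rw [if_neg (by simp [he1]), if_neg (by simp [he1]), if_pos he1, zero_add, zero_add]
        exact h2
      · rw [if_neg he1, add_zero]
        by_cases he2 : e = back
        · rw [if_neg (by simp [he2]), if_pos he2, zero_add]; exact h3 (.inr he2)
        · rw [if_neg he2, add_zero]
          split_ifs with he3
          · exact h3 (.inl he3)
          · exact h1 he1
  rw [List.sum_map_add, List.sum_map_add, sum_map_ite_eq_of_nodup h.nodup,
    sum_map_ite_eq_of_nodup h.nodup, sum_map_ite_eq_of_nodup h.nodup, if_pos hBQ, if_pos hback,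
    List.sum_map_zero] at this
  split_ifs at this <;> linarith

/-- A cycle of negative weight goes through the gadgets of all clauses. -/
theorem exists_occ_of_neg (k : Fin m) : ∃ o : Occ φ, o.1.1 = k ∧ arcAS o ∈ C := by
  classical
  by_contra! hno
  have hback := (h.back_mem_of_neg hlong hw).1
  have hpass := h.passage_of_neg hlong hw
  have hRBQ := h.not_mem_of_neg hlong hw
  set hub : Fin (m + 1) → ℚ := fun i => if i ≤ k.castSucc then 1 else 0 with hhub
  have h0 : hub 0 = 1 := if_pos (Fin.zero_le _)
  have hm : hub (Fin.last m) = 0 := if_neg (by simp)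
  have hj : ∀ j : Fin m, j ≠ k → hub j.succ = hub j.castSucc := by
    intro j hj
    have : j.1 ≠ k.1 := fun h => hj (Fin.ext h)
    simp only [hhub, Fin.le_def, Fin.val_succ, Fin.val_castSucc]
    congr 1
    rw [eq_iff_iff]
    omega
  set π := potential φ hub (fun o => if arcRB o ∈ C then hub o.1.1.castSucc else 1)
    (fun o => if arcRB o ∈ C then hub o.1.1.castSucc else 1) with hπ
  have := h.sum_le_sum (f := fun _ => 0) (g := fun e => if e = back then 1 else 0) π fun e he => by
    cases e with
    | arcPA o' =>
      have h1 : arcRB o' ∉ C := by have := hpass o'; tauto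
      simp [hπ, arcSrc, arcTgt, h0, h1]
    | arcAB o' => simp [hπ, arcSrc, arcTgt]
    | arcBQ o' =>
      have h1 : arcRB o' ∉ C := by have := hRBQ o'; tauto
      simp [hπ, arcSrc, arcTgt, h0, h1]
    | arcRB o' => simp [hπ, arcSrc, arcTgt, he]
    | arcBA o' => simp [hπ, arcSrc, arcTgt]
    | arcAS o' =>
      have h1 : arcRB o' ∈ C := by have := hpass o'; tauto
      simp [hπ, arcSrc, arcTgt, h1, hj o'.1.1 fun h2 => hno o' h2 he]
    | back => simp [hπ, arcSrc, arcTgt, h0, hm]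
  rw [sum_map_ite_eq_of_nodup h.nodup, if_pos hback, List.sum_map_zero] at this
  norm_num at this

theorem mem_iff_back (hno : ∀ o, arcAB o ∉ C) (e : Arc φ) : e ∈ C ↔ e = back := by
  have hback := (h.back_mem_of_neg hlong hw).1
  have hpass := h.passage_of_neg hlong hw
  refine ⟨h.forall_of_mem (P := fun e => e = back) (fun e he f hf hfe he' => ?_) hback rfl e,
    fun he => he ▸ hback⟩
  rw [he'] at hfe
  cases f with
  | arcPA o => exact absurd ((hpass o).1.1 hf) (hno o)
  | arcAB o => exact absurd hf (hno o)
  | arcBQ o => simp [arcSrc, arcTgt] at hfe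
  | arcRB o =>
    -- the gadgets of the clauses start at the first variable only if there is no variable
    exfalso
    have hn := o.1.2.1.2
    simp only [arcSrc, arcTgt] at hfe
    generalize o.1.1.castSucc = j at hfe
    cases j using Fin.cases with
    | zero =>
      have := congrArg Fin.val (Vertex.varV.inj hfe)
      simp at this
      omega
    | succ j => simp [clauseNode] at hfe
  | arcBA o => simp [arcSrc, arcTgt] at hfe
  | arcAS o => simp [arcSrc, arcTgt] at hfe
  | back => rfl

end Neg

end Long

end Cyc

end CNF
end NegFlow

namespace NegFlow
namespace CNF

open Arc

variable {n m : ℕ} {φ : CNF n m}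

namespace Cyc

/-- The union of a cycle `Z` and the cycle of the arcs `a → b`, `b → a` of an occurrence contains no
third cycle, unless `Z` contains the four outer arcs of the occurrence. -/
theorem eq_or_eq_of_subset {Z : List (Arc φ)} (hZ : Cyc φ Z) {o : Occ φ}
    (ho : ¬ (arcPA o ∈ Z ∧ arcAS o ∈ Z ∧ arcRB o ∈ Z ∧ arcBQ o ∈ Z)) {l : List (Arc φ)}
    (hl : Cyc φ l) (hs : ∀ e ∈ l, e ∈ [arcAB o, arcBA o] ∨ e ∈ Z) :
    (∀ e, e ∈ l ↔ e ∈ [arcAB o, arcBA o]) ∨ ∀ e, e ∈ l ↔ e ∈ Z := by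
  by_cases hp : arcAB o ∈ l ∧ arcBA o ∈ l
  · left
    simpa using hl.mem_iff_pair hp.1 hp.2
  right
  refine fun e => hZ.mem_iff_of_subset hl (fun e he => ?_) e
  have h1 := hl.passage o
  have h2 := hZ.passage o
  have hPA := hs (arcPA o)
  have hAS := hs (arcAS o)
  have hRB := hs (arcRB o)
  have hBQ := hs (arcBQ o)
  simp only [List.mem_cons, List.not_mem_nil, or_false, reduceCtorEq, false_or] at hPA hAS hRB hBQ
  rcases hs e he with h | h
  · rcases (by simpa using h : e = arcAB o ∨ e = arcBA o) with rfl | rfl <;> grind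
  · exact h

/-- There are at most two cycles that contain the four outer arcs of all occurrences. -/
theorem mem_iff_of_outer {Z Z' : List (Arc φ)} (hZ : Cyc φ Z) (hZ' : Cyc φ Z')
    (h : ∀ o, arcPA o ∈ Z ∧ arcAS o ∈ Z ∧ arcRB o ∈ Z ∧ arcBQ o ∈ Z)
    (h' : ∀ o, arcPA o ∈ Z' ∧ arcAS o ∈ Z' ∧ arcRB o ∈ Z' ∧ arcBQ o ∈ Z')
    (hb : back ∈ Z ↔ back ∈ Z') (e : Arc φ) : e ∈ Z ↔ e ∈ Z' := by
  cases e with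
  | back => exact hb
  | arcPA o => simp [h o, h' o]
  | arcAS o => simp [h o, h' o]
  | arcRB o => simp [h o, h' o]
  | arcBQ o => simp [h o, h' o]
  | arcAB o =>
    have := hZ.passage o; have := hZ'.passage o; have := h o; have := h' o
    grind
  | arcBA o =>
    have := hZ.passage o; have := hZ'.passage o; have := h o; have := h' o
    grind

/-- A cycle of negative weight that passes the arc `a → b` of an occurrence `o` and the path
`r → b → a → s` of an occurrence `o'` in the same clause is cut at these places into two segments,
which are closed to cycles by the arcs `r → b` and `a → s` of `o`. -/
theorem exists_split {C : List (Arc φ)} (h : Cyc φ C)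
    (hlong : ∀ o, ¬ (arcAB o ∈ C ∧ arcBA o ∈ C)) (hw : wt C < 0) {o : Occ φ} (ho : arcAB o ∈ C) :
    ∃ (o' : Occ φ) (P₁ P₂ : List (Arc φ)), Cyc φ (arcRB o :: P₁) ∧ 0 ≤ wt (arcRB o :: P₁) ∧
      P₁ <:+: C ++ C ∧ Cyc φ (arcAS o :: P₂) ∧ 0 ≤ wt (arcAS o :: P₂) ∧ P₂ <:+: C ++ C ∧
      ∀ e, e ∈ C ↔ ((e ∈ arcRB o :: P₁ ∨ e ∈ arcAS o :: P₂) ∧ e ≠ arcRB o ∧ e ≠ arcAS o) ∨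
        e ∈ [arcAB o, arcAS o', arcBA o', arcRB o'] := by
  obtain ⟨o', ho', hAS'⟩ := h.exists_occ_of_neg hlong hw o.1.1
  have hpass := h.passage_of_neg hlong hw
  have hBA' := (hpass o').2.1.2 hAS'
  have hRB' := ((hpass o').2.2.2 hAS').1
  obtain ⟨hBQ, hRB⟩ := (hpass o).2.2.1 ho
  have hBA : arcBA o ∉ C := fun h' => hlong o ⟨ho, h'⟩
  have hAS : arcAS o ∉ C := fun h' => hBA ((hpass o).2.1.2 h')
  -- a cycle that passes `r → b → q` or `p → a → s` of an occurrence has weight `≥ 0`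
  have hnonneg : ∀ Z : List (Arc φ), Cyc φ Z →
      (arcRB o ∈ Z ∧ arcBQ o ∈ Z ∨ arcPA o ∈ Z ∧ arcAS o ∈ Z) → 0 ≤ wt Z := by
    intro Z hZ hm
    by_contra! hneg
    by_cases hlongZ : ∀ o, ¬ (arcAB o ∈ Z ∧ arcBA o ∈ Z)
    · rcases hm with hm | hm
      · exact hZ.not_mem_of_neg hlongZ hneg o hm
      · exact (hZ.back_mem_of_neg hlongZ hneg).2 o hm
    · push Not at hlongZ
      obtain ⟨o₁, h1, h2⟩ := hlongZ
      have := hZ.mem_iff_pair h1 h2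
      rcases hm with hm | hm
      · simpa using (this _).1 hm.1
      · simpa using (this _).1 hm.1
  obtain ⟨X, Y, rfl⟩ := List.append_of_mem ho
  have hC := h.rotate
  rw [List.cons_append] at hC
  have hmem : ∀ e, e ∈ X ++ arcAB o :: Y ↔ e = arcAB o ∨ e ∈ Y ++ X := by
    intro e; simp only [List.mem_append, List.mem_cons]; tauto
  have hsub : Y ++ X <:+: (X ++ arcAB o :: Y) ++ (X ++ arcAB o :: Y) :=
    ⟨X ++ [arcAB o], arcAB o :: Y, by simp⟩
  set t := Y ++ X with ht
  have hAS't : arcAS o' ∈ t := by simpa using (hmem _).1 hAS'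
  have hBA't : arcBA o' ∈ t := by simpa using (hmem _).1 hBA'
  have hRB't : arcRB o' ∈ t := by simpa using (hmem _).1 hRB'
  obtain ⟨L₃, v, hv⟩ := List.append_of_mem hAS't
  clear_value t
  subst hv
  obtain ⟨v, rfl⟩ := hC.exists_eq_cons hBA't rfl
  have hC' : Cyc φ (arcAB o :: ((L₃ ++ [arcAS o']) ++ arcBA o' :: v)) := by simpa using hC
  obtain ⟨L₁, rfl⟩ := hC'.exists_eq_cons (f := arcRB o') (by simpa using hRB't) rfl
  obtain ⟨hch, hnd⟩ := isCyc_cons.1 hC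
  have hs₁ : arcSrc φ (arcRB o) = arcSrc φ (arcRB o') := by simp only [arcSrc, ho']
  have hs₂ : arcTgt φ (arcAS o) = arcTgt φ (arcAS o') := by simp only [arcTgt, ho']
  have hc₁ : List.IsChain (fun e f => arcSrc φ e = arcTgt φ f) (arcRB o' :: (L₁ ++ [arcAB o])) :=
    hch.suffix ⟨arcAB o :: (L₃ ++ [arcAS o', arcBA o']), by simp⟩
  have hc₂ : List.IsChain (fun e f => arcSrc φ e = arcTgt φ f) (arcAB o :: (L₃ ++ [arcAS o'])) :=
    hch.prefix ⟨arcBA o' :: arcRB o' :: (L₁ ++ [arcAB o]), by simp⟩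
  have hne₁ : L₁ ≠ [] := by
    rintro rfl
    have h1 : arcSrc φ (arcRB o') = arcTgt φ (arcAB o) := by simpa using hc₁
    exact clauseNode_ne_nodeB _ _ h1
  have hne₂ : L₃ ≠ [] := by
    rintro rfl
    have h1 : arcSrc φ (arcAB o) = arcTgt φ (arcAS o') := by simpa using hc₂
    exact clauseNode_ne_nodeA _ _ h1.symm
  have hZ₁ : Cyc φ (arcRB o :: L₁) := by
    refine isCyc_cons.2 ⟨isChain_replace hc₁ hne₁ hs₁ rfl, ?_⟩
    rw [List.map_cons, hs₁, ← List.map_cons]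
    refine hnd.sublist (List.Sublist.map _ (List.IsSuffix.sublist ?_))
    exact ⟨arcAB o :: (L₃ ++ [arcAS o', arcBA o']), by simp⟩
  have hZ₂ : Cyc φ (arcAS o :: L₃) := by
    refine isCyc_cons.2 ⟨isChain_replace hc₂ hne₂ rfl hs₂, ?_⟩
    change ((arcAB o :: L₃).map (arcSrc φ)).Nodup
    exact hnd.sublist (List.Sublist.map _ (List.IsPrefix.sublist ⟨_, rfl⟩))
  have hm₁ : ∀ e ∈ L₁, e ∈ X ++ arcAB o :: Y := fun e he => (hmem e).2 (.inr (by simp [he]))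
  have hm₂ : ∀ e ∈ L₃, e ∈ X ++ arcAB o :: Y := fun e he => (hmem e).2 (.inr (by simp [he]))
  refine ⟨o', L₁, L₃, hZ₁, hnonneg _ hZ₁ (.inl ⟨by simp, ?_⟩), ?_, hZ₂,
    hnonneg _ hZ₂ (.inr ⟨?_, by simp⟩), ?_, fun e => ?_⟩
  · have := hZ₁.passage o
    have h1 : arcBA o ∉ arcRB o :: L₁ := by
      simpa using fun h' => hBA (hm₁ _ h')
    have h2 : arcRB o ∈ arcRB o :: L₁ := by simp
    grind
  · exact List.IsInfix.trans ⟨L₃ ++ [arcAS o', arcBA o', arcRB o'], [], by simp⟩ hsub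
  · have := hZ₂.passage o
    have h1 : arcBA o ∉ arcAS o :: L₃ := by
      simpa using fun h' => hBA (hm₂ _ h')
    have h2 : arcAS o ∈ arcAS o :: L₃ := by simp
    grind
  · exact List.IsInfix.trans ⟨[], arcAS o' :: arcBA o' :: arcRB o' :: L₁, by simp⟩ hsub
  · have h1 : e ∈ X ++ arcAB o :: Y → e ≠ arcRB o ∧ e ≠ arcAS o :=
      fun he => ⟨fun h' => hRB (h' ▸ he), fun h' => hAS (h' ▸ he)⟩
    have h2 : e ∈ X ++ arcAB o :: Y ↔
        e ∈ L₁ ∨ e ∈ L₃ ∨ e ∈ [arcAB o, arcAS o', arcBA o', arcRB o'] := by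
      rw [hmem]
      simp only [List.mem_append, List.mem_cons, List.not_mem_nil, or_false]
      tauto
    rw [h2] at h1
    rw [h2, List.mem_cons (l := L₁), List.mem_cons (l := L₃)]
    constructor
    · rintro (h3 | h3 | h3)
      · exact .inl ⟨.inl (.inr h3), h1 (.inl h3)⟩
      · exact .inl ⟨.inr (.inr h3), h1 (.inr (.inl h3))⟩
      · exact .inr h3
    · rintro (⟨(h3 | h3) | h3 | h3, h4, h5⟩ | h3)
      · exact absurd h3 h4
      · exact .inl h3
      · exact absurd h3 h5
      · exact .inr (.inl h3)
      · exact .inr (.inr h3)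

end Cyc
end CNF
end NegFlow

namespace NegFlow

/-! ### The number of cycles found and the number of vectors written -/

namespace WDigraph

open CNF CNF.Arc

variable {G : WDigraph} {n m : ℕ} {φ : CNF n m}

/-- A numbering of the vertices and arcs that makes `G` the graph of `φ`. -/
structure Numbering (G : WDigraph) (φ : CNF n m) where
  /-- the vertex with a given number -/
  vertex : Fin G.nV ≃ Vertex φ
  /-- the arc with a given number -/
  arc : Fin G.nE ≃ Arc φ
  src_eq : ∀ e, vertex (G.src e) = arcSrc φ (arc e)
  tgt_eq : ∀ e, vertex (G.tgt e) = arcTgt φ (arc e)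
  wt_eq : ∀ e, G.wt e = arcWt φ (arc e)

theorem IsGraphOf.nonempty_numbering (h : G.IsGraphOf φ) : Nonempty (Numbering G φ) := by
  obtain ⟨fV, fE, hf⟩ := h
  exact ⟨⟨fV, fE, fun e => (hf e).1, fun e => (hf e).2.1, fun e => (hf e).2.2⟩⟩

namespace Numbering

variable (N : Numbering G φ)
include N

theorem tidy : G.Tidy where
  inj e f h := by
    have h1 := (Prod.mk.inj (Prod.mk.inj h).1)
    apply N.arc.injective
    apply arc_injective
    rw [Prod.mk.injEq, ← N.src_eq, ← N.src_eq, ← N.tgt_eq, ← N.tgt_eq, Fin.ext h1.1, Fin.ext h1.2]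
    exact ⟨rfl, rfl⟩
  half e := by
    rw [N.wt_eq]
    cases N.arc e <;> simp [arcWt] <;> norm_num

theorem cyc_map {L : List (Fin G.nE)} : CNF.Cyc φ (L.map N.arc) ↔ G.Cyc L :=
  isCyc_map N.vertex.injective (fun e => (N.src_eq e).symm) fun e => (N.tgt_eq e).symm

theorem weight_eq {L : List (Fin G.nE)} (hL : G.Cyc L) :
    G.weight (G.chi L) = (CNF.wt (L.map N.arc) : ℝ) := by
  rw [weight_chi hL.nodup, CNF.wt, List.map_map]
  simp only [N.wt_eq]
  clear hL
  induction L with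
  | nil => simp
  | cons e L ih => simp [ih]

/-- A list of arcs of the graph of the formula as a list of arcs of `G`. -/
def pull (Z : List (Arc φ)) : List (Fin G.nE) := Z.map N.arc.symm

@[simp] theorem map_pull (Z : List (Arc φ)) : (N.pull Z).map N.arc = Z := by simp [pull]

theorem pull_map (L : List (Fin G.nE)) : N.pull (L.map N.arc) = L := by simp [pull]

theorem mem_pull {Z : List (Arc φ)} {e : Fin G.nE} : e ∈ N.pull Z ↔ N.arc e ∈ Z := by
  simp [pull, Equiv.symm_apply_eq]

theorem cyc_pull {Z : List (Arc φ)} : G.Cyc (N.pull Z) ↔ CNF.Cyc φ Z := by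
  rw [← N.cyc_map, map_pull]

theorem weight_pull {Z : List (Arc φ)} (hZ : CNF.Cyc φ Z) :
    G.weight (G.chi (N.pull Z)) = (CNF.wt Z : ℝ) := by
  rw [N.weight_eq (N.cyc_pull.2 hZ), map_pull]

theorem mem_map_arc {L : List (Fin G.nE)} {e : Fin G.nE} : N.arc e ∈ L.map N.arc ↔ e ∈ L :=
  List.mem_map_of_injective N.arc.injective

/-- A graph of a formula that has a cycle has a cycle of negative weight. -/
theorem polyhedron_nonempty {L : List (Fin G.nE)} (hL : G.Cyc L) : G.polyhedron.Nonempty := by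
  obtain ⟨L', hL', hw⟩ : ∃ L', G.Cyc L' ∧ G.weight (G.chi L') < 0 := by
    by_cases hocc : Nonempty (Occ φ)
    · obtain ⟨o⟩ := hocc
      refine ⟨N.pull [arcAB o, arcBA o], N.cyc_pull.2 (cyc_pair o), ?_⟩
      rw [N.weight_pull (cyc_pair o), wt_pair]
      norm_num
    · refine ⟨L, hL, ?_⟩
      have hback : ∀ a ∈ L.map (arcWt φ ∘ N.arc), a = -1 := by
        intro a ha
        obtain ⟨e, he, rfl⟩ := List.mem_map.1 ha
        rw [Function.comp_apply]
        cases N.arc e with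
        | back => rfl
        | _ o => exact absurd ⟨o⟩ hocc
      rw [N.weight_eq hL, CNF.wt, List.map_map, List.eq_replicate_of_mem hback, List.sum_replicate]
      have := List.length_pos_of_ne_nil hL.1
      simpa using this
  exact ⟨_, (mem_verts_iff.2 ⟨L', hL', hw, rfl⟩).1⟩

section Count

open Classical

variable (K : List (List Gen.A))

omit N in
/-- The sets of the arcs of the derived cycles of weight `≥ 0`. -/
noncomputable def nonnegSets (G : WDigraph) (K : List (List Gen.A)) : Finset (Finset (Fin G.nE)) :=
  Finset.univ.filter fun S => ∃ L, G.Cyc L ∧ 0 ≤ G.weight (G.chi L) ∧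
    L.map G.arc ∈ Gen.closure G.arcs K ∧ L.toFinset = S

/-- Each derived cycle of weight `≥ 0` gives rise to an extreme direction that determines it: by
itself if its weight is zero, and otherwise together with the two arcs between the inner vertices of
an occurrence. Excepted are the cycles that contain the outer arcs of all occurrences, of which there
are at most two. -/
theorem card_nonnegSets_le {M : List Gen.Out}
    (hM : ∀ o ∈ Gen.dirVecs G.arcs (Gen.closure G.arcs K), o ∈ M) :
    (nonnegSets G K).card ≤ M.length + 2 := by
  set p : Finset (Fin G.nE) → Prop := fun S => ∀ o : Occ φ, N.arc.symm (arcPA o) ∈ S ∧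
    N.arc.symm (arcAS o) ∈ S ∧ N.arc.symm (arcRB o) ∈ S ∧ N.arc.symm (arcBQ o) ∈ S with hp
  have hmem : ∀ (L : List (Fin G.nE)) (a : Arc φ), N.arc.symm a ∈ L.toFinset ↔ a ∈ L.map N.arc := by
    intro L a
    rw [List.mem_toFinset, ← N.mem_map_arc, Equiv.apply_symm_apply]
  have htf : ∀ {L L' : List (Fin G.nE)}, (∀ e, e ∈ L ↔ e ∈ L') → L.toFinset = L'.toFinset :=
    fun h => by ext e; simpa using h e
  rw [← Finset.card_filter_add_card_filter_not (s := nonnegSets G K) p, add_comm]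
  refine Nat.add_le_add ?_ ?_
  · refine le_trans ?_ (List.toFinset_card_le M)
    refine Finset.card_le_card_of_forall_subsingleton (fun S o =>
      (∃ L, G.Cyc L ∧ 0 ≤ G.weight (G.chi L) ∧ (∀ e ∈ L, G.val o e ≠ 0) ∧ L.toFinset = S) ∧
      ∀ L, G.Cyc L → 0 ≤ G.weight (G.chi L) → (∀ e ∈ L, G.val o e ≠ 0) → L.toFinset = S) ?_ ?_
    · intro S hS
      obtain ⟨hS, hpS⟩ := Finset.mem_filter.1 hS
      obtain ⟨-, L, hL, hw, hcl, rfl⟩ := Finset.mem_filter.1 hS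
      rcases hw.eq_or_lt with hw0 | hw0
      · refine ⟨_, List.mem_toFinset.2 (hM _ (N.tidy.zeroVec_mem hcl hL.nodup hw0.symm)), ?_⟩
        rw [N.tidy.val_zeroVec]
        have hsupp : ∀ e, ((L.length : ℝ)⁻¹ • G.chi L) e ≠ 0 ↔ e ∈ L := fun e => by
          rw [smul_ne_zero_iff (length_inv_pos hL).ne', chi_ne_zero_iff]
        simp only [hsupp]
        exact ⟨⟨L, hL, hw, fun e he => he, rfl⟩, fun L' hL' _ hs =>
          htf (hL.mem_iff_of_subset hL' hs)⟩
      · simp only [hp, not_forall, hmem] at hpS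
        obtain ⟨o, ho⟩ := hpS
        have hT := N.cyc_pull.2 (cyc_pair o)
        have hTw : G.weight (G.chi (N.pull [arcAB o, arcBA o])) < 0 := by
          rw [N.weight_pull (cyc_pair o), wt_pair]; norm_num
        have hno : G.NoThird (N.pull [arcAB o, arcBA o]) L := by
          intro l hl hs
          have := Cyc.eq_or_eq_of_subset (N.cyc_map.2 hL) ho (N.cyc_map.2 hl) fun a ha => by
            obtain ⟨e, he, rfl⟩ := List.mem_map.1 ha
            rw [N.mem_map_arc, ← N.mem_pull]
            exact hs e he
          refine this.imp (fun h e => ?_) fun h e => ?_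
          · rw [N.mem_pull, ← N.mem_map_arc, h]
          · rw [← N.mem_map_arc, h, N.mem_map_arc]
        have hTc : (N.pull [arcAB o, arcBA o]).map G.arc ∈ Gen.closure G.arcs K := by
          refine Gen.mem_closure.2 ⟨Tidy.isCyc_iff.2 hT, .inl (Gen.mem_pairsOf.2 ?_)⟩
          exact ⟨_, mem_arcs.2 ⟨_, rfl⟩, _, mem_arcs.2 ⟨_, rfl⟩, rfl⟩
        refine ⟨_, List.mem_toFinset.2 (hM _ (N.tidy.pairVec_mem hTc hcl hT hL hTw hw0 hno)), ?_⟩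
        rw [N.tidy.val_pairVec hT.nodup hL.nodup hTw hw0]
        simp only [smul_ne_zero_iff (pair_coeff_pos hT hTw hw0).ne', pairDir_ne_zero_iff hTw hw0]
        refine ⟨⟨L, hL, hw, fun e he => .inr he, rfl⟩, fun L' hL' hw' hs => ?_⟩
        rcases hno L' hL' hs with h | h
        · rw [chi_congr h] at hw'; linarith
        · exact htf h
    · rintro o - S ⟨-, ⟨L, hL, hw, hs, rfl⟩, -⟩ S' ⟨-, -, h⟩
      exact h L hL hw hs
  · refine (Finset.card_le_card_of_injOn (t := Finset.univ)
      (fun S => decide (N.arc.symm back ∈ S))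
      (fun _ _ => Finset.mem_coe.2 (Finset.mem_univ _)) ?_).trans (by simp)
    intro S hS S' hS' hb
    obtain ⟨hS, hpS⟩ := Finset.mem_filter.1 hS
    obtain ⟨hS', hpS'⟩ := Finset.mem_filter.1 hS'
    obtain ⟨-, L, hL, -, -, rfl⟩ := Finset.mem_filter.1 hS
    obtain ⟨-, L', hL', -, -, rfl⟩ := Finset.mem_filter.1 hS'
    simp only [hp, hmem] at hpS hpS'
    refine htf fun e => ?_
    rw [← N.mem_map_arc, ← N.mem_map_arc]
    refine Cyc.mem_iff_of_outer (N.cyc_map.2 hL) (N.cyc_map.2 hL') hpS hpS' ?_ _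
    rw [← hmem, ← hmem]
    simpa using hb

/-- The number of the cycles found is bounded by a polynomial in the number of the extreme
directions that come from them. -/
theorem length_le {M : List Gen.Out} (hnd : K.Nodup)
    (hK : ∀ C ∈ K, IsCyc Gen.src Gen.tgt C ∧ ∀ e ∈ C, e ∈ G.arcs)
    (hM : ∀ o ∈ Gen.dirVecs G.arcs (Gen.closure G.arcs K), o ∈ M) :
    K.length ≤ G.nE * ((M.length + 2) + G.nE + 1 +
      (M.length + 2) * (M.length + 2) * (G.nE * G.nE)) := by
  have hKL : ∀ C ∈ K, ∃ L, C = L.map G.arc ∧ G.Cyc L := by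
    intro C hC
    obtain ⟨L, rfl⟩ := exists_map_arc (hK C hC).2
    exact ⟨L, rfl, Tidy.isCyc_iff.1 (hK _ hC).1⟩
  set F : Finset (Finset (Fin G.nE)) :=
    Finset.univ.filter fun S => ∃ L : List (Fin G.nE), L.map G.arc ∈ K ∧ L.toFinset = S with hF
  -- a cycle is determined by its first arc and its set of arcs
  have h1 : K.length ≤ G.nE * F.card := by
    have h2 : ((Finset.univ : Finset (Fin G.nE)) ×ˢ F).card = G.nE * F.card := by
      rw [Finset.card_product, Finset.card_fin]
    rw [← List.toFinset_card_of_nodup hnd, ← h2]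
    refine Finset.card_le_card_of_forall_subsingleton
      (fun C x => ∃ L : List (Fin G.nE), C = (x.1 :: L).map G.arc ∧ (x.1 :: L).toFinset = x.2) ?_ ?_
    · intro C hC
      rw [List.mem_toFinset] at hC
      obtain ⟨L, rfl, hL⟩ := hKL C hC
      obtain ⟨e, L, rfl⟩ := List.exists_cons_of_ne_nil hL.1
      exact ⟨(e, (e :: L).toFinset), Finset.mem_product.2 ⟨Finset.mem_univ _,
        Finset.mem_filter.2 ⟨Finset.mem_univ _, _, hC, rfl⟩⟩, L, rfl, rfl⟩
    · rintro ⟨e, S⟩ - C ⟨hC, L, rfl, hLS⟩ C' ⟨hC', L', rfl, hLS'⟩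
      dsimp only at *
      have hL := Tidy.isCyc_iff.1 (hK _ (List.mem_toFinset.1 hC)).1
      have hL' := Tidy.isCyc_iff.1 (hK _ (List.mem_toFinset.1 hC')).1
      rw [hL.ext_of_cons hL' fun x => by
        rw [← List.mem_toFinset, ← List.mem_toFinset, hLS, hLS']]
  -- the two-arc cycles of the occurrences
  set P : Finset (Finset (Fin G.nE)) := Finset.univ.filter fun S =>
    ∃ o : Occ φ, S = (N.pull [arcAB o, arcBA o]).toFinset with hP
  have hPc : P.card ≤ G.nE := by
    conv_rhs => rw [← Finset.card_fin G.nE]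
    refine Finset.card_le_card_of_forall_subsingleton (fun S e =>
      ∃ o : Occ φ, N.arc e = arcAB o ∧ S = (N.pull [arcAB o, arcBA o]).toFinset) ?_ ?_
    · intro S hS
      obtain ⟨o, ho⟩ := (Finset.mem_filter.1 hS).2
      exact ⟨N.arc.symm (arcAB o), Finset.mem_univ _, o, by simp, ho⟩
    · rintro e - S ⟨-, o, ho, rfl⟩ S' ⟨-, o', ho', rfl⟩
      obtain rfl : o = o' := by simpa using ho.symm.trans ho'
      rfl
  have hN := N.card_nonnegSets_le K hM
  -- the sets that are determined by two derived cycles of weight `≥ 0` as in `Cyc.exists_split`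
  set Q : Finset (Finset (Fin G.nE)) := Finset.univ.filter fun S =>
    ∃ S₁ ∈ nonnegSets G K, ∃ S₂ ∈ nonnegSets G K, ∃ o o' : Occ φ, ∀ e, e ∈ S ↔
      ((e ∈ S₁ ∨ e ∈ S₂) ∧ N.arc e ≠ arcRB o ∧ N.arc e ≠ arcAS o) ∨
        N.arc e ∈ [arcAB o, arcAS o', arcBA o', arcRB o'] with hQ
  have hQc : Q.card ≤ (M.length + 2) * (M.length + 2) * (G.nE * G.nE) := by
    refine le_trans (b := ((nonnegSets G K ×ˢ nonnegSets G K) ×ˢ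
      ((Finset.univ : Finset (Fin G.nE)) ×ˢ (Finset.univ : Finset (Fin G.nE)))).card) ?_ ?_
    · refine Finset.card_le_card_of_forall_subsingleton (fun S x =>
        ∃ o o' : Occ φ, N.arc x.2.1 = arcAB o ∧ N.arc x.2.2 = arcAB o' ∧ ∀ e, e ∈ S ↔
        ((e ∈ x.1.1 ∨ e ∈ x.1.2) ∧ N.arc e ≠ arcRB o ∧ N.arc e ≠ arcAS o) ∨
          N.arc e ∈ [arcAB o, arcAS o', arcBA o', arcRB o']) ?_ ?_
      · intro S hS
        obtain ⟨S₁, h1, S₂, h2, o, o', h⟩ := (Finset.mem_filter.1 hS).2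
        exact ⟨((S₁, S₂), (N.arc.symm (arcAB o), N.arc.symm (arcAB o'))), by simp [h1, h2],
          o, o', by simp, by simp, h⟩
      · rintro x - S ⟨-, o₁, o₁', h1, h1', h⟩ S' ⟨-, o₂, o₂', h2, h2', h'⟩
        obtain rfl : o₁ = o₂ := by simpa using h1.symm.trans h2
        obtain rfl : o₁' = o₂' := by simpa using h1'.symm.trans h2'
        ext e
        rw [h, h']
    · rw [Finset.card_product, Finset.card_product, Finset.card_product, Finset.card_fin]
      gcongr
  have hsub : F ⊆ nonnegSets G K ∪ P ∪ {(N.pull [back]).toFinset} ∪ Q := by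
    intro S hS
    obtain ⟨L, hLK, rfl⟩ := (Finset.mem_filter.1 hS).2
    have hL := Tidy.isCyc_iff.1 (hK _ hLK).1
    have hC := N.cyc_map.2 hL
    simp only [Finset.mem_union]
    have hcl : L.map G.arc ∈ Gen.closure G.arcs K :=
      Gen.mem_closure.2 ⟨(hK _ hLK).1, .inr (.inl hLK)⟩
    rcases le_or_gt 0 (G.weight (G.chi L)) with hw | hw
    · exact .inl (.inl (.inl (Finset.mem_filter.2 ⟨Finset.mem_univ _, L, hL, hw, hcl, rfl⟩)))
    have hw' : CNF.wt (L.map N.arc) < 0 := by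
      rw [N.weight_eq hL] at hw
      exact_mod_cast hw
    -- a negative cycle is `back` alone, a pair `a → b`, `b → a`, or splits into two derived cycles
    by_cases hlong : ∀ o, ¬ (arcAB o ∈ L.map N.arc ∧ arcBA o ∈ L.map N.arc)
    · by_cases hAB : ∀ o, arcAB o ∉ L.map N.arc
      · refine .inl (.inr (Finset.mem_singleton.2 (Finset.ext fun e => ?_)))
        rw [List.mem_toFinset, List.mem_toFinset, N.mem_pull, ← N.mem_map_arc,
          hC.mem_iff_back hlong hw' hAB, List.mem_singleton]
      · push Not at hAB
        obtain ⟨o, ho⟩ := hAB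
        obtain ⟨o', P₁, P₂, hc₁, hw₁, hP₁, hc₂, hw₂, hP₂, hmem⟩ := hC.exists_split hlong hw' ho
        have key : ∀ (a : Arc φ) (P : List (Arc φ)), CNF.Cyc φ (a :: P) → 0 ≤ CNF.wt (a :: P) →
            P <:+: L.map N.arc ++ L.map N.arc →
            (N.pull (a :: P)).toFinset ∈ nonnegSets G K := by
          intro a P hc hw hP
          refine Finset.mem_filter.2 ⟨Finset.mem_univ _, _, N.cyc_pull.2 hc, ?_, ?_, rfl⟩
          · rw [N.weight_pull hc]; exact_mod_cast hw
          · refine Gen.mem_closure.2 ⟨Tidy.isCyc_iff.2 (N.cyc_pull.2 hc),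
              .inr (.inr ⟨_, hLK, Gen.mem_chords.2 ⟨(N.pull P).map G.arc, ?_, _,
                mem_arcs.2 ⟨_, rfl⟩, rfl⟩⟩)⟩
            have := (hP.map N.arc.symm).map G.arc
            rw [List.map_append] at this
            change (N.pull P).map G.arc <:+:
              (N.pull (L.map N.arc) ++ N.pull (L.map N.arc)).map G.arc at this
            rwa [N.pull_map, List.map_append] at this
        refine .inr (Finset.mem_filter.2 ⟨Finset.mem_univ _, _, key _ _ hc₁ hw₁ hP₁, _,
          key _ _ hc₂ hw₂ hP₂, o, o', fun e => ?_⟩)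
        rw [List.mem_toFinset, List.mem_toFinset, List.mem_toFinset, ← N.mem_map_arc, hmem,
          N.mem_pull, N.mem_pull]
    · push Not at hlong
      obtain ⟨o, h1, h2⟩ := hlong
      refine .inl (.inl (.inr (Finset.mem_filter.2 ⟨Finset.mem_univ _, o, Finset.ext fun e => ?_⟩)))
      rw [List.mem_toFinset, List.mem_toFinset, N.mem_pull, ← N.mem_map_arc,
        hC.mem_iff_pair h1 h2]
      simp
  have hFc : F.card ≤ (M.length + 2) + G.nE + 1 +
      (M.length + 2) * (M.length + 2) * (G.nE * G.nE) := by
    refine (Finset.card_le_card hsub).trans ((Finset.card_union_le _ _).trans ?_)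
    refine Nat.add_le_add ((Finset.card_union_le _ _).trans ?_) hQc
    refine Nat.add_le_add ((Finset.card_union_le _ _).trans ?_) (by simp)
    exact Nat.add_le_add hN hPc
  exact h1.trans (Nat.mul_le_mul_left _ hFc)

end Count

end Numbering
end WDigraph
end NegFlow

namespace NegFlow

open TreeCode (code)

/-! ### The enumeration of the extreme points and directions -/

theorem codeSize_nat (k : ℕ) : codeSize k = 2 * k + 1 := by
  change (Data.ofList (List.replicate k .nil)).size = _
  induction k with
  | zero => rfl
  | succ k ih => rw [List.replicate_succ, Data.ofList, Data.size, ih, Data.size]; ring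

namespace WDigraph

variable {G : WDigraph} {n m : ℕ} {φ : CNF n m}

theorem Numbering.codeSize_le (N : Numbering G φ) :
    codeSize (G.nV, G.arcs) ≤ 2 * G.nV + 1 + (G.nE * (4 * G.nV + 19) + 1) + 1 := by
  have h : codeSize G.arcs ≤ G.arcs.length * (4 * G.nV + 18 + 1) + 1 := by
    refine codeSize_list_le fun a ha => ?_
    obtain ⟨e, rfl⟩ := mem_arcs.1 ha
    have h1 := (G.src e).2
    have h2 := (G.tgt e).2
    have h3 := codeSize_bool (decide (G.wt e < 0))
    have h4 : (G.wt e).num.natAbs ≤ 1 ∧ (G.wt e).den ≤ 2 := by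
      rw [N.wt_eq]
      cases N.arc e <;> norm_num [CNF.arcWt]
    change codeSize (((G.src e : ℕ), (G.tgt e : ℕ)), (decide (G.wt e < 0), (G.wt e).num.natAbs,
      (G.wt e).den)) ≤ _
    simp only [codeSize_pair, codeSize_nat]
    omega
  rw [arcs, List.length_ofFn] at h
  rw [codeSize_pair, codeSize_nat]
  exact Nat.add_le_add_right (Nat.add_le_add_left h _) 1

/-- The set of vectors that is generated: the extreme directions, and with them the extreme points
if `b` is true. -/
def target (b : Bool) (G : WDigraph) : Set (Fin G.nE → ℝ) :=
  if b = true then G.verts ∪ G.dirs else G.dirs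

theorem Kind.exists_cyc {o : Gen.Out} (h : G.Kind o) : ∃ L, G.Cyc L := by
  cases h with
  | zero L hL => exact ⟨L, hL⟩
  | pair L _ hL => exact ⟨L, hL⟩
  | vert L hL => exact ⟨L, hL⟩

theorem dirVecs_subset_candidates (b : Bool) (arcs : List Gen.A) (Ls : List (List Gen.A)) :
    Gen.dirVecs arcs Ls ⊆ Gen.candidates b arcs Ls := by
  cases b <;> simp [Gen.candidates]

theorem Numbering.exists_candidate_iff (N : Numbering G φ) (b : Bool) {Ls : List (List Gen.A)}
    (hLs : ∀ C, C ∈ Ls ↔ IsCyc Gen.src Gen.tgt C ∧ ∀ e ∈ C, e ∈ G.arcs) (x : Fin G.nE → ℝ) :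
    (∃ o ∈ Gen.candidates b G.arcs Ls, G.val o = x) ↔ x ∈ G.target b := by
  have hsound : ∀ C ∈ Ls, ∃ L, C = L.map G.arc ∧ G.Cyc L := fun C hC => by
    obtain ⟨L, rfl⟩ := exists_map_arc ((hLs C).1 hC).2
    exact ⟨L, rfl, Tidy.isCyc_iff.1 ((hLs _).1 hC).1⟩
  have hcomplete : ∀ L, G.Cyc L → ∃ L', L'.map G.arc ∈ Ls ∧ G.Cyc L' ∧ ∀ e, e ∈ L' ↔ e ∈ L := by
    refine fun L hL => ⟨L, (hLs _).2 ⟨Tidy.isCyc_iff.2 hL, fun a ha => ?_⟩, hL, fun _ => .rfl⟩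
    obtain ⟨e, -, rfl⟩ := List.mem_map.1 ha
    exact mem_arcs.2 ⟨e, rfl⟩
  have hdir : (∃ o ∈ Gen.dirVecs G.arcs Ls, G.val o = x) ↔ x ∈ G.dirs := by
    constructor
    · rintro ⟨o, ho, rfl⟩
      obtain ⟨hk, h⟩ := N.tidy.kind_of_mem_dirVecs hsound ho
      obtain ⟨L, hL⟩ := hk.exists_cyc
      exact h (N.polyhedron_nonempty hL)
    · intro hx
      by_cases hP : G.polyhedron.Nonempty
      · exact N.tidy.exists_dirVec hcomplete hP hx
      · rw [dirs_eq_empty hP] at hx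
        exact absurd hx (Set.notMem_empty x)
  have hvert : (∃ o ∈ Gen.vertVecs G.arcs Ls, G.val o = x) ↔ x ∈ G.verts := by
    constructor
    · rintro ⟨o, ho, rfl⟩
      exact (N.tidy.kind_of_mem_vertVecs hsound ho).2
    · exact N.tidy.exists_vertVec hcomplete
  cases b with
  | false => simpa [Gen.candidates, target] using hdir
  | true =>
    simp only [Gen.candidates, target, if_true, List.mem_append, Set.mem_union, ← hdir, ← hvert,
      or_and_right, exists_or]

end WDigraph

open Polynomial in
theorem generated_target (b : Bool) :
    GeneratedInIncrementalPolyTime cnfGraphs fun G => G.target b := by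
  obtain ⟨p, Q, h⟩ := Gen.exists_program b
  refine ⟨p, Q.comp (2 * X + 1 + (X * (4 * X + 19) + 1) + 1 +
    X * ((X + 2) + X + 1 + (X + 2) * (X + 2) * (X * X))), fun G hG => ?_⟩
  obtain ⟨n, m, φ, hφ⟩ := hG
  obtain ⟨N⟩ := hφ.nonempty_numbering
  obtain ⟨t, M, Ls, hrun, hout, hM, hLs, hcand, htime⟩ := h G.nV G.arcs
    (List.nodup_ofFn.2 N.tidy.inj)
  have hkind : ∀ o ∈ M, G.Kind o := fun o ho =>
    N.tidy.kind_of_mem_candidates (fun C hC => by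
      obtain ⟨L, rfl⟩ := WDigraph.exists_map_arc ((hLs C).1 hC).2
      exact ⟨L, rfl, WDigraph.Tidy.isCyc_iff.1 ((hLs _).1 hC).1⟩) ((hcand o).1 ho)
  refine ⟨t, by rwa [G.encode_eq], ⟨M.map G.val, ?_, fun x => ?_, ?_⟩, fun t' ht' => ?_⟩
  · exact hM.map_on fun o ho o' ho' he => (hkind o ho).ext (hkind o' ho') he
  · rw [← N.exists_candidate_iff b hLs, List.mem_map]
    simp only [hcand]
  · rw [hout, List.forall₂_map_left_iff, List.forall₂_map_right_iff, List.forall₂_same]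
    exact fun o ho => N.tidy.proper (hkind o ho)
  · obtain ⟨K, M', hK, hcyc, hdone, hcount, hsteps⟩ := htime t' ht'
    have hlen : K.length ≤ G.nE * ((M'.length + 2) + G.nE + 1 +
        (M'.length + 2) * (M'.length + 2) * (G.nE * G.nE)) := by
      rcases eq_or_ne K [] with rfl | hne
      · exact Nat.zero_le _
      · exact N.length_le K hK hcyc fun o ho =>
          hdone hne o (WDigraph.dirVecs_subset_candidates b _ _ ho)
    refine hsteps.trans ?_
    rw [eval_comp, eval_add]
    refine polynomial_eval_mono _ (Nat.add_le_add (N.codeSize_le.trans ?_) (hlen.trans ?_))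
    all_goals
      set x := G.nV + G.nE + t'.outputs.length
      have h1 : G.nV ≤ x := by omega
      have h2 : G.nE ≤ x := by omega
      have h3 : M'.length ≤ x := by omega
      simp only [eval_add, eval_mul, eval_X, eval_one, eval_ofNat]
      gcongr

end NegFlow

theorem proposition1 :
    NegFlow.GeneratedInIncrementalPolyTime NegFlow.cnfGraphs (fun G => G.dirs) ∧
    NegFlow.GeneratedInIncrementalPolyTime NegFlow.cnfGraphs (fun G => G.verts ∪ G.dirs) :=
  ⟨NegFlow.generated_target false, NegFlow.generated_target true⟩
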